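/- **Setting.** Let $L/\mathbb{Q}_p$ be a finite extension with ring of integers $\mathfrak{o}$, uniformizer $\varpi$ and residue field $\mathbb{F}_q=\mathfrak{o}/\varpi$. Let $\mathbb{X}_0=\mathbb{P}^1_{\mathfrak{o}}$ and, for $n\ge 0$, let $\mathbb{X}_{n+1}$ be the blow-up of $\mathbb{X}_n$ in the (reduced closed subscheme of the) smooth $\mathbb{F}_q$-rational points of its special fiber; let $\mathrm{pr}:\mathbb{X}_n\to\mathbb{P}^1_{\mathfrak{o}}$ be the iterated blow-up morphism. For $k\ge 0$ let $\mathbb{G}(k)$ be the affine group scheme over $\mathfrak{o}$ with $$\mathcal{O}(\mathbb{G}(k))=\mathfrak{o}\Big[a_k,b_k,c_k,d_k,\tfrac1{\Delta_k}\Big],\qquad \Delta_k=\det(1+\varpi^kX),\qquad X=\begin{pmatrix}a_k&b_k\\c_k&d_k\end{pmatrix},$$ and with comultiplication given, entry by entry, by $X\mapsto X+X'+\varpi^kXX'$, where $X=X\otimes1$ and $X'=1\otimes X$ (so $1+\varpi^kX$ is multiplicative, $\mathbb{G}(0)=\mathrm{GL}_{2,\mathfrak{o}}$ in the coordinates $g-1$,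 and $X\mapsto g=1+\varpi^kX$ is a homomorphism $\gamma_k:\mathbb{G}(k)\to\mathrm{GL}_{2,\mathfrak{o}}$). Let $\mathfrak{X}_n$ and $\widehat{\mathbb{G}}(k)$ be the formal completions of $\mathbb{X}_n$ and $\mathbb{G}(k)$ along their special fibers. Actions are right actions, and the natural action of $\mathrm{GL}_2$ on $\mathbb{P}^1$ is $([x_0:x_1],g)\mapsto[x_0:x_1]\,g$. **Proposition 2.1.** Let $k\ge n\ge 0$. There is an action $\sigma$ of $\mathbb{G}(k)$ on $\mathbb{X}_n$ with the following properties. (i) $\sigma:\mathbb{X}_n\times_{\mathfrak{o}}\mathbb{G}(k)\to\mathbb{X}_n$ extends the natural action of $\mathrm{GL}_{2,L}$ on $\mathbb{P}^1_L$. That is, $\mathrm{pr}$ and $\gamma_k$ induce isomorphisms $\mathbb{X}_n\times_{\mathfrak{o}}L\cong\mathbb{P}^1_L$ and $\mathbb{G}(k)\times_{\mathfrak{o}}L\cong\mathrm{GL}_{2,L}$, and these identify the base change of $\sigma$ to $L$ with the natural action. (ii) The morphism $\widehat\sigma:\mathfrak{X}_n\times\widehat{\mathbb{G}}(k)\to\mathfrak{X}_n$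 induced by $\sigma$ on the formal completions is an action of the formal group scheme $\widehat{\mathbb{G}}(k)$ on $\mathfrak{X}_n$. If $k>n$, then the induced action of the special fiber $\widehat{\mathbb{G}}(k)_s$ on the special fiber $\mathfrak{X}_{n,s}$ is trivial. -/

import Mathlib

open CategoryTheory Limits AlgebraicGeometry HomogeneousLocalization TensorProduct

universe u

namespace BlowupModel

section

lemma isPushout_of_injective {R S A B A' B' : Type u} [CommRing R] [CommRing S] [CommRing A]
    [CommRing B] [CommRing A'] [CommRing B']
    {f : R →+* S} (hf : f.Flat) {a : R →+* A} {b : S →+* B} {g : A →+* B}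
    {a' : R →+* A'} {b' : S →+* B'} {g' : A' →+* B'}
    (H : IsPushout (CommRingCat.ofHom f) (CommRingCat.ofHom a')
      (CommRingCat.ofHom b') (CommRingCat.ofHom g'))
    (v : A →+* A') (w : B →+* B') (hv : Function.Injective v) (hw : Function.Injective w)
    (hva : v.comp a = a') (hwb : w.comp b = b') (hvw : w.comp g = g'.comp v)
    (hsurj : ∀ y : B, y ∈ AddSubgroup.closure {z : B | ∃ s x, z = b s * g x}) :
    IsPushout (CommRingCat.ofHom f) (CommRingCat.ofHom a)
      (CommRingCat.ofHom b) (CommRingCat.ofHom g) := by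
  have hcomm (r : R) : g' (a' r) = b' (f r) := (congr($(H.w).hom r)).symm
  have hvw' (x) : w (g x) = g' (v x) := congr($hvw x)
  have hcomm' (r : R) : g (a r) = b (f r) := by
    apply hw
    rw [hvw']
    have h1 : w (b (f r)) = b' (f r) := congr($hwb _)
    rw [h1, ← hcomm, ← hva]; rfl
  algebraize [f, a, b, g, a', b', g', v, w, g.comp a, g'.comp a']
  have : IsScalarTower R S B := .of_algebraMap_eq hcomm'
  have : IsScalarTower R S B' := .of_algebraMap_eq hcomm
  have : IsScalarTower R A A' := .of_algebraMap_eq' hva.symm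
  have : IsScalarTower S B B' := .of_algebraMap_eq' hwb.symm
  have P : Algebra.IsPushout R S A' B' := CommRingCat.isPushout_iff_isPushout.mp H
  suffices Algebra.IsPushout R S A B from CommRingCat.isPushout_iff_isPushout.mpr this
  let W : S ⊗[R] A →ₗ[S] B :=
    LinearMap.liftBaseChange S (IsScalarTower.toAlgHom R A B).toLinearMap
  have hW (s x) : W (s ⊗ₜ x) = b s * g x := by
    simp only [W, LinearMap.liftBaseChange_tmul, Algebra.smul_def]; rfl
  let V : A →ₗ[R] A' := (IsScalarTower.toAlgHom R A A').toLinearMap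
  let e := P.out.equiv
  have hWV (x) : w (W x) = e (V.lTensor S x) := by
    induction x with
    | zero => simp
    | add x y hx hy => simp only [map_add, hx, hy]
    | tmul s x =>
      simp only [hW, e, LinearMap.lTensor_tmul, IsBaseChange.equiv_tmul, Algebra.smul_def, map_mul]
      congr 1
      · exact congr($hwb s)
      · exact hvw' x
  rw [Algebra.isPushout_iff]
  have hbij : Function.Bijective W := ?_
  · exact IsBaseChange.of_equiv (LinearEquiv.ofBijective W hbij)
      fun x ↦ (hW 1 x).trans (by simp; rfl)
  refine ⟨fun x y hxy ↦ ?_, fun y ↦ ?_⟩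
  · apply Module.Flat.lTensor_preserves_injective_linearMap (M := S) V hv
    apply e.injective
    rw [← hWV, ← hWV, hxy]
  · induction hsurj y using AddSubgroup.closure_induction with
    | mem y hy => obtain ⟨s, x, rfl⟩ := hy; exact ⟨s ⊗ₜ x, hW s x⟩
    | zero => exact ⟨0, map_zero _⟩
    | add x y _ _ hx hy =>
      obtain ⟨x, rfl⟩ := hx; obtain ⟨y, rfl⟩ := hy; exact ⟨x + y, map_add _ _ _⟩
    | neg x _ hx => obtain ⟨x, rfl⟩ := hx; exact ⟨-x, map_neg _ _⟩

lemma mem_closure_of_isPushout {R S A B : Type u} [CommRing R] [CommRing S] [CommRing A]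
    [CommRing B] {f : R →+* S} {a : R →+* A} {b : S →+* B} {g : A →+* B}
    (H : IsPushout (CommRingCat.ofHom f) (CommRingCat.ofHom a)
      (CommRingCat.ofHom b) (CommRingCat.ofHom g)) (y : B) :
    y ∈ AddSubgroup.closure {z : B | ∃ s x, z = b s * g x} := by
  have hcomm (r : R) : g (a r) = b (f r) := (congr($(H.w).hom r)).symm
  algebraize [f, a, b, g, g.comp a]
  have : IsScalarTower R S B := .of_algebraMap_eq hcomm
  have P : Algebra.IsPushout R S A B := CommRingCat.isPushout_iff_isPushout.mp H
  obtain ⟨t, rfl⟩ := P.out.equiv.surjective y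
  induction t with
  | zero => simp
  | add x y hx hy => rw [map_add]; exact add_mem hx hy
  | tmul s x =>
    refine AddSubgroup.subset_closure ⟨s, x, ?_⟩
    rw [IsBaseChange.equiv_tmul, Algebra.smul_def]; rfl

end
section
variable {R S A B : Type u} [CommRing R] [CommRing S] [CommRing A] [CommRing B]
  [Algebra R A] [Algebra S B]
  (𝒜 : ℕ → Submodule R A) (ℬ : ℕ → Submodule S B) [GradedAlgebra 𝒜] [GradedAlgebra ℬ]

/-- The structure homomorphism `R → A_(s)`. -/
noncomputable def awayStr (s : A) : R →+* Away 𝒜 s :=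
  (fromZeroRingHom 𝒜 _).comp (algebraMap R (𝒜 0))

lemma val_awayStr (s : A) (r : R) :
    (awayStr 𝒜 s r).val = algebraMap A (Localization.Away s) (algebraMap R A r) :=
  Localization.mk_one_eq_algebraMap _

variable {𝒜 ℬ}

lemma val_awayMap_eq (φ : GradedRingHom 𝒜 ℬ) (s : A) (x : Away 𝒜 s) :
    (Away.map φ s x).val = IsLocalization.map (Localization.Away (φ s)) φ.toRingHom
      (M := Submonoid.powers s) (T := Submonoid.powers (φ s))
      (Submonoid.powers_le.mpr (Submonoid.mem_powers _)) x.val := by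
  obtain ⟨c, rfl⟩ := HomogeneousLocalization.mk_surjective x
  rw [Away.map, map_mk, val_mk, val_mk, Localization.mk_eq_mk', Localization.mk_eq_mk',
    IsLocalization.map_mk']
  rfl

lemma away_isPushout {f : R →+* S} (hf : f.Flat) (φ : GradedRingHom 𝒜 ℬ)
    (H : IsPushout (CommRingCat.ofHom f) (CommRingCat.ofHom (algebraMap R A))
      (CommRingCat.ofHom (algebraMap S B)) (CommRingCat.ofHom φ.toRingHom))
    {i : ℕ} {s : A} (hs : s ∈ 𝒜 i) :
    IsPushout (CommRingCat.ofHom f) (CommRingCat.ofHom (awayStr 𝒜 s))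
      (CommRingCat.ofHom (awayStr ℬ (φ s))) (CommRingCat.ofHom (Away.map φ s)) := by
  let m : Localization.Away s →+* Localization.Away (φ s) :=
    IsLocalization.map (Localization.Away (φ s)) φ.toRingHom
      (M := Submonoid.powers s) (T := Submonoid.powers (φ s))
      (Submonoid.powers_le.mpr (Submonoid.mem_powers _))
  have : IsLocalization (Submonoid.map φ.toRingHom (Submonoid.powers s))
      (Localization.Away (φ s)) := by
    rw [Submonoid.map_powers]; exact inferInstanceAs (IsLocalization.Away (φ s) _)
  have hloc := CommRingCat.isPushout_of_isLocalization φ.toRingHom m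
    (IsLocalization.map_comp _) (Submonoid.powers s)
  have H' := H.paste_vert hloc
  rw [← CommRingCat.ofHom_comp, ← CommRingCat.ofHom_comp] at H'
  refine isPushout_of_injective hf H' (algebraMap _ _) (algebraMap _ _)
    (val_injective _) (val_injective _) (RingHom.ext fun r ↦ val_awayStr _ _ _)
    (RingHom.ext fun r ↦ val_awayStr _ _ _) (RingHom.ext fun r ↦ val_awayMap_eq _ _ _) fun y ↦ ?_
  have hs' : φ s ∈ ℬ i := φ.map_mem hs
  obtain ⟨n, b, hb, rfl⟩ := Away.mk_surjective ℬ hs' y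
  let q : B →+ Away ℬ (φ s) :=
    { toFun := fun b ↦ Away.mk ℬ hs' n (DirectSum.decompose ℬ b (n • i)) (SetLike.coe_mem _)
      map_zero' := val_injective _ (by simp [Away.val_mk, Localization.mk_zero])
      map_add' := fun x y ↦ val_injective _ (by
        rw [val_add, Away.val_mk, Away.val_mk, Away.val_mk, Localization.add_mk_self]
        simp) }
  have hqb : Away.mk ℬ hs' n b hb = q b := val_injective _ (by
    change _ = HomogeneousLocalization.val (Away.mk ℬ hs' n _ _)
    rw [Away.val_mk, Away.val_mk, DirectSum.decompose_of_mem_same ℬ hb])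
  rw [hqb]
  have hq (b' : B) (hb' : b' ∈ AddSubgroup.closure
      {z : B | ∃ s x, z = algebraMap S B s * φ.toRingHom x}) :
      q b' ∈ AddSubgroup.closure {z | ∃ c x, z = awayStr ℬ (φ s) c * Away.map φ s x} := by
    induction hb' using AddSubgroup.closure_induction with
    | mem z hz =>
      obtain ⟨c, x, rfl⟩ := hz
      refine AddSubgroup.subset_closure ⟨c, Away.mk 𝒜 hs n (DirectSum.decompose 𝒜 x (n • i))
        (SetLike.coe_mem _), val_injective _ ?_⟩
      change HomogeneousLocalization.val (Away.mk ℬ hs' n _ _) = _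
      have h1 : φ ((DirectSum.decompose 𝒜 x (n • i) : 𝒜 (n • i)) : A) =
        DirectSum.decompose ℬ (φ x) (n • i) := φ.map_directSumDecompose
      rw [val_mul, val_awayStr, Away.map_mk, Away.val_mk, Away.val_mk,
        ← Localization.mk_one_eq_algebraMap, Localization.mk_mul, one_mul, h1]
      congr 1
      rw [← Algebra.smul_def, ← Algebra.smul_def, DirectSum.decompose_smul]
      rfl
    | zero => simp
    | add x y _ _ hx hy => rw [map_add]; exact add_mem hx hy
    | neg x _ hx => rw [map_neg]; exact neg_mem hx
  exact hq b (mem_closure_of_isPushout H b)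

variable (𝒜) in
/-- The structure morphism `Proj A → Spec R` of a graded `R`-algebra `A`. -/
noncomputable def projStr : Proj 𝒜 ⟶ Spec (.of R) :=
  Proj.toSpecZero 𝒜 ≫ Spec.map (CommRingCat.ofHom (algebraMap R (𝒜 0)))

lemma awayι_projStr {i : ℕ} (hi : 0 < i) {s : A} (hs : s ∈ 𝒜 i) :
    Proj.awayι 𝒜 s hs hi ≫ projStr 𝒜 = Spec.map (CommRingCat.ofHom (awayStr 𝒜 s)) := by
  rw [projStr, Proj.awayι_toSpecZero_assoc, ← Spec.map_comp]
  rfl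

open HomogeneousIdeal in
lemma proj_isPullback {f : R →+* S} (hf : f.Flat) (φ : GradedRingHom 𝒜 ℬ)
    (hφ : irrelevant ℬ ≤ (irrelevant 𝒜).map φ)
    (H : IsPushout (CommRingCat.ofHom f) (CommRingCat.ofHom (algebraMap R A))
      (CommRingCat.ofHom (algebraMap S B)) (CommRingCat.ofHom φ.toRingHom)) :
    IsPullback (Proj.map φ hφ) (projStr ℬ) (projStr 𝒜) (Spec.map (CommRingCat.ofHom f)) := by
  refine Scheme.isPullback_of_openCover _ _ _ _ (Proj.affineOpenCover 𝒜).openCover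
    fun ⟨⟨d, hd⟩, s, hs0⟩ ↦ ?_
  have hs : s ∈ 𝒜 d := hs0
  have hs' : φ s ∈ ℬ d := φ.map_mem hs
  have i1 : IsOpenImmersion (Proj.awayι 𝒜 s hs hd) := inferInstance
  have i2 : IsOpenImmersion (Proj.awayι ℬ (φ s) hs' hd) := inferInstance
  have h1 : IsPullback (Spec.map (CommRingCat.ofHom (Away.map φ s))) (Proj.awayι ℬ (φ s) hs' hd)
      (Proj.awayι 𝒜 s hs hd) (Proj.map φ hφ) := by
    refine IsOpenImmersion.isPullback _ _ _ _ (Proj.awayι_comp_map φ hφ hd s hs) ?_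
    rw [Proj.opensRange_awayι, Proj.opensRange_awayι, Proj.map_preimage_basicOpen]
  have h2 := isPullback_SpecMap_of_isPushout _ _ _ _ (away_isPushout hf φ H hs).flip
  refine h2.of_iso (h1.flip.isoPullback) (Iso.refl _) (Iso.refl _) (Iso.refl _) ?_ ?_ ?_ ?_
  · exact (Category.comp_id _).trans h1.flip.isoPullback_hom_snd.symm
  · refine ((Category.comp_id _).trans (awayι_projStr hd hs').symm).trans ?_
    exact (h1.flip.isoPullback_hom_fst_assoc _).symm
  · exact ((Category.comp_id _).trans (awayι_projStr hd hs).symm).trans (Category.id_comp _).symm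
  · simp
end

section
variable {R S A B : Type u} [CommRing R] [CommRing S] [CommRing A] [CommRing B]
  [Algebra R A] [Algebra S B]
  {𝒜 : ℕ → Submodule R A} {ℬ : ℕ → Submodule S B} [GradedAlgebra 𝒜] [GradedAlgebra ℬ]

open HomogeneousIdeal in
lemma irrelevant_le_of_isPushout {f : R →+* S} (φ : GradedRingHom 𝒜 ℬ)
    (H : IsPushout (CommRingCat.ofHom f) (CommRingCat.ofHom (algebraMap R A))
      (CommRingCat.ofHom (algebraMap S B)) (CommRingCat.ofHom φ.toRingHom)) :
    irrelevant ℬ ≤ (irrelevant 𝒜).map φ := by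
  refine (irrelevant_le ℬ).mpr fun n hn b hb ↦ ?_
  have hq (b' : B) (hb' : b' ∈ AddSubgroup.closure
      {z : B | ∃ s x, z = algebraMap S B s * φ.toRingHom x}) :
      (DirectSum.decompose ℬ b' n : B) ∈ (irrelevant 𝒜).toIdeal.map φ := by
    induction hb' using AddSubgroup.closure_induction with
    | mem z hz =>
      obtain ⟨c, x, rfl⟩ := hz
      have h1 : φ ((DirectSum.decompose 𝒜 x n : 𝒜 n) : A) =
        DirectSum.decompose ℬ (φ x) n := φ.map_directSumDecompose
      rw [← Algebra.smul_def, DirectSum.decompose_smul]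
      change c • ((DirectSum.decompose ℬ (φ x) n : ℬ n) : B) ∈ _
      rw [← h1, Algebra.smul_def]
      exact Ideal.mul_mem_left _ _ (Ideal.mem_map_of_mem _
        (mem_irrelevant_of_mem _ hn (SetLike.coe_mem _)))
    | zero => simp
    | add x y _ _ hx hy => simpa using add_mem hx hy
    | neg x _ hx =>
      rw [DirectSum.decompose_neg]
      exact neg_mem hx
  have := hq b (mem_closure_of_isPushout H b)
  rwa [DirectSum.decompose_of_mem_same ℬ hb] at this
end

section
variable {R S : Type u} [CommRing R] [CommRing S]
open Polynomial

/-- The degree `n` part `Iⁿ tⁿ` of the Rees algebra `⨁ₙ Iⁿ tⁿ ⊆ R[t]`. -/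
noncomputable def reesGrading (I : Ideal R) (n : ℕ) : Submodule R (reesAlgebra I) :=
  (LinearMap.range (monomial n : R →ₗ[R] R[X])).comap (reesAlgebra I).val.toLinearMap

lemma mem_reesGrading {I : Ideal R} {n : ℕ} {x : reesAlgebra I} :
    x ∈ reesGrading I n ↔ monomial n (x.1.coeff n) = x.1 := by
  constructor
  · rintro ⟨r, hr⟩
    change monomial n r = x.1 at hr
    rw [← hr, coeff_monomial_same]
  · intro h
    exact ⟨_, h⟩

/-- The component of degree `n` of an element of the Rees algebra. -/
noncomputable def reesComponent (I : Ideal R) (n : ℕ) : reesAlgebra I →ₗ[R] reesGrading I n where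
  toFun x := ⟨⟨monomial n (x.1.coeff n), reesAlgebra.monomial_mem.mpr (x.2 n)⟩, ⟨_, rfl⟩⟩
  map_add' x y := by ext : 2; simp
  map_smul' r x := by ext : 2; simp [smul_monomial]

noncomputable instance (I : Ideal R) : GradedAlgebra (reesGrading I) where
  one_mem := ⟨1, rfl⟩
  mul_mem := by
    rintro i j x y ⟨a, ha⟩ ⟨b, hb⟩
    refine ⟨a * b, ?_⟩
    rw [← monomial_mul_monomial, ha, hb]
    rfl
  toDecomposition := by
    classical
    have key (x : reesAlgebra I) (i : ℕ) :
        (∑ j ∈ x.1.support, DirectSum.lof R ℕ (fun i ↦ reesGrading I i) j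
          (reesComponent I j x)) i = reesComponent I i x := by
      rw [DFinsupp.finsetSum_apply, Finset.sum_eq_single i]
      · exact DirectSum.lof_apply _ _ _
      · intro j _ hj
        exact DFinsupp.single_eq_of_ne hj.symm
      · intro hi
        have : reesComponent I i x = 0 := by
          ext : 2
          simp [reesComponent, Polynomial.notMem_support_iff.mp hi]
        rw [this, map_zero]
        rfl
    refine .ofLinearMap _
      { toFun := fun x ↦ ∑ j ∈ x.1.support, DirectSum.lof R ℕ (fun i ↦ reesGrading I i) j
          (reesComponent I j x)
        map_add' := fun x y ↦ ?_
        map_smul' := fun r x ↦ ?_ } ?_ ?_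
    · refine DFinsupp.ext fun i ↦ ?_
      rw [DirectSum.add_apply, key, key, key, map_add]
    · refine DFinsupp.ext fun i ↦ ?_
      rw [key, map_smul]
      exact congr(r • $(key x i)).symm
    · refine LinearMap.ext fun x ↦ Subtype.ext ?_
      change ((DirectSum.coeLinearMap (reesGrading I) (∑ j ∈ x.1.support, _) :
        reesAlgebra I) : R[X]) = x.1
      simp only [map_sum, DirectSum.coeLinearMap_lof]
      rw [AddSubmonoidClass.coe_finsetSum]
      exact x.1.as_sum_support.symm
    · refine DirectSum.linearMap_ext _ fun i ↦ LinearMap.ext fun x ↦ DFinsupp.ext fun j ↦ ?_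
      simp only [LinearMap.comp_apply, LinearMap.id_apply, DirectSum.coeLinearMap_lof]
      refine (key _ j).trans ?_
      have hx := mem_reesGrading.mp x.2
      by_cases hij : i = j
      · subst hij
        rw [DirectSum.lof_apply]
        exact Subtype.ext (Subtype.ext hx)
      · refine Eq.trans ?_ ((congr($(DirectSum.lof_eq_of R ℕ (fun i ↦ reesGrading I i) i x) j)).trans
          (DirectSum.of_eq_of_ne _ _ _ (Ne.symm hij))).symm
        refine Subtype.ext (Subtype.ext ?_)
        change monomial j (x.1.1.coeff j) = 0
        rw [← hx, coeff_monomial_of_ne _ (Ne.symm hij), map_zero]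

/-- The homomorphism of Rees algebras induced by `f : R → S` with `f(I) S ⊆ J`. -/
noncomputable def reesMap (f : R →+* S) {I : Ideal R} {J : Ideal S} (h : I.map f ≤ J) :
    GradedRingHom (reesGrading I) (reesGrading J) where
  toRingHom := ((mapRingHom f).comp (reesAlgebra I).val.toRingHom).codRestrict
    (reesAlgebra J).toSubring fun x i ↦ by
      change (Polynomial.map f x.1).coeff i ∈ J ^ i
      rw [coeff_map]
      exact Ideal.pow_right_mono h i (Ideal.map_pow f I i ▸ Ideal.mem_map_of_mem f (x.2 i))
  map_mem := by
    rintro i x ⟨a, ha⟩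
    refine ⟨f a, ?_⟩
    change monomial i (f a) = Polynomial.map f x.1
    rw [← map_monomial]
    exact congr(Polynomial.map f $ha)

lemma coe_reesMap (f : R →+* S) {I : Ideal R} {J : Ideal S} (h : I.map f ≤ J)
    (x : reesAlgebra I) : (reesMap f h x).1 = Polynomial.map f x.1 := rfl

lemma mul_mem_closure {S A B : Type u} [CommRing S] [CommRing A] [CommRing B]
    (b : S →+* B) (g : A →+* B) (r : S) {t : B}
    (ht : t ∈ AddSubgroup.closure {z : B | ∃ s x, z = b s * g x}) :
    b r * t ∈ AddSubgroup.closure {z : B | ∃ s x, z = b s * g x} := by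
  induction ht using AddSubgroup.closure_induction with
  | mem t ht =>
    obtain ⟨s, x, rfl⟩ := ht
    exact AddSubgroup.subset_closure ⟨r * s, x, by rw [map_mul, mul_assoc]⟩
  | zero => simp
  | add x y _ _ hx hy => rw [mul_add]; exact add_mem hx hy
  | neg x _ hx => rw [mul_neg]; exact neg_mem hx

lemma reesMap_isPushout {f : R →+* S} (hf : f.Flat) {I : Ideal R} {J : Ideal S}
    (h : I.map f = J) :
    IsPushout (CommRingCat.ofHom f) (CommRingCat.ofHom (algebraMap R (reesAlgebra I)))
      (CommRingCat.ofHom (algebraMap S (reesAlgebra J)))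
      (CommRingCat.ofHom (reesMap f h.le).toRingHom) := by
  have H : IsPushout (CommRingCat.ofHom f) (CommRingCat.ofHom (C : R →+* R[X]))
      (CommRingCat.ofHom (C : S →+* S[X])) (CommRingCat.ofHom (mapRingHom f)) := by
    algebraize [f]
    let : Algebra R[X] S[X] := Polynomial.algebra R S
    exact CommRingCat.isPushout_of_isPushout R S R[X] S[X]
  refine isPushout_of_injective hf H (reesAlgebra I).val.toRingHom (reesAlgebra J).val.toRingHom
    Subtype.val_injective Subtype.val_injective rfl rfl rfl fun y ↦ ?_
  set T := AddSubgroup.closure {z : reesAlgebra J | ∃ s x,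
    z = algebraMap S (reesAlgebra J) s * (reesMap f h.le).toRingHom x} with hT
  have hy : y = ∑ i ∈ y.1.support, (reesComponent J i y : reesAlgebra J) := by
    apply Subtype.ext
    rw [AddSubmonoidClass.coe_finsetSum]
    exact y.1.as_sum_support
  rw [hy]
  refine sum_mem fun i _ ↦ ?_
  have aux (c : S) (hc : c ∈ (I ^ i).map f) (hc' : c ∈ J ^ i) :
      (⟨monomial i c, reesAlgebra.monomial_mem.mpr hc'⟩ : reesAlgebra J) ∈ T := by
    induction hc using Submodule.span_induction with
    | mem c hc =>
      obtain ⟨a, ha, rfl⟩ := hc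
      refine AddSubgroup.subset_closure ⟨1, ⟨monomial i a, reesAlgebra.monomial_mem.mpr ha⟩, ?_⟩
      rw [map_one, one_mul]
      exact Subtype.ext (map_monomial f).symm
    | zero =>
      convert zero_mem T
      exact map_zero (monomial i)
    | add c d hc hd h1 h2 =>
      have hpow : (I ^ i).map f = J ^ i := by rw [Ideal.map_pow, h]
      convert add_mem (h1 (hpow ▸ hc)) (h2 (hpow ▸ hd))
      exact map_add (monomial i) _ _
    | smul r c hc h1 =>
      have hpow : (I ^ i).map f = J ^ i := by rw [Ideal.map_pow, h]
      have h2 := h1 (hpow ▸ hc)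
      convert mul_mem_closure (algebraMap S (reesAlgebra J)) (reesMap f h.le).toRingHom r h2
      change monomial i (r * c) = C r * monomial i c
      rw [C_mul_monomial]
  exact aux _ (by rw [Ideal.map_pow, h]; exact y.2 i) (y.2 i)

end

section
variable {X : Scheme.{u}} (I : X.IdealSheafData)

/-- Over an affine open `U`, the blow-up is `Proj` of the Rees algebra of `I(U)`. -/
noncomputable abbrev blowUpChart (U : X.affineOpens) : Scheme.{u} :=
  Proj (reesGrading (I.ideal U))

/-- The restriction homomorphism `Γ(V) → Γ(U)` for affine opens `U ≤ V`. -/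
noncomputable abbrev resHom {U V : X.affineOpens} (h : U ≤ V) : Γ(X, V) →+* Γ(X, U) :=
  (X.presheaf.map (homOfLE (show U.1 ≤ V.1 from h)).op).hom

lemma resHom_flat {U V : X.affineOpens} (h : U ≤ V) : (resHom h).Flat := by
  have h0 : U.1 ≤ V.1 := h
  have hU : IsAffineOpen U.1 := U.2
  have hV : IsAffineOpen V.1 := V.2
  have h1 : Spec.map (X.presheaf.map (homOfLE h0).op) ≫ hV.fromSpec = hU.fromSpec :=
    IsAffineOpen.map_fromSpec hV hU (homOfLE h0).op
  have h2 : IsOpenImmersion (Spec.map (X.presheaf.map (homOfLE h0).op) ≫ hV.fromSpec) := by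
    rw [h1]; infer_instance
  have h3 : IsOpenImmersion (Spec.map (X.presheaf.map (homOfLE h0).op)) :=
    IsOpenImmersion.of_comp _ hV.fromSpec
  exact Flat.SpecMap_iff.mp (inferInstance : Flat (Spec.map (X.presheaf.map (homOfLE h0).op)))

lemma projMap_congr {R S A B : Type u} [CommRing R] [CommRing S] [CommRing A] [CommRing B]
    [Algebra R A] [Algebra S B] {𝒜 : ℕ → Submodule R A} {ℬ : ℕ → Submodule S B}
    [GradedAlgebra 𝒜] [GradedAlgebra ℬ] {φ ψ : GradedRingHom 𝒜 ℬ} (h : φ = ψ) (hφ) (hψ) :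
    Proj.map φ hφ = Proj.map ψ hψ := by
  subst h; rfl

lemma map_ideal_resHom {U V : X.affineOpens} (h : U ≤ V) :
    (I.ideal V).map (resHom h) = I.ideal U := I.map_ideal h

lemma irrelevant_le_reesMap {U V : X.affineOpens} (h : U ≤ V) :
    HomogeneousIdeal.irrelevant (reesGrading (I.ideal U)) ≤
      (HomogeneousIdeal.irrelevant (reesGrading (I.ideal V))).map
        (reesMap (resHom h) (map_ideal_resHom I h).le) :=
  irrelevant_le_of_isPushout _ (reesMap_isPushout (resHom_flat h) (map_ideal_resHom I h))

/-- The open immersion of charts for `U ≤ V`. -/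
noncomputable def blowUpChartMap {U V : X.affineOpens} (h : U ≤ V) :
    blowUpChart I U ⟶ blowUpChart I V :=
  Proj.map (reesMap (resHom h) (map_ideal_resHom I h).le) (irrelevant_le_reesMap I h)

/-- The structure morphism of a chart. -/
noncomputable def blowUpChartStr (U : X.affineOpens) : blowUpChart I U ⟶ U.1.toScheme :=
  projStr (reesGrading (I.ideal U)) ≫ (IsAffineOpen.isoSpec U.2).inv

lemma isoSpec_inv_homOfLE {U V : X.Opens} (hU : IsAffineOpen U) (hV : IsAffineOpen V)
    (h : U ≤ V) : Spec.map (X.presheaf.map (homOfLE h).op) ≫ hV.isoSpec.inv =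
      hU.isoSpec.inv ≫ X.homOfLE h := by
  rw [Iso.eq_inv_comp, ← Category.assoc, Iso.comp_inv_eq, IsAffineOpen.isoSpec_hom,
    IsAffineOpen.isoSpec_hom]
  exact Scheme.Opens.toSpecΓ_SpecMap_presheaf_map ..

lemma blowUpChart_isPullback {U V : X.affineOpens} (h : U ≤ V) :
    IsPullback (blowUpChartMap I h) (blowUpChartStr I U) (blowUpChartStr I V)
      (X.homOfLE (show U.1 ≤ V.1 from h)) := by
  have := proj_isPullback (resHom_flat h) (reesMap (resHom h) (map_ideal_resHom I h).le)
    (irrelevant_le_reesMap I h) (reesMap_isPushout (resHom_flat h) (map_ideal_resHom I h))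
  refine this.of_iso (Iso.refl _) (Iso.refl _) (IsAffineOpen.isoSpec U.2).symm
    (IsAffineOpen.isoSpec V.2).symm ?_ ?_ ?_ ?_
  · exact (Category.comp_id _).trans (Category.id_comp _).symm
  · simp [blowUpChartStr]
  · simp [blowUpChartStr]
  · exact isoSpec_inv_homOfLE U.2 V.2 h

/-- The gluing datum of the blow-up. -/
noncomputable def blowUpData : X.directedAffineCover.RelativeGluingData where
  functor :=
    { obj := fun U : X.affineOpens ↦ blowUpChart I U
      map := fun h ↦ blowUpChartMap I (leOfHom h)
      map_id := fun U ↦ by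
        refine (projMap_congr ?_ _ (by simp)).trans Proj.map_id
        refine DFunLike.ext _ _ fun x ↦ Subtype.ext ?_
        change Polynomial.map (X.presheaf.map (𝟙 _)).hom x.1 = x.1
        rw [X.presheaf.map_id]
        exact Polynomial.map_id
      map_comp := fun {U V W} h h' ↦ by
        refine Eq.trans (projMap_congr ?_ _
          (HomogeneousIdeal.irrelevant_le_map_comp (irrelevant_le_reesMap I (leOfHom h'))
            (irrelevant_le_reesMap I (leOfHom h)))) (Proj.map_comp _ _ _ _)
        refine DFunLike.ext _ _ fun x ↦ Subtype.ext ?_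
        change Polynomial.map (resHom _) x.1 = Polynomial.map (resHom (leOfHom h))
          (Polynomial.map (resHom (leOfHom h')) x.1)
        rw [Polynomial.map_map]
        congr 1
        exact congrArg CommRingCat.Hom.hom (X.presheaf.map_comp
          (homOfLE (show V.1 ≤ W.1 from leOfHom h')).op
          (homOfLE (show U.1 ≤ V.1 from leOfHom h)).op) }
  natTrans :=
    { app := fun U : X.affineOpens ↦ blowUpChartStr I U
      naturality := fun U V h ↦ (blowUpChart_isPullback I (leOfHom h)).w }
  equifibered := by
    intro U V h
    exact blowUpChart_isPullback I (leOfHom h)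

/-- The blow-up of the scheme `X` in the ideal sheaf `I`: the relative `Proj` of the
Rees algebra `⨁ₙ Iⁿ`, glued from `Proj (⨁ₙ I(U)ⁿ)` over the affine opens `U` of `X`. -/
noncomputable def blowUp : Scheme.{u} := (blowUpData I).glued

/-- The projection of the blow-up to `X`. -/
noncomputable def blowUpToBase : blowUp I ⟶ X := (blowUpData I).toBase

end

section
variable {R S A B : Type u} [CommRing R] [CommRing S] [CommRing A] [CommRing B]
  [Algebra R A] [Algebra S B]
  {𝒜 : ℕ → Submodule R A} {ℬ : ℕ → Submodule S B} [GradedAlgebra 𝒜] [GradedAlgebra ℬ]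

open HomogeneousIdeal in
lemma awayι_projMap_projStr (f : R →+* S) (φ : GradedRingHom 𝒜 ℬ)
    (hφ : irrelevant ℬ ≤ (irrelevant 𝒜).map φ)
    (hf : ∀ r, φ (algebraMap R A r) = algebraMap S B (f r)) {i : ℕ} (hi : 0 < i) {s : A}
    (hs : s ∈ 𝒜 i) :
    Proj.awayι ℬ (φ s) (φ.2 hs) hi ≫ Proj.map φ hφ ≫ projStr 𝒜 =
      Proj.awayι ℬ (φ s) (φ.2 hs) hi ≫ projStr ℬ ≫ Spec.map (CommRingCat.ofHom f) := by
  rw [Proj.awayι_comp_map_assoc φ hφ hi s hs, awayι_projStr hi hs,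
    reassoc_of% awayι_projStr hi (show φ s ∈ ℬ i from φ.2 hs), ← Spec.map_comp, ← Spec.map_comp,
    ← CommRingCat.ofHom_comp, ← CommRingCat.ofHom_comp]
  congr 2
  refine RingHom.ext fun r ↦ val_injective _ ?_
  change (Away.map φ s (awayStr 𝒜 s r)).val = (awayStr ℬ (φ s) (f r)).val
  rw [val_awayMap_eq, val_awayStr, val_awayStr, IsLocalization.map_eq]
  exact congrArg _ (hf r)

open HomogeneousIdeal in
lemma projMap_projStr (f : R →+* S) (φ : GradedRingHom 𝒜 ℬ)
    (hφ : irrelevant ℬ ≤ (irrelevant 𝒜).map φ)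
    (hf : ∀ r, φ (algebraMap R A r) = algebraMap S B (f r)) :
    Proj.map φ hφ ≫ projStr 𝒜 = projStr ℬ ≫ Spec.map (CommRingCat.ofHom f) :=
  (Proj.mapAffineOpenCover φ hφ).openCover.hom_ext _ _ fun s ↦
    awayι_projMap_projStr f φ hφ hf s.1.2 s.2.2

end

section
open MvPolynomial
attribute [local instance] MvPolynomial.gradedAlgebra

/-- The standard grading of `R[x₀, x₁]`. -/
noncomputable abbrev coordGrading (R : Type u) [CommRing R] :
    ℕ → Submodule R (MvPolynomial (Fin 2) R) :=
  homogeneousSubmodule (Fin 2) R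

/-- The projective line `ℙ¹_R = Proj R[x₀, x₁]` as a scheme over `Spec R`. -/
noncomputable def P1 (R : Type u) [CommRing R] : Over (Spec (.of R)) :=
  Over.mk (projStr (coordGrading R))

variable {R S : Type u} [CommRing R] [CommRing S]

/-- The homomorphism of graded rings `R[x₀, x₁] → S[x₀, x₁]` which is given by `f` on the
coefficients and by `x_j ↦ ∑ i, M i j * x_i` on the variables. -/
noncomputable def linearSubst (f : R →+* S) (M : Matrix (Fin 2) (Fin 2) S) :
    GradedRingHom (coordGrading R) (coordGrading S) where
  toRingHom := eval₂Hom (C.comp f) fun j ↦ ∑ i, C (M i j) * X i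
  map_mem {n x} hx := by
    rw [← one_mul n]
    exact IsHomogeneous.eval₂ hx _ _ (fun r ↦ isHomogeneous_C _ _) fun j ↦
      IsHomogeneous.sum _ _ _ fun i _ ↦ by
        simpa using (isHomogeneous_C (Fin 2) (M i j)).mul (isHomogeneous_X S i)

lemma linearSubst_C (f : R →+* S) (M : Matrix (Fin 2) (Fin 2) S) (r : R) :
    linearSubst f M (C r) = C (f r) := eval₂_C _ _ _

lemma linearSubst_X (f : R →+* S) (M : Matrix (Fin 2) (Fin 2) S) (j : Fin 2) :
    linearSubst f M (X j) = ∑ i, C (M i j) * X i := eval₂_X _ _ _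

lemma irrelevant_le_of_X_mem (J : HomogeneousIdeal (coordGrading R)) (h : ∀ i, X i ∈ J) :
    HomogeneousIdeal.irrelevant (coordGrading R) ≤ J := by
  refine (HomogeneousIdeal.irrelevant_le _).mpr fun n hn p hp ↦ ?_
  have h1 : Ideal.span (X '' (Set.univ : Set (Fin 2))) ≤ J.toIdeal :=
    Ideal.span_le.mpr (by rintro _ ⟨i, -, rfl⟩; exact h i)
  refine h1 (mem_ideal_span_X_image.mpr fun m hm ↦ ?_)
  have hp' : IsHomogeneous p n := hp
  have h2 : m ≠ 0 := by
    rintro rfl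
    have := hp' (mem_support_iff.mp hm)
    simp at this
    omega
  obtain ⟨i, hi⟩ := Finsupp.ne_iff.mp h2
  exact ⟨i, trivial, by simpa using hi⟩

lemma irrelevant_le_linearSubst (f : R →+* S) {M : Matrix (Fin 2) (Fin 2) S}
    (hM : IsUnit M.det) :
    HomogeneousIdeal.irrelevant (coordGrading S) ≤
      (HomogeneousIdeal.irrelevant (coordGrading R)).map (linearSubst f M) := by
  refine irrelevant_le_of_X_mem _ fun i ↦ ?_
  have h1 : (X i : MvPolynomial (Fin 2) S) = ∑ j, C (M⁻¹ j i) * linearSubst f M (X j) := by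
    simp only [linearSubst_X, Finset.mul_sum]
    rw [Finset.sum_comm]
    have h2 (k : Fin 2) : ∑ j, C (M⁻¹ j i) * (C (M k j) * X k) =
        C ((M * M⁻¹) k i) * (X k : MvPolynomial (Fin 2) S) := by
      rw [Matrix.mul_apply, map_sum, Finset.sum_mul]
      exact Finset.sum_congr rfl fun j _ ↦ by rw [C_mul]; ring
    simp only [h2, Matrix.mul_nonsing_inv M hM, Matrix.one_apply]
    simp
  rw [h1]
  refine Ideal.sum_mem _ fun j _ ↦ Ideal.mul_mem_left _ _ (Ideal.mem_map_of_mem _ ?_)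
  exact HomogeneousIdeal.mem_irrelevant_of_mem _ one_pos (isHomogeneous_X R j)

/-- The morphism `ℙ¹_S → ℙ¹_R`, `[x₀ : x₁] ↦ [x₀ : x₁] M`, over `Spec f : Spec S → Spec R`, for
an invertible matrix `M` with entries in `S`. -/
noncomputable def P1.map (f : R →+* S) (M : Matrix (Fin 2) (Fin 2) S) (hM : IsUnit M.det) :
    (P1 S).left ⟶ (P1 R).left :=
  Proj.map (linearSubst f M) (irrelevant_le_linearSubst f hM)

lemma P1.map_hom (f : R →+* S) (M : Matrix (Fin 2) (Fin 2) S) (hM : IsUnit M.det) :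
    P1.map f M hM ≫ (P1 R).hom = (P1 S).hom ≫ Spec.map (CommRingCat.ofHom f) :=
  projMap_projStr f _ _ fun r ↦ linearSubst_C f M r

/-- The morphism `ℙ¹_S → ℙ¹_R` induced by a ring homomorphism `f : R → S`. -/
noncomputable def P1.baseMap (f : R →+* S) : (P1 S).left ⟶ (P1 R).left :=
  P1.map f 1 (by simp)

lemma P1.baseMap_isPullback {f : R →+* S} (hf : f.Flat) :
    IsPullback (P1.baseMap f) (P1 S).hom (P1 R).hom (Spec.map (CommRingCat.ofHom f)) := by
  refine proj_isPullback hf _ _ ?_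
  have : (linearSubst f (1 : Matrix (Fin 2) (Fin 2) S)).toRingHom = MvPolynomial.map f := by
    refine MvPolynomial.ringHom_ext (fun r ↦ ?_) fun j ↦ ?_
    · exact (linearSubst_C f 1 r).trans (map_C f r).symm
    · refine (linearSubst_X f 1 j).trans ?_
      simp [Matrix.one_apply]
  rw [this]
  algebraize [f]
  let : Algebra (MvPolynomial (Fin 2) R) (MvPolynomial (Fin 2) S) := algebraMvPolynomial
  exact CommRingCat.isPushout_of_isPushout R S (MvPolynomial (Fin 2) R) (MvPolynomial (Fin 2) S)

variable (R) in
/-- The coordinate ring `R[g₀₀, g₀₁, g₁₀, g₁₁, 1 / det g]` of `GL₂`. -/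
abbrev GL2Ring : Type u := Localization.Away (Matrix.mvPolynomialX (Fin 2) (Fin 2) R).det

variable (R) in
/-- The universal invertible matrix. -/
noncomputable def GL2Ring.univ : Matrix (Fin 2) (Fin 2) (GL2Ring R) :=
  (Matrix.mvPolynomialX (Fin 2) (Fin 2) R).map (algebraMap _ (GL2Ring R))

lemma GL2Ring.isUnit_det_univ : IsUnit (GL2Ring.univ R).det := by
  have : (GL2Ring.univ R).det =
      algebraMap _ (GL2Ring R) (Matrix.mvPolynomialX (Fin 2) (Fin 2) R).det :=
    (RingHom.map_det _ _).symm
  rw [this]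
  exact IsLocalization.Away.algebraMap_isUnit _

variable (R) in
/-- The scheme `GL₂` over `Spec R`. -/
noncomputable def GL2 : Over (Spec (.of R)) :=
  Over.mk (Spec.map (CommRingCat.ofHom (algebraMap R (GL2Ring R))))

/-- The homomorphism of coordinate rings `O(GL₂_R) → A` over `f : R → A` that is defined by an
invertible matrix with entries in `A`. -/
noncomputable def GL2Ring.lift {A : Type u} [CommRing A] (f : R →+* A)
    (M : Matrix (Fin 2) (Fin 2) A) (hM : IsUnit M.det) : GL2Ring R →+* A :=
  IsLocalization.Away.lift (Matrix.mvPolynomialX (Fin 2) (Fin 2) R).det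
    (g := eval₂Hom f fun ij ↦ M ij.1 ij.2) (by
      rw [RingHom.map_det]
      convert hM
      ext i j
      simp)

lemma GL2Ring.lift_algebraMap {A : Type u} [CommRing A] (f : R →+* A)
    (M : Matrix (Fin 2) (Fin 2) A) (hM : IsUnit M.det) (r : R) :
    GL2Ring.lift f M hM (algebraMap R (GL2Ring R) r) = f r := by
  rw [IsScalarTower.algebraMap_apply R (MvPolynomial (Fin 2 × Fin 2) R) (GL2Ring R), GL2Ring.lift,
    IsLocalization.Away.lift_eq]
  exact eval₂_C _ _ _

lemma GL2Ring.lift_univ {A : Type u} [CommRing A] (f : R →+* A)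
    (M : Matrix (Fin 2) (Fin 2) A) (hM : IsUnit M.det) (i j : Fin 2) :
    GL2Ring.lift f M hM (GL2Ring.univ R i j) = M i j := by
  rw [GL2Ring.univ, Matrix.map_apply, GL2Ring.lift, IsLocalization.Away.lift_eq]
  simp

/-- The morphism `GL₂_S → GL₂_R` induced by a ring homomorphism `f : R → S`. -/
noncomputable def GL2.baseMap (f : R →+* S) : (GL2 S).left ⟶ (GL2 R).left :=
  Spec.map (CommRingCat.ofHom (GL2Ring.lift ((algebraMap S (GL2Ring S)).comp f)
    (GL2Ring.univ S) GL2Ring.isUnit_det_univ))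

lemma GL2Ring.flat : (algebraMap R (GL2Ring R)).Flat := by
  have h1 : Module.Flat (MvPolynomial (Fin 2 × Fin 2) R) (GL2Ring R) :=
    IsLocalization.flat _ (Submonoid.powers (Matrix.mvPolynomialX (Fin 2) (Fin 2) R).det)
  have : Module.Flat R (GL2Ring R) := Module.Flat.trans R (MvPolynomial (Fin 2 × Fin 2) R) _
  exact (RingHom.flat_algebraMap_iff).mpr this

variable (R) in
/-- The morphism of schemes underlying the natural action of `GL₂` on the projective line: the
product `ℙ¹ × GL₂` is identified with the projective line over the coordinate ring of `GL₂`, and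
the universal matrix acts. -/
noncomputable def natActionLeft :
    pullback (P1 R).hom (Spec.map (CommRingCat.ofHom (algebraMap R (GL2Ring R)))) ⟶ (P1 R).left :=
  (P1.baseMap_isPullback (GL2Ring.flat (R := R))).isoPullback.inv ≫
    P1.map (algebraMap R (GL2Ring R)) (GL2Ring.univ R) GL2Ring.isUnit_det_univ

lemma natActionLeft_hom : natActionLeft R ≫ (P1 R).hom =
    pullback.fst (P1 R).hom (Spec.map (CommRingCat.ofHom (algebraMap R (GL2Ring R)))) ≫
      (P1 R).hom := by
  rw [natActionLeft, Category.assoc, P1.map_hom, Iso.inv_comp_eq, pullback.condition]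
  exact ((P1.baseMap_isPullback (GL2Ring.flat (R := R))).isoPullback_hom_snd_assoc _).symm

variable (R) in
open MonoidalCategory in
/-- The natural (right) action `([x₀ : x₁], g) ↦ [x₀ : x₁] g` of `GL₂` on the projective line. -/
noncomputable def natAction : P1 R ⊗ GL2 R ⟶ P1 R :=
  Over.homMk (natActionLeft R) natActionLeft_hom

end

section
open MvPolynomial
variable {R : Type u} [CommRing R]

/-- The determinant of `1 + t X`, where `X` is the matrix of the indeterminates `a, b, c, d`. -/
noncomputable def congDet (t : R) : MvPolynomial (Fin 2 × Fin 2) R :=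
  (1 + t • Matrix.mvPolynomialX (Fin 2) (Fin 2) R).det

/-- For `t ∈ R`, the ring `R[a, b, c, d, 1 / Δ]`, where `Δ` is the determinant of `1 + t X`
and `X` is the matrix of the indeterminates `a, b, c, d`. -/
def CongRing (t : R) : Type u := Localization.Away (congDet t)

noncomputable instance (t : R) : CommRing (CongRing t) :=
  inferInstanceAs (CommRing (Localization.Away (congDet t)))

noncomputable instance (t : R) : Algebra (MvPolynomial (Fin 2 × Fin 2) R) (CongRing t) :=
  inferInstanceAs (Algebra _ (Localization.Away (congDet t)))

noncomputable instance (t : R) : Algebra R (CongRing t) :=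
  inferInstanceAs (Algebra R (Localization.Away (congDet t)))

instance (t : R) : IsScalarTower R (MvPolynomial (Fin 2 × Fin 2) R) (CongRing t) :=
  inferInstanceAs (IsScalarTower R _ (Localization.Away (congDet t)))

instance (t : R) : IsLocalization.Away (congDet t) (CongRing t) :=
  inferInstanceAs (IsLocalization.Away _ (Localization.Away (congDet t)))

namespace CongRing

/-- The matrix `X` of the coordinates `a, b, c, d`. -/
noncomputable def univ (t : R) : Matrix (Fin 2) (Fin 2) (CongRing t) :=
  (Matrix.mvPolynomialX (Fin 2) (Fin 2) R).map (algebraMap _ (CongRing t))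

variable {t : R} {A B : Type u} [CommRing A] [Algebra R A] [CommRing B] [Algebra R B]

lemma mapMatrix_one_add_smul (f : A →ₐ[R] B) (M : Matrix (Fin 2) (Fin 2) A) :
    f.mapMatrix (1 + t • M) = 1 + t • f.mapMatrix M := by
  rw [map_add, map_one, map_smul]

lemma isUnit_det_univ : IsUnit (1 + t • univ t).det := by
  have h := mapMatrix_one_add_smul (t := t)
    (IsScalarTower.toAlgHom R (MvPolynomial (Fin 2 × Fin 2) R) (CongRing t))
    (Matrix.mvPolynomialX (Fin 2) (Fin 2) R)
  have h2 : (IsScalarTower.toAlgHom R (MvPolynomial (Fin 2 × Fin 2) R) (CongRing t)).mapMatrix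
    (Matrix.mvPolynomialX (Fin 2) (Fin 2) R) = univ t := rfl
  rw [← h2, ← h, ← AlgHom.map_det]
  exact IsLocalization.Away.algebraMap_isUnit (congDet t)

/-- The `A`-valued point of `Spec (CongRing t)` with coordinates `M`. -/
noncomputable def lift (M : Matrix (Fin 2) (Fin 2) A) (hM : IsUnit (1 + t • M).det) :
    CongRing t →ₐ[R] A :=
  IsLocalization.liftAlgHom (M := Submonoid.powers (congDet t))
      (f := aeval fun ij ↦ M ij.1 ij.2) <| by
    rintro ⟨_, n, rfl⟩
    simp only [map_pow]
    refine IsUnit.pow n ?_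
    rw [congDet, AlgHom.map_det, mapMatrix_one_add_smul]
    convert hM
    ext i j
    simp

lemma lift_univ (M : Matrix (Fin 2) (Fin 2) A) (hM : IsUnit (1 + t • M).det) :
    (lift M hM).mapMatrix (univ t) = M := by
  ext i j
  simp [univ, lift]

lemma hom_ext {f g : CongRing t →ₐ[R] A} (h : f.mapMatrix (univ t) = g.mapMatrix (univ t)) :
    f = g := by
  refine IsLocalization.algHom_ext (Submonoid.powers (congDet t)) ?_
  refine MvPolynomial.algHom_ext fun ij ↦ ?_
  exact congr($h ij.1 ij.2)

/-- The group law `(X, Y) ↦ X + Y + t X Y`, for which `X ↦ 1 + t X` is multiplicative. -/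
def mulMat (t : R) (M N : Matrix (Fin 2) (Fin 2) A) : Matrix (Fin 2) (Fin 2) A :=
  M + N + t • (M * N)

lemma one_add_mulMat (M N : Matrix (Fin 2) (Fin 2) A) :
    1 + t • mulMat t M N = (1 + t • M) * (1 + t • N) := by
  simp only [mulMat, add_mul, mul_add, smul_add, one_mul, mul_one, smul_mul_assoc, mul_smul_comm]
  abel

lemma isUnit_det_mulMat {M N : Matrix (Fin 2) (Fin 2) A} (hM : IsUnit (1 + t • M).det)
    (hN : IsUnit (1 + t • N).det) : IsUnit (1 + t • mulMat t M N).det := by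
  rw [one_add_mulMat, Matrix.det_mul]
  exact hM.mul hN

lemma map_mulMat (f : A →ₐ[R] B) (M N : Matrix (Fin 2) (Fin 2) A) :
    f.mapMatrix (mulMat t M N) = mulMat t (f.mapMatrix M) (f.mapMatrix N) := by
  rw [mulMat, map_add, map_add, map_smul, map_mul, mulMat]

lemma isUnit_det_map (f : A →ₐ[R] B) {M : Matrix (Fin 2) (Fin 2) A}
    (hM : IsUnit (1 + t • M).det) : IsUnit (1 + t • f.mapMatrix M).det := by
  rw [← mapMatrix_one_add_smul, ← AlgHom.map_det]
  exact hM.map f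

lemma mulMat_assoc (M N P : Matrix (Fin 2) (Fin 2) A) :
    mulMat t (mulMat t M N) P = mulMat t M (mulMat t N P) := by
  simp only [mulMat, add_mul, mul_add, smul_add, smul_mul_assoc, mul_smul_comm, mul_assoc]
  abel

/-- The inverse for the group law `mulMat`. -/
noncomputable def invMat (t : R) (M : Matrix (Fin 2) (Fin 2) A) : Matrix (Fin 2) (Fin 2) A :=
  -((1 + t • M)⁻¹ * M)

lemma mulMat_invMat_left {M : Matrix (Fin 2) (Fin 2) A} (hM : IsUnit (1 + t • M).det) :
    mulMat t (invMat t M) M = 0 := by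
  have h : (1 + t • M)⁻¹ * (M + t • (M * M)) = M := by
    have : M + t • (M * M) = (1 + t • M) * M := by simp [add_mul]
    rw [this, ← mul_assoc, Matrix.nonsing_inv_mul _ hM, one_mul]
  rw [mul_add, mul_smul_comm, ← mul_assoc] at h
  rw [mulMat, invMat, neg_mul, smul_neg]
  calc -((1 + t • M)⁻¹ * M) + M + -(t • ((1 + t • M)⁻¹ * M * M)) =
      M - ((1 + t • M)⁻¹ * M + t • ((1 + t • M)⁻¹ * M * M)) := by abel
    _ = 0 := by rw [h, sub_self]

lemma mulMat_invMat_right {M : Matrix (Fin 2) (Fin 2) A} (hM : IsUnit (1 + t • M).det) :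
    mulMat t M (invMat t M) = 0 := by
  have h2 : (1 + t • M) * ((1 + t • M)⁻¹ * M) = M := by
    rw [← mul_assoc, Matrix.mul_nonsing_inv _ hM, one_mul]
  rw [mulMat, invMat, mul_neg, smul_neg]
  rw [add_mul, one_mul, smul_mul_assoc] at h2
  calc M + -((1 + t • M)⁻¹ * M) + -(t • (M * ((1 + t • M)⁻¹ * M))) =
      M - ((1 + t • M)⁻¹ * M + t • (M * ((1 + t • M)⁻¹ * M))) := by abel
    _ = 0 := by rw [h2, sub_self]

lemma isUnit_det_invMat {M : Matrix (Fin 2) (Fin 2) A} (hM : IsUnit (1 + t • M).det) :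
    IsUnit (1 + t • invMat t M).det := by
  have h := congrArg Matrix.det (one_add_mulMat (t := t) (invMat t M) M)
  rw [mulMat_invMat_left hM, smul_zero, add_zero, Matrix.det_one, Matrix.det_mul] at h
  exact IsUnit.of_mul_eq_one _ h.symm

variable (t)

/-- The comultiplication, given by the formula `X ↦ X ⊗ 1 + 1 ⊗ X + t (X ⊗ 1) (1 ⊗ X)`. -/
noncomputable def comulHom : CongRing t →ₐ[R] CongRing t ⊗[R] CongRing t :=
  lift (mulMat t ((Algebra.TensorProduct.includeLeft (R := R) (S := R)).mapMatrix (univ t))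
    ((Algebra.TensorProduct.includeRight (R := R)).mapMatrix (univ t)))
    (isUnit_det_mulMat (isUnit_det_map _ isUnit_det_univ) (isUnit_det_map _ isUnit_det_univ))

/-- The counit `X ↦ 0`. -/
noncomputable def counitHom : CongRing t →ₐ[R] R := lift 0 (by simp)

/-- The antipode. -/
noncomputable def antipodeHom : CongRing t →ₐ[R] CongRing t :=
  lift (invMat t (univ t)) (isUnit_det_invMat isUnit_det_univ)

lemma map_comulHom (f : CongRing t ⊗[R] CongRing t →ₐ[R] A) :
    (f.comp (comulHom t)).mapMatrix (univ t) =
      mulMat t ((f.comp Algebra.TensorProduct.includeLeft).mapMatrix (univ t))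
        ((f.comp Algebra.TensorProduct.includeRight).mapMatrix (univ t)) := by
  change f.mapMatrix ((comulHom t).mapMatrix (univ t)) = _
  rw [comulHom, lift_univ, map_mulMat]
  rfl

lemma map_counitHom (f : R →ₐ[R] A) : (f.comp (counitHom t)).mapMatrix (univ t) = 0 := by
  change f.mapMatrix ((counitHom t).mapMatrix (univ t)) = _
  rw [counitHom, lift_univ, map_zero]

lemma map_antipodeHom : (antipodeHom t).mapMatrix (univ t) = invMat t (univ t) := lift_univ _ _

lemma mulMat_zero_left (M : Matrix (Fin 2) (Fin 2) A) : mulMat t 0 M = M := by simp [mulMat]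

lemma mulMat_zero_right (M : Matrix (Fin 2) (Fin 2) A) : mulMat t M 0 = M := by simp [mulMat]

noncomputable instance : Bialgebra R (CongRing t) :=
  .ofAlgHom (comulHom t) (counitHom t)
    (hom_ext <| by
      rw [← AlgHom.comp_assoc, map_comulHom, AlgHom.comp_assoc, AlgHom.comp_assoc,
        Algebra.TensorProduct.map_comp_includeLeft, Algebra.TensorProduct.map_comp_includeRight,
        ← AlgHom.comp_assoc, map_comulHom, map_comulHom, Algebra.TensorProduct.map_comp_includeLeft,
        Algebra.TensorProduct.map_comp_includeRight, map_comulHom, mulMat_assoc]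
      rfl)
    (hom_ext <| by
      rw [map_comulHom, Algebra.TensorProduct.map_comp_includeLeft,
        Algebra.TensorProduct.map_comp_includeRight, map_counitHom, mulMat_zero_left]
      rfl)
    (hom_ext <| by
      rw [map_comulHom, Algebra.TensorProduct.map_comp_includeLeft,
        Algebra.TensorProduct.map_comp_includeRight, map_counitHom, mulMat_zero_right]
      rfl)

lemma lift_comp_comulHom (f g : CongRing t →ₐ[R] A) :
    ((Algebra.TensorProduct.lift f g fun _ _ ↦ Commute.all _ _).comp (comulHom t)).mapMatrix (univ t) =
      mulMat t (f.mapMatrix (univ t)) (g.mapMatrix (univ t)) := by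
  rw [map_comulHom, Algebra.TensorProduct.lift_comp_includeLeft]
  congr 2
  exact AlgHom.ext fun x ↦ by simp

noncomputable instance : HopfAlgebra R (CongRing t) :=
  .ofAlgHom (antipodeHom t)
    (hom_ext <| by
      refine (lift_comp_comulHom t _ _).trans (Eq.trans ?_ (map_counitHom t _).symm)
      rw [map_antipodeHom]
      exact mulMat_invMat_left isUnit_det_univ)
    (hom_ext <| by
      refine (lift_comp_comulHom t _ _).trans (Eq.trans ?_ (map_counitHom t _).symm)
      rw [map_antipodeHom]
      exact mulMat_invMat_right isUnit_det_univ)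

end CongRing

/-- The affine group scheme `Spec R[a, b, c, d, 1 / Δ]` over `Spec R`, whose group law is
`(X, Y) ↦ X + Y + t X Y`, that is, `1 + t X` is multiplicative in `X`. For `t = ϖ ^ k` this is
the `k`-th congruence group scheme `𝔾(k)`; for `t = 1` it is `GL₂` in the coordinates `g - 1`. -/
noncomputable def congGroup (t : R) : Over (Spec (.of R)) :=
  (Spec (.of (CongRing t))).asOver (Spec (.of R))

noncomputable instance (t : R) : GrpObj (congGroup t) :=
  inferInstanceAs (GrpObj ((Spec (.of (CongRing t))).asOver (Spec (.of R))))

/-- The homomorphism of group schemes `congGroup t → GL₂`, `X ↦ 1 + t X`. -/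
noncomputable def congGroupToGL2 (t : R) : congGroup t ⟶ GL2 R :=
  Over.homMk (Spec.map (CommRingCat.ofHom (GL2Ring.lift (algebraMap R (CongRing t))
    (1 + t • CongRing.univ t) CongRing.isUnit_det_univ))) <| by
    refine (Spec.map_comp _ _).symm.trans ?_
    rw [← CommRingCat.ofHom_comp]
    have : (GL2Ring.lift (algebraMap R (CongRing t)) (1 + t • CongRing.univ t)
        CongRing.isUnit_det_univ).comp (algebraMap R (GL2Ring R)) =
        algebraMap R (CongRing t) :=
      RingHom.ext fun r ↦ GL2Ring.lift_algebraMap _ _ CongRing.isUnit_det_univ r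
    rw [this]
    rfl

end

section
variable {O : Type u} [CommRing O] (ϖ : O)

/-- The residue ring `O / ϖ`. -/
abbrev Res : Type u := O ⧸ Ideal.span {ϖ}

/-- The closed immersion `Spec (O / ϖ) → Spec O`. -/
noncomputable def specRes : Spec (.of (Res ϖ)) ⟶ Spec (.of O) :=
  Spec.map (CommRingCat.ofHom (Ideal.Quotient.mk _))

/-- The special fibre of `X`, as a scheme over `Spec (O / ϖ)`. -/
noncomputable def specialFibre (X : Over (Spec (.of O))) : Over (Spec (.of (Res ϖ))) :=
  (Over.pullback (specRes ϖ)).obj X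

/-- The closed immersion of the special fibre into `X`. -/
noncomputable def specialFibreι (X : Over (Spec (.of O))) : (specialFibre ϖ X).left ⟶ X.left :=
  pullback.fst X.hom (specRes ϖ)

/-- The points of `X` which come from the `O / ϖ`-rational points of the special fibre at which
the special fibre is smooth over `O / ϖ`. -/
def smoothRationalPoints (X : Over (Spec (.of O))) : Set X.left :=
  {x | ∃ (y : (specialFibre ϖ X).left) (s : Spec (.of (Res ϖ)) ⟶ (specialFibre ϖ X).left)
    (U : (specialFibre ϖ X).left.Opens), specialFibreι ϖ X y = x ∧
      s ≫ (specialFibre ϖ X).hom = 𝟙 _ ∧ y ∈ Set.range s ∧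
      y ∈ U ∧ Smooth (U.ι ≫ (specialFibre ϖ X).hom)}

/-- The ideal sheaf of the smooth rational points of the special fibre, that is, of the reduced
closed subscheme of `X` supported on them. -/
noncomputable def centre (X : Over (Spec (.of O))) : X.left.IdealSheafData :=
  Scheme.IdealSheafData.vanishingIdeal ⟨closure (smoothRationalPoints ϖ X), isClosed_closure⟩

/-- The blow-up of `X` in the smooth rational points of its special fibre. -/
noncomputable def blowUpPoints (X : Over (Spec (.of O))) : Over (Spec (.of O)) :=
  Over.mk (blowUpToBase (centre ϖ X) ≫ X.hom)

/-- The projection of the blow-up. -/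
noncomputable def blowUpPointsProj (X : Over (Spec (.of O))) : blowUpPoints ϖ X ⟶ X :=
  Over.homMk (blowUpToBase (centre ϖ X)) rfl

/-- The model `𝕏ₙ`: one starts with `𝕏₀ = ℙ¹` over `O`, and `𝕏ₙ₊₁` is the blow-up of `𝕏ₙ` in
the smooth rational points of its special fibre. -/
noncomputable def model : ℕ → Over (Spec (.of O))
  | 0 => P1 O
  | n + 1 => blowUpPoints ϖ (model n)

/-- The iterated blow-up morphism `pr : 𝕏ₙ → 𝕏₀ = ℙ¹`. -/
noncomputable def pr : ∀ n : ℕ, model ϖ n ⟶ P1 O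
  | 0 => 𝟙 _
  | n + 1 => blowUpPointsProj ϖ (model ϖ n) ≫ pr n

end

section
open MonoidalCategory MonObj
universe v w

/-- A right action `σ : X × G → X` of a monoid object (for example, a group object) `G` on an
object `X`: `x 1 = x` and `x (g h) = (x g) h`. -/
structure IsRightAction {C : Type w} [Category.{v} C] [CartesianMonoidalCategory C] {G : C}
    [MonObj G] {X : C} (σ : X ⊗ G ⟶ X) : Prop where
  one : X ◁ η[G] ≫ σ = (ρ_ X).hom
  mul : X ◁ μ[G] ≫ σ = (α_ X G G).inv ≫ σ ▷ G ≫ σ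

end

section
open MonoidalCategory
variable {O : Type u} [CommRing O]

/-- Let `L` be an `O`-algebra, `π : X → ℙ¹` and `γ : G → GL₂` morphisms over `O` and
`σ : X × G → X` a morphism over `O`. Then `σ` extends the natural action of `GL₂` on the
projective line over `L` if, after base change to `L`, the morphisms `π` and `γ` become
isomorphisms `e : X_L ≅ ℙ¹_L` and `e' : G_L ≅ GL₂_L` which identify `σ` with the natural action. -/
def ExtendsNatAction (L : Type u) [CommRing L] [Algebra O L] {X G : Over (Spec (.of O))}
    (π : X ⟶ P1 O) (γ : G ⟶ GL2 O) (σ : X ⊗ G ⟶ X) : Prop :=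
  let j : Spec (.of L) ⟶ Spec (.of O) := Spec.map (CommRingCat.ofHom (algebraMap O L))
  ∃ (e : (Over.pullback j).obj X ≅ P1 L) (e' : (Over.pullback j).obj G ≅ GL2 L),
    e.hom.left ≫ P1.baseMap (algebraMap O L) = pullback.fst X.hom j ≫ π.left ∧
    e'.hom.left ≫ GL2.baseMap (algebraMap O L) = pullback.fst G.hom j ≫ γ.left ∧
    Functor.LaxMonoidal.μ (Over.pullback j) X G ≫ (Over.pullback j).map σ ≫ e.hom =
      (e.hom ⊗ₘ e'.hom) ≫ natAction L

end

section
variable {O : Type u} [CommRing O] (ϖ : O)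

/-- The element `ϖ` is locally nilpotent on the scheme `T` over `Spec O`, i.e. the structure
morphism of `T` factors through the formal spectrum of the `ϖ`-adic completion of `O`. -/
def isNilp : ObjectProperty (Over (Spec (.of O))) := fun T ↦
  ∀ U : T.left.affineOpens,
    IsNilpotent ((T.hom.appLE ⊤ U le_top).hom ((Scheme.ΓSpecIso (.of O)).inv.hom ϖ))

/-- The category of schemes over `Spec O` on which `ϖ` is locally nilpotent. -/
abbrev Nilp := (isNilp ϖ).FullSubcategory

/-- The category of functors of points on schemes on which `ϖ` is locally nilpotent; it contains
the formal schemes over the formal spectrum of the `ϖ`-adic completion of `O`. -/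
abbrev FormalSpace := (Nilp ϖ)ᵒᵖ ⥤ Type u

/-- The formal completion of schemes over `Spec O` along the special fibre, through its functor of
points: for `T` on which `ϖ` is locally nilpotent, the `T`-valued points of the completion
of `X` are the morphisms `T → X` over `Spec O` (each of which factors set-theoretically through
the special fibre). -/
noncomputable def completion : Over (Spec (.of O)) ⥤ FormalSpace ϖ :=
  yoneda ⋙ (Functor.whiskeringLeft _ _ _).obj (isNilp ϖ).ι.op

instance : PreservesFiniteProducts (completion ϖ) := by
  unfold completion; infer_instance

noncomputable instance : (completion ϖ).Monoidal := .ofChosenFiniteProducts _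

/-- The completion of a group scheme is a formal group scheme. -/
noncomputable instance (G : Over (Spec (.of O))) [GrpObj G] : GrpObj ((completion ϖ).obj G) :=
  (completion ϖ).grpObjObj

lemma isNilp_map_specRes (T : Over (Spec (.of (Res ϖ)))) :
    isNilp ϖ ((Over.map (specRes ϖ)).obj T) := by
  intro U'
  let U : T.left.Opens := U'.1
  refine ⟨1, ?_⟩
  have h1 : ((Over.map (specRes ϖ)).obj T).hom.appLE ⊤ U le_top =
      (specRes ϖ).appLE ⊤ ⊤ le_top ≫ T.hom.appLE ⊤ U le_top :=
    (Scheme.Hom.appLE_comp_appLE T.hom (specRes ϖ) ⊤ ⊤ U le_top le_top).symm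
  have h2 : ((Scheme.ΓSpecIso (.of O)).inv ≫ (specRes ϖ).appLE ⊤ ⊤ le_top).hom ϖ = 0 := by
    have h3 : (specRes ϖ).appLE ⊤ ⊤ le_top = (specRes ϖ).appTop :=
      (Scheme.Hom.app_eq_appLE _).symm
    rw [h3, specRes, ← Scheme.ΓSpecIso_inv_naturality]
    have h4 : Ideal.Quotient.mk (Ideal.span {ϖ}) ϖ = 0 :=
      Ideal.Quotient.eq_zero_iff_mem.mpr (Ideal.mem_span_singleton_self ϖ)
    change (Scheme.ΓSpecIso (.of (Res ϖ))).inv.hom (Ideal.Quotient.mk (Ideal.span {ϖ}) ϖ) = 0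
    rw [h4, map_zero]
  rw [pow_one]
  change (((Over.map (specRes ϖ)).obj T).hom.appLE ⊤ U le_top).hom _ = 0
  rw [h1]
  change (T.hom.appLE ⊤ U le_top).hom
    (((Scheme.ΓSpecIso (.of O)).inv ≫ (specRes ϖ).appLE ⊤ ⊤ le_top).hom ϖ) = 0
  rw [h2, map_zero]

/-- A scheme over `Spec (O / ϖ)` as a scheme over `Spec O` on which `ϖ` is nilpotent. -/
noncomputable def toNilp : Over (Spec (.of (Res ϖ))) ⥤ Nilp ϖ :=
  (isNilp ϖ).lift (Over.map (specRes ϖ)) (isNilp_map_specRes ϖ)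

/-- The special fibre of a formal scheme, again as a functor of points: the restriction to the
schemes over `Spec (O / ϖ)`. -/
noncomputable def formalSpecialFibre :
    FormalSpace ϖ ⥤ (Over (Spec (.of (Res ϖ))))ᵒᵖ ⥤ Type u :=
  (Functor.whiskeringLeft _ _ _).obj (toNilp ϖ).op

open MonoidalCategory CartesianMonoidalCategory

/-- The morphism `𝔛 × Ĝ → 𝔛` of formal completions that is induced by a morphism `X × G → X`. -/
noncomputable def completedAction {X G : Over (Spec (.of O))} (σ : X ⊗ G ⟶ X) :
    (completion ϖ).obj X ⊗ (completion ϖ).obj G ⟶ (completion ϖ).obj X :=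
  Functor.LaxMonoidal.μ (completion ϖ) X G ≫ (completion ϖ).map σ

/-- The action `τ : 𝔛 × 𝔊 → 𝔛` is trivial on special fibres, i.e. on special fibres it is the
projection to `𝔛`. -/
def TrivialOnSpecialFibre {𝔛 𝔊 : FormalSpace ϖ} (τ : 𝔛 ⊗ 𝔊 ⟶ 𝔛) : Prop :=
  (formalSpecialFibre ϖ).map τ = (formalSpecialFibre ϖ).map (fst 𝔛 𝔊)

end

end BlowupModel

/-!
The action on `𝕏ₙ` is obtained by lifting the action of `𝔾(k)` on the projective line through one
blow-up after the other. The natural action of `1 + ϖᵏ X` on the projective line is congruent to the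
projection modulo `ϖᵏ` (`congrMod_congAct`), and each blow-up costs one factor `ϖ`.

The lifting step is `CongrMod.exists_lift`. Let `f, g : Y → X` be morphisms of schemes over `O` which
are congruent modulo `ϖᵐ⁺¹`, with `Y` flat, and blow up `X` in an ideal sheaf `I` that contains `ϖ`.
If `g` lifts to the blow-up, then so does `f`, and the lifts are congruent modulo `ϖᵐ`. Indeed, let
`g` map an affine open `Spec B` of `Y` to the chart `Spec A[I/c]`. Then `g(c)` generates the ideal
`g(I) B`, so that `ϖ = g(c) d` for some `d`, and `f(x) - g(x)` is a multiple of
`ϖᵐ⁺¹ = g(c) d ϖᵐ` for all `x` (`exists_factorization`). Hence `g(c)` divides `f(I)`, and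
`f(c) = g(c) (1 + ϖᵐ d b)`. Near a point at which `d` vanishes, the ideal `f(I) B` is therefore
generated by `f(c)`; where `d` is invertible, it is generated by `f(ϖ) = g(c) d`, and where `ϖ` is invertible, it
is the unit ideal. The universal property of affine
blow-up algebras (`exists_awayLift`) gives the lift of `f`. Dividing `f(x) - g(x)` by `g(c)` shows
that fractions `x / c` are compared modulo `ϖᵐ` (`comp_eq_of_factorization`). This is applied to
`f = σₙ ∘ (π × id)` and `g = π ∘ fst`, where `π : 𝕏ₙ₊₁ → 𝕏ₙ` is the blow-up and `σₙ` is the action on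
`𝕏ₙ`; here `g` lifts to the projection `fst` (`exists_model_action`).

Lifts glue, and identities between them can be checked on the projective line: the models are
separated over it, they are flat over `O`, and `pr` is an isomorphism after inverting `ϖ`
(`GenericallyMono.hom_ext`, `hom_ext_of_comp_pr`). In this way the axioms of an action are inherited
from the projective line. Completion preserves products and therefore actions, and a congruence
modulo `ϖ` says that the action on the special fibre is the projection.
-/

namespace BlowupModel

/-! ### Affine blow-up algebras -/

section ReesCharts
open Polynomial
variable {R B C : Type u} [CommRing R] [CommRing B] [CommRing C] {I : Ideal R}

/-- The element `s t` of degree one of the Rees algebra, for `s ∈ I`. -/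
noncomputable def reesElem {s : R} (hs : s ∈ I) : reesAlgebra I :=
  ⟨monomial 1 s, reesAlgebra.monomial_mem.mpr (by rwa [pow_one])⟩

lemma reesElem_mem {s : R} (hs : s ∈ I) : reesElem hs ∈ reesGrading I 1 := ⟨s, rfl⟩

/-- The element `r tⁿ / (s t)ⁿ` of the affine blow-up algebra, for `r ∈ Iⁿ`. -/
noncomputable def reesFrac {s : R} (hs : s ∈ I) (n : ℕ) (r : R) (hr : r ∈ I ^ n) :
    Away (reesGrading I) (reesElem hs) :=
  Away.mk _ (reesElem_mem hs) n ⟨monomial n r, reesAlgebra.monomial_mem.mpr hr⟩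
    ⟨r, by simp⟩

lemma val_reesFrac {s : R} (hs : s ∈ I) (n : ℕ) (r : R) (hr : r ∈ I ^ n) :
    (reesFrac hs n r hr).val = Localization.mk ⟨monomial n r, reesAlgebra.monomial_mem.mpr hr⟩
      (⟨reesElem hs ^ n, ⟨n, rfl⟩⟩ : Submonoid.powers (reesElem hs)) := Away.val_mk ..

lemma exists_eq_reesFrac {s : R} (hs : s ∈ I) (x : Away (reesGrading I) (reesElem hs)) :
    ∃ n r, ∃ hr : r ∈ I ^ n, x = reesFrac hs n r hr := by
  obtain ⟨n, ⟨a, ha⟩, ⟨r, hr⟩, rfl⟩ := Away.mk_surjective _ (reesElem_mem hs) x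
  have hr' : monomial n r = a := by simpa using hr
  subst hr'
  exact ⟨n, r, reesAlgebra.monomial_mem.mp ha, rfl⟩

lemma reesFrac_zero {s : R} (hs : s ∈ I) (r : R) :
    reesFrac hs 0 r (by simp) = awayStr (reesGrading I) (reesElem hs) r := by
  refine val_injective _ ?_
  rw [val_reesFrac, val_awayStr, ← Localization.mk_one_eq_algebraMap]
  congr 1

lemma reesFrac_add {s : R} (hs : s ∈ I) (n : ℕ) {r r' : R} (hr : r ∈ I ^ n) (hr' : r' ∈ I ^ n) :
    reesFrac hs n (r + r') (add_mem hr hr') = reesFrac hs n r hr + reesFrac hs n r' hr' := by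
  refine val_injective _ ?_
  rw [val_add, val_reesFrac, val_reesFrac, val_reesFrac, Localization.add_mk_self]
  congr 1
  exact Subtype.ext (map_add (monomial n) r r')

lemma reesFrac_mul {s : R} (hs : s ∈ I) (m n : ℕ) {r r' : R} (hr : r ∈ I ^ m)
    (hr' : r' ∈ I ^ n) :
    reesFrac hs (m + n) (r * r') (pow_add I m n ▸ Ideal.mul_mem_mul hr hr') =
      reesFrac hs m r hr * reesFrac hs n r' hr' := by
  refine val_injective _ ?_
  rw [val_mul, val_reesFrac, val_reesFrac, val_reesFrac, Localization.mk_mul]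
  congr 1
  · exact Subtype.ext (monomial_mul_monomial m n r r').symm
  · exact Subtype.ext (pow_add _ _ _)

/-- On the chart `D₊(s t)` of the blow-up, every element `r` of `I` is a multiple of `s`. -/
lemma reesFrac_one_mul {s : R} (hs : s ∈ I) {r : R} (hr : r ∈ I) :
    reesFrac hs 1 r (by rwa [pow_one]) * awayStr (reesGrading I) (reesElem hs) s =
      awayStr (reesGrading I) (reesElem hs) r := by
  refine val_injective _ ?_
  rw [val_mul, val_reesFrac, val_awayStr, val_awayStr, ← Localization.mk_one_eq_algebraMap,
    ← Localization.mk_one_eq_algebraMap, Localization.mk_mul, Localization.mk_eq_mk_iff,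
    Localization.r_iff_exists]
  refine ⟨1, Subtype.ext ?_⟩
  change 1 * (1 * (monomial 1 r * C s)) = 1 * ((monomial 1 s ^ 1 * 1) * C r)
  simp [mul_comm]

/-- The affine blow-up algebra `R[I/s]` is generated by `R` and the fractions `r / s` with
`r ∈ I`. -/
lemma away_ringHom_ext {s : R} (hs : s ∈ I)
    {f g : Away (reesGrading I) (reesElem hs) →+* C}
    (h0 : ∀ r, f (awayStr _ _ r) = g (awayStr _ _ r))
    (h1 : ∀ r (hr : r ∈ I), f (reesFrac hs 1 r (by rwa [pow_one])) =
      g (reesFrac hs 1 r (by rwa [pow_one]))) : f = g := by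
  have key (n : ℕ) : ∀ r (hr : r ∈ I ^ n), f (reesFrac hs n r hr) = g (reesFrac hs n r hr) := by
    induction n with
    | zero => intro r hr; rw [reesFrac_zero, h0]
    | succ n ih =>
      intro r hr
      have hr' : r ∈ I ^ n * I := hr
      induction hr' using Submodule.mul_induction_on' with
      | mem_mul_mem a ha b hb =>
        have := reesFrac_mul hs n 1 ha (show b ∈ I ^ 1 by rwa [pow_one])
        rw [this, map_mul, map_mul, ih, h1 b hb]
      | add a ha b hb h2 h3 =>
        have ha' : a ∈ I ^ (n + 1) := ha
        have hb' : b ∈ I ^ (n + 1) := hb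
        rw [reesFrac_add hs _ ha' hb', map_add, map_add, h2, h3]
  refine RingHom.ext fun x ↦ ?_
  obtain ⟨n, r, hr, rfl⟩ := exists_eq_reesFrac hs x
  exact key n r hr

/-- The universal property of the affine blow-up algebra `R[I/s]`. -/
lemma exists_awayLift (φ : R →+* B) {s : R} (hs : s ∈ I) (hI : ∀ a ∈ I, φ s ∣ φ a)
    (hreg : φ s ∈ nonZeroDivisors B) :
    ∃ ψ : Away (reesGrading I) (reesElem hs) →+* B, ψ.comp (awayStr _ _) = φ := by
  obtain ⟨Bs, _, _, v, hv, hinj⟩ : ∃ (Bs : Type u) (_ : CommRing Bs) (_ : Algebra B Bs) (v : Bs),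
      algebraMap B Bs (φ s) * v = 1 ∧ Function.Injective (algebraMap B Bs) :=
    ⟨Localization.Away (φ s), inferInstance, inferInstance, IsLocalization.Away.invSelf (φ s),
      IsLocalization.Away.mul_invSelf _,
      IsLocalization.injective _ (Submonoid.powers_le.mpr hreg)⟩
  obtain ⟨θ, hθ⟩ : ∃ θ : reesAlgebra I →+* Bs, ∀ n r (hr : monomial n r ∈ reesAlgebra I),
      θ ⟨monomial n r, hr⟩ = algebraMap B Bs (φ r) * v ^ n :=
    ⟨(eval₂RingHom ((algebraMap B Bs).comp φ) v).comp (reesAlgebra I).val.toRingHom,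
      fun n r _ ↦ eval₂_monomial _ _⟩
  have hθs : θ (reesElem hs) = 1 := (hθ _ _ _).trans (by rw [pow_one, hv])
  obtain ⟨Θ, hΘ⟩ : ∃ Θ : Localization.Away (reesElem hs) →+* Bs, ∀ x, Θ (algebraMap _ _ x) = θ x :=
    ⟨IsLocalization.Away.lift (reesElem hs) (g := θ) (by rw [hθs]; exact isUnit_one),
      fun x ↦ IsLocalization.Away.lift_eq _ _ _⟩
  obtain ⟨ψ', hψ⟩ : ∃ ψ' : Away (reesGrading I) (reesElem hs) →+* Bs, ∀ x, ψ' x = Θ x.val :=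
    ⟨Θ.comp (algebraMap _ _), fun x ↦ rfl⟩
  have hψ' (r) : ψ' (awayStr _ _ r) = algebraMap B Bs (φ r) := by
    have : algebraMap R (reesAlgebra I) r =
      ⟨monomial 0 r, reesAlgebra.monomial_mem.mpr (by simp)⟩ := rfl
    rw [hψ, val_awayStr, hΘ, this, hθ, pow_zero, mul_one]
  have hfrac (n r hr) : ψ' (reesFrac hs n r hr) = algebraMap B Bs (φ r) * v ^ n := by
    rw [hψ, val_reesFrac, ← hθ n r (reesAlgebra.monomial_mem.mpr hr), ← hΘ]
    have h2 := congrArg Θ (IsLocalization.mk'_spec (Localization.Away (reesElem hs))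
      (⟨monomial n r, reesAlgebra.monomial_mem.mpr hr⟩ : reesAlgebra I)
      (⟨reesElem hs ^ n, ⟨n, rfl⟩⟩ : Submonoid.powers (reesElem hs)))
    rw [map_mul, hΘ, hΘ] at h2
    rw [hΘ, Localization.mk_eq_mk', ← h2, map_pow, hθs, one_pow, mul_one]
  have hrange (x) : ψ' x ∈ (algebraMap B Bs).range := by
    obtain ⟨n, r, hr, rfl⟩ := exists_eq_reesFrac hs x
    have h3 : φ s ^ n ∣ φ r := by
      have h4 : I.map φ ≤ Ideal.span {φ s} := Ideal.map_le_iff_le_comap.mpr fun a ha ↦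
        Ideal.mem_span_singleton.mpr (hI a ha)
      have h5 := Ideal.pow_right_mono h4 n (Ideal.map_pow φ I n ▸ Ideal.mem_map_of_mem φ hr)
      rwa [Ideal.span_singleton_pow, Ideal.mem_span_singleton] at h5
    obtain ⟨b, hb⟩ := h3
    refine ⟨b, ?_⟩
    rw [hfrac, hb, map_mul, map_pow, mul_right_comm, ← mul_pow, hv, one_pow, one_mul]
  let e : B ≃+* (algebraMap B Bs).range := RingEquiv.ofBijective (algebraMap B Bs).rangeRestrict
    ⟨fun x y h ↦ hinj congr($h.1), (algebraMap B Bs).rangeRestrict_surjective⟩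
  refine ⟨e.symm.toRingHom.comp (ψ'.codRestrict _ hrange), RingHom.ext fun r ↦ ?_⟩
  apply e.injective
  change e (e.symm _) = _
  rw [e.apply_symm_apply]
  exact Subtype.ext (hψ' r)

/-- The charts `D₊(s t)` with `s ∈ I` cover the blow-up. -/
lemma iSup_basicOpen_reesElem (I : Ideal R) :
    ⨆ s : I, Proj.basicOpen (reesGrading I) (reesElem s.2) = ⊤ := by
  refine Proj.iSup_basicOpen_eq_top _ _ ((HomogeneousIdeal.toIdeal_irrelevant_le _).mpr ?_)
  rintro n hn ⟨x, hx⟩ ⟨r, hr⟩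
  have hr' : monomial n r = x := hr
  subst hr'
  obtain ⟨n, rfl⟩ := Nat.exists_eq_add_of_le' hn
  have hr2 : r ∈ I ^ n * I := reesAlgebra.monomial_mem.mp hx
  clear hr hn
  induction hr2 using Submodule.mul_induction_on' with
  | mem_mul_mem a ha b hb =>
    have : (⟨monomial (n + 1) (a * b), hx⟩ : reesAlgebra I) =
        ⟨monomial n a, reesAlgebra.monomial_mem.mpr ha⟩ * reesElem hb :=
      Subtype.ext (monomial_mul_monomial n 1 a b).symm
    rw [this]
    exact Ideal.mul_mem_left _ _ (Ideal.subset_span ⟨⟨b, hb⟩, rfl⟩)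
  | add a ha b hb h2 h3 =>
    have ha' : monomial (n + 1) a ∈ reesAlgebra I := reesAlgebra.monomial_mem.mpr ha
    have hb' : monomial (n + 1) b ∈ reesAlgebra I := reesAlgebra.monomial_mem.mpr hb
    have : (⟨monomial (n + 1) (a + b), hx⟩ : reesAlgebra I) = ⟨_, ha'⟩ + ⟨_, hb'⟩ :=
      Subtype.ext (map_add _ a b)
    rw [this]
    exact add_mem (h2 ha') (h3 hb')

end ReesCharts

section ProjFlat
variable {O R A : Type u} [CommRing O] [CommRing R] [CommRing A] [Algebra R A]
  (𝒜 : ℕ → Submodule R A) [GradedAlgebra 𝒜]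

instance isSeparated_projStr : IsSeparated (projStr 𝒜) := by
  unfold projStr; infer_instance

/-- Over a Dedekind domain `O`, `Proj` of a graded algebra without `O`-torsion is flat. -/
lemma flat_projStr [IsDedekindDomain O] (φ : O →+* R)
    (h : ∀ o : O, o ≠ 0 → ∀ a : A, algebraMap R A (φ o) * a = 0 → a = 0) :
    Flat (projStr 𝒜 ≫ Spec.map (CommRingCat.ofHom φ)) := by
  have : IsZariskiLocalAtSource @Flat := HasRingHomProperty.instIsZariskiLocalAtSource
  refine (IsZariskiLocalAtSource.iff_of_openCover (P := @Flat)
    (Proj.affineOpenCover 𝒜).openCover).mpr fun ⟨⟨d, hd⟩, s, hs⟩ ↦ ?_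
  have hs' : s ∈ 𝒜 d := hs
  have h1 : Proj.awayι 𝒜 s hs' hd ≫ projStr 𝒜 ≫ Spec.map (CommRingCat.ofHom φ) =
      Spec.map (CommRingCat.ofHom ((awayStr 𝒜 s).comp φ)) := by
    rw [reassoc_of% awayι_projStr hd hs', ← Spec.map_comp, ← CommRingCat.ofHom_comp]
  have h2 : Flat (Proj.awayι 𝒜 s hs' hd ≫ projStr 𝒜 ≫ Spec.map (CommRingCat.ofHom φ)) := by
    rw [h1, Flat.SpecMap_iff]
    change ((awayStr 𝒜 s).comp φ).Flat
    let : Algebra O (Away 𝒜 s) := ((awayStr 𝒜 s).comp φ).toAlgebra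
    have : Module.IsTorsionFree O (Away 𝒜 s) := by
      refine .of_smul_eq_zero fun o x hx ↦ ?_
      by_cases ho : o = 0
      · exact .inl ho
      refine .inr ?_
      obtain ⟨n, a, ha, rfl⟩ := Away.mk_surjective 𝒜 hs' x
      have hx' := congrArg HomogeneousLocalization.val hx
      have h3 : o • Away.mk 𝒜 hs' n a ha = awayStr 𝒜 s (φ o) * Away.mk 𝒜 hs' n a ha := rfl
      rw [h3, val_mul, val_awayStr, Away.val_mk, ← Localization.mk_one_eq_algebraMap,
        Localization.mk_mul, val_zero, Localization.mk_eq_mk',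
        IsLocalization.mk'_eq_zero_iff] at hx'
      obtain ⟨⟨_, m, rfl⟩, hm⟩ := hx'
      refine val_injective _ ?_
      rw [Away.val_mk, val_zero, Localization.mk_eq_mk', IsLocalization.mk'_eq_zero_iff]
      refine ⟨⟨_, m, rfl⟩, h o ho _ ?_⟩
      rw [← hm]; ring
    exact (inferInstance : Module.Flat O (Away 𝒜 s))
  exact h2

end ProjFlat

/-! ### Charts of blow-ups, and uniqueness of lifts -/

section StructHom
variable {O : Type u} [CommRing O]

lemma isAffineOpen_coe {X : Scheme.{u}} (U : X.affineOpens) : IsAffineOpen U.1 := U.2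

/-- The structure homomorphism `O → Γ(X, U)` of an affine open `U` of a scheme `X` over `O`. -/
noncomputable def structHom {X : Scheme.{u}} (s : X ⟶ Spec (.of O)) (U : X.affineOpens) :
    O →+* Γ(X, U) :=
  (Spec.preimage ((isAffineOpen_coe U).fromSpec ≫ s)).hom

variable {X Y : Scheme.{u}}

lemma fromSpec_comp (s : X ⟶ Spec (.of O)) (U : X.affineOpens) :
    (isAffineOpen_coe U).fromSpec ≫ s = Spec.map (CommRingCat.ofHom (structHom s U)) :=
  (Spec.map_preimage _).symm

lemma appLE_structHom (s : X ⟶ Spec (.of O)) (f : Y ⟶ X) (U : X.affineOpens) (W : Y.affineOpens)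
    (e : W.1 ≤ f ⁻¹ᵁ U.1) (o : O) :
    (f.appLE U.1 W.1 e).hom (structHom s U o) = structHom (f ≫ s) W o := by
  have h : CommRingCat.ofHom (structHom s U) ≫ f.appLE U.1 W.1 e =
      CommRingCat.ofHom (structHom (f ≫ s) W) := by
    apply Spec.map_injective
    rw [Spec.map_comp, ← fromSpec_comp, ← fromSpec_comp,
      IsAffineOpen.SpecMap_appLE_fromSpec_assoc f (isAffineOpen_coe U) (isAffineOpen_coe W) e]
  exact congr(($h).hom o)

lemma map_structHom (s : X ⟶ Spec (.of O)) (U V : X.affineOpens) (h : V.1 ≤ U.1) (o : O) :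
    (X.presheaf.map (homOfLE h).op).hom (structHom s U o) = structHom s V o := by
  have h : CommRingCat.ofHom (structHom s U) ≫ X.presheaf.map (homOfLE h).op =
      CommRingCat.ofHom (structHom s V) := by
    apply Spec.map_injective
    rw [Spec.map_comp, ← fromSpec_comp, ← fromSpec_comp,
      IsAffineOpen.map_fromSpec_assoc (isAffineOpen_coe U) (isAffineOpen_coe V)]
  exact congr(($h).hom o)

lemma structHom_comp_SpecMap {L : Type u} [CommRing L] (j : O →+* L) (s : X ⟶ Spec (.of L))
    (U : X.affineOpens) :
    structHom (s ≫ Spec.map (CommRingCat.ofHom j)) U = (structHom s U).comp j := by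
  have h : CommRingCat.ofHom (structHom (s ≫ Spec.map (CommRingCat.ofHom j)) U) =
      CommRingCat.ofHom ((structHom s U).comp j) := by
    apply Spec.map_injective
    rw [← fromSpec_comp, CommRingCat.ofHom_comp, Spec.map_comp, ← fromSpec_comp, Category.assoc]
  exact congr(($h).hom)

lemma flat_structHom (s : X ⟶ Spec (.of O)) [Flat s] (U : X.affineOpens) :
    (structHom s U).Flat := by
  have : Flat ((isAffineOpen_coe U).fromSpec ≫ s) := inferInstance
  rw [fromSpec_comp, Flat.SpecMap_iff] at this
  exact this

lemma structHom_mem_nonZeroDivisors (s : X ⟶ Spec (.of O)) [Flat s] (U : X.affineOpens)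
    {o : O} (ho : o ∈ nonZeroDivisors O) : structHom s U o ∈ nonZeroDivisors Γ(X, U) := by
  have := flat_structHom s U
  algebraize [structHom s U]
  have h : IsSMulRegular Γ(X, U) o := IsSMulRegular.of_flat fun x y hxy ↦ by
    have h1 : o * x = o * y := hxy
    have h2 : (x - y) * o = 0 := by linear_combination h1
    exact sub_eq_zero.mp ((mem_nonZeroDivisors_iff_right.mp ho) _ h2)
  refine mem_nonZeroDivisors_iff_right.mpr fun x hx ↦ h ?_
  change o • x = o • 0
  rw [Algebra.smul_def, smul_zero, mul_comm]
  exact hx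

lemma exists_affineOpens_mem_le (x : X) {V : X.Opens} (hx : x ∈ V) :
    ∃ U : X.affineOpens, x ∈ U.1 ∧ U.1 ≤ V := by
  obtain ⟨_, ⟨U, hU, rfl⟩, hxU, hUV⟩ :=
    X.isBasis_affineOpens.exists_subset_of_mem_open hx V.isOpen
  exact ⟨⟨U, hU⟩, hxU, hUV⟩

/-- If `a` becomes invertible on `Z`, a morphism `Z → X` factors locally through the locus where
`a` is invertible. -/
lemma exists_affineOpens_isUnit {L : Type u} [CommRing L] (j : O →+* L) {a : O}
    (ha : IsUnit (j a)) (s : X ⟶ Spec (.of O)) (q : Y ⟶ X) (r : Y ⟶ Spec (.of L))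
    (hq : q ≫ s = r ≫ Spec.map (CommRingCat.ofHom j)) (y : Y) :
    ∃ V : X.affineOpens, q y ∈ V.1 ∧ IsUnit (structHom s V a) := by
  obtain ⟨U, hU, -⟩ := exists_affineOpens_mem_le (q y) (V := ⊤) trivial
  obtain ⟨W, hW, hWU⟩ := exists_affineOpens_mem_le y (V := q ⁻¹ᵁ U.1) hU
  have h1 : IsUnit ((q.appLE U.1 W.1 hWU).hom (structHom s U a)) := by
    rw [appLE_structHom, hq, structHom_comp_SpecMap]
    exact ha.map (structHom r W)
  have h2 := Scheme.basicOpen_of_isUnit _ h1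
  rw [Scheme.basicOpen_appLE] at h2
  refine ⟨X.affineBasicOpen (structHom s U a), (h2.ge hW).2, ?_⟩
  rw [← map_structHom s U (X.affineBasicOpen (structHom s U a)) (X.basicOpen_le _)]
  exact X.toRingedSpace.isUnit_res_basicOpen _

end StructHom

section BlowUpCharts

/-- Blowing up the empty subscheme changes nothing: the chart of the section `1` is everything. -/
lemma isIso_projStr_reesGrading {R : Type u} [CommRing R] {I : Ideal R} (hI : I = ⊤) :
    IsIso (projStr (reesGrading I)) := by
  have h1 : (1 : R) ∈ I := hI ▸ trivial
  have i1 : IsIso (Proj.awayι (reesGrading I) (reesElem h1) (reesElem_mem h1) one_pos) := by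
    have : Surjective (Proj.awayι (reesGrading I) (reesElem h1) (reesElem_mem h1) one_pos) := by
      rw [surjective_iff, ← Set.range_eq_univ, ← Scheme.Hom.coe_opensRange, Proj.opensRange_awayι,
        ← TopologicalSpace.Opens.coe_top]
      refine congrArg _ (top_le_iff.mp ?_)
      rw [← iSup_basicOpen_reesElem]
      refine iSup_le fun s ↦ Proj.basicOpen_mono _ _ _ ⟨algebraMap _ _ s.1, ?_⟩
      refine Subtype.ext ?_
      change Polynomial.monomial 1 s.1 = Polynomial.monomial 1 1 * Polynomial.C s.1
      rw [Polynomial.monomial_mul_C, one_mul]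
    exact IsOpenImmersion.isIso _
  have i2 : Function.Bijective (awayStr (reesGrading I) (reesElem h1)) := by
    obtain ⟨ψ, hψ⟩ := exists_awayLift (RingHom.id _) h1 (fun a _ ↦ by simp) (by simp)
    have hψ' (x) : ψ (awayStr (reesGrading I) (reesElem h1) x) = x := congr($hψ x)
    refine ⟨fun x y hxy ↦ ?_, fun x ↦ ?_⟩
    · rw [← hψ' x, hxy, hψ']
    · have h2 : (awayStr (reesGrading I) (reesElem h1)).comp ψ = RingHom.id _ := by
        refine away_ringHom_ext h1 (fun r ↦ congrArg (awayStr _ _) (hψ' r)) fun r hr ↦ ?_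
        have h3 : reesFrac h1 1 r (by rwa [pow_one]) = awayStr _ _ r := by
          rw [← reesFrac_one_mul h1 hr, RingHom.map_one]
          exact (mul_one _).symm
        rw [h3]
        exact congrArg (awayStr _ _) (hψ' r)
      exact ⟨ψ x, congr($h2 x)⟩
  have h3 : IsIso (CommRingCat.ofHom (awayStr (reesGrading I) (reesElem h1))) :=
    (ConcreteCategory.isIso_iff_bijective _).mpr i2
  have h4 : IsIso (Proj.awayι (reesGrading I) (reesElem h1) (reesElem_mem h1) one_pos ≫
    projStr (reesGrading I)) := by
      rw [awayι_projStr one_pos (reesElem_mem h1)]; infer_instance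
  exact IsIso.of_isIso_comp_left
    (Proj.awayι (reesGrading I) (reesElem h1) (reesElem_mem h1) one_pos) _

variable {X : Scheme.{u}} (I : X.IdealSheafData)

/-- The open immersion of a chart into the blow-up. -/
noncomputable def blowUpι (U : X.affineOpens) : blowUpChart I U ⟶ blowUp I :=
  colimit.ι (blowUpData I).functor U

lemma isPullback_blowUpι (U : X.affineOpens) :
    IsPullback (blowUpChartStr I U) (blowUpι I U) U.1.ι (blowUpToBase I) :=
  (blowUpData I).isPullback_natTrans_ι_toBase U

instance (U : X.affineOpens) : IsOpenImmersion (blowUpι I U) :=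
  MorphismProperty.of_isPullback (P := @IsOpenImmersion) (isPullback_blowUpι I U) inferInstance

lemma blowUpι_toBase (U : X.affineOpens) :
    blowUpι I U ≫ blowUpToBase I =
      projStr (reesGrading (I.ideal U)) ≫ (isAffineOpen_coe U).fromSpec :=
  (isPullback_blowUpι I U).w.symm.trans (Category.assoc _ _ _)

instance : IsSeparated (blowUpToBase I) := by
  refine IsZariskiLocalAtTarget.of_openCover X.directedAffineCover
    fun (U : X.affineOpens) ↦ ?_
  change IsSeparated (pullback.snd (blowUpToBase I) U.1.ι)
  have h : IsSeparated (projStr (reesGrading (I.ideal U)) ≫ (isAffineOpen_coe U).isoSpec.inv) :=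
    inferInstance
  change IsSeparated (blowUpChartStr I U) at h
  have h1 : IsSeparated ((isPullback_blowUpι I U).flip.isoPullback.inv ≫ blowUpChartStr I U) :=
    inferInstance
  exact (isPullback_blowUpι I U).flip.isoPullback_inv_snd ▸ h1

variable {O : Type u} [CommRing O] (s : X ⟶ Spec (.of O))

/-- A blow-up of a flat scheme over a Dedekind domain is flat, since the Rees algebras have no
torsion. -/
lemma flat_blowUp [IsDedekindDomain O] [Flat s] : Flat (blowUpToBase I ≫ s) := by
  have : IsZariskiLocalAtSource @Flat := HasRingHomProperty.instIsZariskiLocalAtSource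
  refine (IsZariskiLocalAtSource.iff_of_openCover (P := @Flat)
    (blowUpData I).cover).mpr fun (U : X.affineOpens) ↦ ?_
  change Flat (blowUpι I U ≫ blowUpToBase I ≫ s)
  rw [reassoc_of% blowUpι_toBase I U, fromSpec_comp]
  refine flat_projStr _ _ fun o ho x hx ↦ Subtype.ext (Polynomial.ext fun n ↦ ?_)
  have h1 := structHom_mem_nonZeroDivisors s U (mem_nonZeroDivisors_of_ne_zero ho)
  have h2 : (Polynomial.C (structHom s U o) * x.1).coeff n = 0 := by
    have : Polynomial.C (structHom s U o) * x.1 = 0 := congrArg Subtype.val hx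
    rw [this, Polynomial.coeff_zero]
  rw [Polynomial.coeff_C_mul] at h2
  exact (mul_left_mem_nonZeroDivisors_eq_zero_iff h1).mp h2

/-- Over an affine open on which the centre is empty, the blow-up is an isomorphism. -/
lemma isIso_blowUpChartStr (U : X.affineOpens) (hU : I.ideal U = ⊤) :
    IsIso (blowUpChartStr I U) := by
  have := isIso_projStr_reesGrading hU
  exact (inferInstance : IsIso (projStr (reesGrading (I.ideal U)) ≫
    (isAffineOpen_coe U).isoSpec.inv))

/-- The blow-up becomes an isomorphism after a base change to a scheme on which `a` is invertible,
for `a` in the ideal of the centre. -/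
lemma isIso_pullback_snd_blowUpToBase {a : O} (hI : ∀ U, structHom s U a ∈ I.ideal U)
    {L : Type u} [CommRing L] (j : O →+* L) (ha : IsUnit (j a)) {Z : Scheme.{u}} (q : Z ⟶ X)
    (r : Z ⟶ Spec (.of L)) (hq : q ≫ s = r ≫ Spec.map (CommRingCat.ofHom j)) :
    IsIso (pullback.snd (blowUpToBase I) q) := by
  choose V hV hVa using exists_affineOpens_isUnit j ha s q r hq
  change MorphismProperty.isomorphisms _ _
  refine (IsZariskiLocalAtTarget.iff_of_iSup_eq_top (P := .isomorphisms Scheme.{u})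
    (fun z ↦ q ⁻¹ᵁ (V z).1) (top_le_iff.mp fun z _ ↦
      TopologicalSpace.Opens.mem_iSup.mpr ⟨z, hV z⟩)).mpr fun z ↦ ?_
  have h1 : I.ideal (V z) = ⊤ := Ideal.eq_top_of_isUnit_mem _ (hI (V z)) (hVa z)
  have h2 := isIso_blowUpChartStr I (V z) h1
  have h3 := (isPullback_morphismRestrict (pullback.snd (blowUpToBase I) q)
    (q ⁻¹ᵁ (V z).1)).flip.paste_horiz (IsPullback.of_hasPullback (blowUpToBase I) q)
  have h4 : (q ⁻¹ᵁ (V z).1).ι ≫ q = (q ∣_ (V z).1) ≫ (V z).1.ι :=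
    (isPullback_morphismRestrict q (V z).1).w.symm
  rw [h4] at h3
  have t := (isPullback_blowUpι I (V z)).flip
  have h5 := h3.w
  rw [← Category.assoc] at h5
  rw [← t.lift_fst _ _ h5] at h3
  exact MorphismProperty.of_isPullback (P := .isomorphisms Scheme.{u})
    (IsPullback.of_right h3 (t.lift_snd _ _ h5) t) h2

end BlowUpCharts

section Unique
variable {O L : Type u} [CommRing O] [CommRing L] (j : O →+* L)

/-- Morphisms over `Z` into a separated scheme agree if they agree on a scheme-theoretically dense
subscheme: their equalizer is a closed subscheme containing it. -/
lemma hom_ext_of_schemeTheoreticallyDominant {X Y Z W : Scheme.{u}} (π : X ⟶ Z) [IsSeparated π]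
    (i : W ⟶ Y) [IsSchemeTheoreticallyDominant i] {f g : Y ⟶ X} (h : f ≫ π = g ≫ π)
    (hi : i ≫ f = i ≫ g) : f = g := by
  let Y' : Over Z := Over.mk (f ≫ π)
  let X' : Over Z := Over.mk π
  let W' : Over Z := Over.mk (i ≫ f ≫ π)
  let f' : Y' ⟶ X' := Over.homMk f
  let g' : Y' ⟶ X' := Over.homMk g h.symm
  let i' : W' ⟶ Y' := Over.homMk i
  have : IsSeparated X'.hom := ‹_›
  have h1 : i' ≫ f' = i' ≫ g' := by ext1; exact hi
  have h2 : (equalizer.lift i' h1).left ≫ (equalizer.ι f' g').left = i := by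
    rw [← Over.comp_left, equalizer.lift_ι]; rfl
  have h3 : (equalizer.ι f' g').left.ker = ⊥ := by
    have h4 := Scheme.Hom.le_ker_comp (equalizer.lift i' h1).left (equalizer.ι f' g').left
    rw [h2, i.ker_eq_bot] at h4
    exact le_bot_iff.mp h4
  have := IsClosedImmersion.isIso_iff_ker_eq_bot.mpr h3
  rw [← cancel_epi (equalizer.ι f' g').left]
  exact congr($(equalizer.condition f' g').left)

/-- A morphism `π : X → Z` of schemes over `O` is a monomorphism over `L`. -/
def GenericallyMono {X Z : Scheme.{u}} (π : X ⟶ Z) (s : Z ⟶ Spec (.of O)) : Prop :=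
  ∀ ⦃T : Scheme.{u}⦄ (a b : T ⟶ X) (r : T ⟶ Spec (.of L)),
    a ≫ π ≫ s = r ≫ Spec.map (CommRingCat.ofHom j) → a ≫ π = b ≫ π → a = b

variable {j}

lemma GenericallyMono.comp {X X' Z : Scheme.{u}} {π : X ⟶ X'} {π' : X' ⟶ Z}
    {s : Z ⟶ Spec (.of O)} (h : GenericallyMono j π (π' ≫ s)) (h' : GenericallyMono j π' s) :
    GenericallyMono j (π ≫ π') s := fun T a b r hr hab ↦
  h a b r (by simpa using hr) (h' _ _ r (by simpa using hr) (by simpa using hab))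

/-- A blow-up is a monomorphism over `L` if its centre becomes empty over `L`. -/
lemma genericallyMono_blowUp {X : Scheme.{u}} (I : X.IdealSheafData) (s : X ⟶ Spec (.of O)) {a : O}
    (hI : ∀ U, structHom s U a ∈ I.ideal U) (ha : IsUnit (j a)) :
    GenericallyMono j (blowUpToBase I) s := fun T f g r hr hfg ↦ by
  have := isIso_pullback_snd_blowUpToBase I s hI j ha (f ≫ blowUpToBase I) r
    (by simpa using hr)
  have h1 : f ≫ blowUpToBase I = 𝟙 T ≫ f ≫ blowUpToBase I := (Category.id_comp _).symm
  have h2 : g ≫ blowUpToBase I = 𝟙 T ≫ f ≫ blowUpToBase I := by rw [← hfg, Category.id_comp]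
  have h : pullback.lift f (𝟙 T) h1 = pullback.lift g (𝟙 T) h2 := by
    rw [← cancel_mono (pullback.snd (blowUpToBase I) (f ≫ blowUpToBase I)),
      pullback.lift_snd, pullback.lift_snd]
  rw [← pullback.lift_fst f (𝟙 T) h1, h, pullback.lift_fst]

/-- A lift along a separated morphism which is a monomorphism over `L` is unique, if it is
defined on a flat scheme. -/
lemma GenericallyMono.hom_ext (hj : Function.Injective j) {X Y Z : Scheme.{u}} {π : X ⟶ Z}
    [IsSeparated π] {s : Z ⟶ Spec (.of O)} (hπ : GenericallyMono j π s) {f g : Y ⟶ X}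
    [Flat (f ≫ π ≫ s)] (h : f ≫ π = g ≫ π) : f = g := by
  have : IsSchemeTheoreticallyDominant (Spec.map (CommRingCat.ofHom j)) := by
    rw [isSchemeTheoreticallyDominant_iff]
    refine Scheme.IdealSheafData.ext_of_isAffine ?_
    have h1 := Scheme.ΓSpecIso_naturality (CommRingCat.ofHom j)
    have h2 : Function.Injective (Spec.map (CommRingCat.ofHom j)).appTop.hom := by
      rw [← Iso.eq_comp_inv] at h1
      rw [h1, CommRingCat.hom_comp, CommRingCat.hom_comp, RingHom.coe_comp, RingHom.coe_comp]
      exact (ConcreteCategory.bijective_of_isIso (Scheme.ΓSpecIso (.of L)).inv).1.comp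
        (Function.Injective.comp (show Function.Injective (CommRingCat.ofHom j).hom from hj)
          (ConcreteCategory.bijective_of_isIso (Scheme.ΓSpecIso (.of O)).hom).1)
    simp only [Scheme.Hom.ker_apply _ ⟨⊤, isAffineOpen_top (Spec (.of O))⟩,
      Scheme.IdealSheafData.ideal_bot]
    exact (RingHom.injective_iff_ker_eq_bot _).mp h2
  refine hom_ext_of_schemeTheoreticallyDominant π
    (pullback.snd (Spec.map (CommRingCat.ofHom j)) (f ≫ π ≫ s)) h
    (hπ _ _ (pullback.fst _ _) ?_ (by simp [h]))
  rw [Category.assoc, pullback.condition]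

end Unique

/-! ### Local lifts and congruences of morphisms -/

section LocalMorphisms
variable {X Y Z : Scheme.{u}}

lemma hom_ext_of_affineOpens (f g : Y ⟶ X)
    (H : ∀ y : Y, ∃ W : Y.affineOpens, y ∈ W.1 ∧
      (isAffineOpen_coe W).fromSpec ≫ f = (isAffineOpen_coe W).fromSpec ≫ g) : f = g := by
  refine Scheme.hom_ext_of_forall _ _ fun y ↦ ?_
  obtain ⟨W, hy, hW⟩ := H y
  refine ⟨W.1, hy, ?_⟩
  rw [← (isAffineOpen_coe W).isoSpec_hom_fromSpec, Category.assoc, Category.assoc, hW]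

variable {O L : Type u} [CommRing O] [CommRing L] {j : O →+* L}

lemma GenericallyMono.exists_lift_of_openCover (hj : Function.Injective j) {π : X ⟶ Z}
    [IsSeparated π] {s : Z ⟶ Spec (.of O)} (hπ : GenericallyMono j π s) (f : Y ⟶ Z)
    [hf : Flat (f ≫ s)] (𝒰 : Y.OpenCover) (l : ∀ i, 𝒰.X i ⟶ X)
    (hl : ∀ i, l i ≫ π = 𝒰.f i ≫ f) : ∃ f' : Y ⟶ X, f' ≫ π = f := by
  have hcomp (y z) : pullback.fst (𝒰.f y) (𝒰.f z) ≫ l y =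
      pullback.snd (𝒰.f y) (𝒰.f z) ≫ l z := by
    have h : Flat ((pullback.fst (𝒰.f y) (𝒰.f z) ≫ l y) ≫ π ≫ s) := by
      have h1 : (pullback.fst (𝒰.f y) (𝒰.f z) ≫ l y) ≫ π ≫ s =
          (pullback.fst (𝒰.f y) (𝒰.f z) ≫ 𝒰.f y) ≫ f ≫ s := by
        simp only [Category.assoc]
        rw [reassoc_of% hl y]
      rw [h1]
      exact Flat.comp _ _
    refine hπ.hom_ext hj ?_
    rw [Category.assoc, Category.assoc, hl, hl, pullback.condition_assoc]
  refine ⟨𝒰.glueMorphisms l hcomp, 𝒰.hom_ext _ _ fun y ↦ ?_⟩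
  rw [𝒰.ι_glueMorphisms_assoc, hl]

/-- Lifts along a separated morphism which is a monomorphism over `L` can be constructed locally
on a flat scheme, since they are unique. -/
lemma GenericallyMono.exists_lift (hj : Function.Injective j) {π : X ⟶ Z} [IsSeparated π]
    {s : Z ⟶ Spec (.of O)} (hπ : GenericallyMono j π s) (f : Y ⟶ Z) [Flat (f ≫ s)]
    (H : ∀ y : Y, ∃ W : Y.affineOpens, y ∈ W.1 ∧ ∃ l : Spec Γ(Y, W) ⟶ X,
      l ≫ π = (isAffineOpen_coe W).fromSpec ≫ f) : ∃ f' : Y ⟶ X, f' ≫ π = f := by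
  choose W hW l hl using H
  refine hπ.exists_lift_of_openCover hj f (Y.openCoverOfIsOpenCover (fun y ↦ (W y).1)
    (top_le_iff.mp fun y _ ↦ TopologicalSpace.Opens.mem_iSup.mpr ⟨y, hW y⟩))
    (fun y ↦ (isAffineOpen_coe (W y)).isoSpec.hom ≫ l y) fun (y : Y) ↦ ?_
  change ((isAffineOpen_coe (W y)).isoSpec.hom ≫ l y) ≫ π = (W y).1.ι ≫ f
  rw [Category.assoc, hl, ← Category.assoc, (isAffineOpen_coe (W y)).isoSpec_hom_fromSpec]

end LocalMorphisms

section Congruence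
variable {X Y : Scheme.{u}} {O : Type u} [CommRing O]

/-- Two morphisms `f, g : Y → X` of schemes over `O` are congruent modulo `a ∈ O` if they agree on
all points of `Y` with values in `O`-algebras in which `a = 0`. -/
def CongrMod (a : O) (t : Y ⟶ Spec (.of O)) (f g : Y ⟶ X) : Prop :=
  ∀ ⦃C : Type u⦄ [CommRing C] (ψ : O →+* C), ψ a = 0 → ∀ h : Spec (.of C) ⟶ Y,
    h ≫ t = Spec.map (CommRingCat.ofHom ψ) → h ≫ f = h ≫ g

variable {a : O} {t : Y ⟶ Spec (.of O)} {f g : Y ⟶ X}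

lemma CongrMod.dvd_sub (h : CongrMod a t f g) (U : X.affineOpens) (W : Y.affineOpens)
    (hWf : W.1 ≤ f ⁻¹ᵁ U.1) (hWg : W.1 ≤ g ⁻¹ᵁ U.1) (x : Γ(X, U)) :
    structHom t W a ∣ (f.appLE U.1 W.1 hWf).hom x - (g.appLE U.1 W.1 hWg).hom x := by
  rw [← Ideal.mem_span_singleton, ← Ideal.Quotient.mk_eq_mk_iff_sub_mem]
  let mk := Ideal.Quotient.mk (Ideal.span {structHom t W a})
  have h1 := h (C := Γ(Y, W) ⧸ Ideal.span {structHom t W a}) (mk.comp (structHom t W))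
    (Ideal.Quotient.eq_zero_iff_mem.mpr (Ideal.mem_span_singleton_self _))
    (Spec.map (CommRingCat.ofHom mk) ≫ (isAffineOpen_coe W).fromSpec)
    (by rw [Category.assoc, fromSpec_comp, ← Spec.map_comp, ← CommRingCat.ofHom_comp])
  rw [Category.assoc, Category.assoc,
    ← IsAffineOpen.SpecMap_appLE_fromSpec f (isAffineOpen_coe U) (isAffineOpen_coe W) hWf,
    ← IsAffineOpen.SpecMap_appLE_fromSpec g (isAffineOpen_coe U) (isAffineOpen_coe W) hWg,
    ← Category.assoc, ← Category.assoc, cancel_mono, ← Spec.map_comp, ← Spec.map_comp] at h1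
  exact congr(($(Spec.map_injective h1)).hom x)

lemma exists_fromSpec_eq (W : Y.affineOpens) {y : Y} (hy : y ∈ W.1) :
    ∃ q : Spec Γ(Y, W), (isAffineOpen_coe W).fromSpec q = y := by
  have := (isAffineOpen_coe W).range_fromSpec
  exact this.ge hy

lemma fromSpec_mem_basicOpen (W : Y.affineOpens) (q : Spec Γ(Y, W)) (b : Γ(Y, W)) :
    (isAffineOpen_coe W).fromSpec q ∈ Y.basicOpen b ↔ b ∉ q.asIdeal := by
  have h := (isAffineOpen_coe W).fromSpec_preimage_basicOpen (f := b)
  exact (iff_of_eq congr(q ∈ $h)).trans (PrimeSpectrum.mem_basicOpen _ _)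

/-- Congruent morphisms agree on points at which `a` vanishes. -/
lemma CongrMod.apply_eq (h : CongrMod a t f g) (W : Y.affineOpens) {y : Y} (hy : y ∈ W.1)
    (ha : y ∉ Y.basicOpen (structHom t W a)) : f y = g y := by
  obtain ⟨q, rfl⟩ := exists_fromSpec_eq W hy
  rw [fromSpec_mem_basicOpen, not_not] at ha
  let mk := Ideal.Quotient.mk q.asIdeal
  have h1 := h (C := Γ(Y, W) ⧸ q.asIdeal) (mk.comp (structHom t W))
    (Ideal.Quotient.eq_zero_iff_mem.mpr ha)
    (Spec.map (CommRingCat.ofHom mk) ≫ (isAffineOpen_coe W).fromSpec)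
    (by rw [Category.assoc, fromSpec_comp, ← Spec.map_comp, ← CommRingCat.ofHom_comp])
  obtain ⟨q', hq'⟩ : ∃ q', Spec.map (CommRingCat.ofHom mk) q' = q := by
    have : q.asIdeal.IsPrime := q.isPrime
    refine ⟨(⟨⊥, Ideal.isPrime_bot⟩ : PrimeSpectrum (Γ(Y, W) ⧸ q.asIdeal)),
      PrimeSpectrum.ext ?_⟩
    exact Ideal.mk_ker (I := q.asIdeal)
  have h3 := congr($h1 q')
  simpa only [Scheme.Hom.comp_apply, hq'] using h3

end Congruence

section BlowUpAffineCharts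
variable {X Y : Scheme.{u}} (I : X.IdealSheafData)

/-- The affine chart `Spec A[I/c]` of the blow-up over an affine open `U = Spec A`, for a section
`c` of the ideal of the centre. -/
noncomputable def blowUpAwayι (U : X.affineOpens) {c : Γ(X, U)} (hc : c ∈ I.ideal U) :
    Spec (.of (Away (reesGrading (I.ideal U)) (reesElem hc))) ⟶ blowUp I :=
  Proj.awayι _ (reesElem hc) (reesElem_mem hc) one_pos ≫ blowUpι I U

instance (U : X.affineOpens) {c : Γ(X, U)} (hc : c ∈ I.ideal U) :
    IsOpenImmersion (blowUpAwayι I U hc) := by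
  unfold blowUpAwayι; infer_instance

lemma blowUpAwayι_toBase (U : X.affineOpens) {c : Γ(X, U)} (hc : c ∈ I.ideal U) :
    blowUpAwayι I U hc ≫ blowUpToBase I = Spec.map (CommRingCat.ofHom
      (awayStr (reesGrading (I.ideal U)) (reesElem hc))) ≫ (isAffineOpen_coe U).fromSpec := by
  rw [blowUpAwayι, Category.assoc, blowUpι_toBase,
    reassoc_of% awayι_projStr one_pos (reesElem_mem hc)]

lemma exists_mem_opensRange_blowUpAwayι (U : X.affineOpens) (z : ↥(blowUp I))
    (hz : blowUpToBase I z ∈ U.1) :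
    ∃ (c : Γ(X, U)) (hc : c ∈ I.ideal U), z ∈ (blowUpAwayι I U hc).opensRange := by
  obtain ⟨w, hw, -⟩ := Scheme.exists_preimage_of_isPullback (isPullback_blowUpι I U).flip z
    ⟨_, hz⟩ rfl
  obtain ⟨⟨c, hc⟩, hw'⟩ := TopologicalSpace.Opens.mem_iSup.mp
    ((iSup_basicOpen_reesElem (I.ideal U)).ge (Set.mem_univ w))
  refine ⟨c, hc, ?_⟩
  rw [← Proj.opensRange_awayι _ _ (reesElem_mem hc) one_pos] at hw'
  obtain ⟨v, hv⟩ := hw'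
  exact ⟨v, by rw [← hw, ← hv]; rfl⟩

lemma le_preimage_of_le_preimage_opensRange (U : X.affineOpens) {c : Γ(X, U)} (hc : c ∈ I.ideal U)
    (g' : Y ⟶ blowUp I) {W : Y.Opens} (hW : W ≤ g' ⁻¹ᵁ (blowUpAwayι I U hc).opensRange) :
    W ≤ (g' ≫ blowUpToBase I) ⁻¹ᵁ U.1 := by
  intro y hy
  obtain ⟨v, hv⟩ := hW hy
  change (g' ≫ blowUpToBase I) y ∈ U.1
  rw [Scheme.Hom.comp_apply]
  have h1 : blowUpAwayι I U hc v = g' y := hv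
  rw [← h1, ← Scheme.Hom.comp_apply, blowUpAwayι_toBase]
  have := (isAffineOpen_coe U).range_fromSpec
  exact this.le ⟨_, rfl⟩

/-- A morphism into an affine chart `Spec A[I/c]` of the blow-up is given by a homomorphism of
`A`-algebras. -/
lemma exists_eq_SpecMap_blowUpAwayι (U : X.affineOpens) {c : Γ(X, U)} (hc : c ∈ I.ideal U)
    (g' : Y ⟶ blowUp I) (W : Y.affineOpens) (hW : W.1 ≤ g' ⁻¹ᵁ (blowUpAwayι I U hc).opensRange)
    (hW' : W.1 ≤ (g' ≫ blowUpToBase I) ⁻¹ᵁ U.1) :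
    ∃ ψ : Away (reesGrading (I.ideal U)) (reesElem hc) →+* Γ(Y, W),
      (isAffineOpen_coe W).fromSpec ≫ g' = Spec.map (CommRingCat.ofHom ψ) ≫ blowUpAwayι I U hc ∧
      ∀ x, ψ (awayStr _ _ x) = ((g' ≫ blowUpToBase I).appLE U.1 W.1 hW').hom x := by
  let l := IsOpenImmersion.lift (blowUpAwayι I U hc) ((isAffineOpen_coe W).fromSpec ≫ g') (by
    rintro _ ⟨q, rfl⟩
    rw [Scheme.Hom.comp_apply]
    refine hW ?_
    have := (isAffineOpen_coe W).range_fromSpec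
    exact this.le ⟨_, rfl⟩)
  have hl : l ≫ blowUpAwayι I U hc = (isAffineOpen_coe W).fromSpec ≫ g' :=
    IsOpenImmersion.lift_fac _ _ _
  have hl' : Spec.map (CommRingCat.ofHom (Spec.preimage l).hom) = l := Spec.map_preimage l
  refine ⟨(Spec.preimage l).hom, ?_, fun x ↦ ?_⟩
  · rw [hl', hl]
  · have h1 : CommRingCat.ofHom (awayStr (reesGrading (I.ideal U)) (reesElem hc)) ≫
        CommRingCat.ofHom (Spec.preimage l).hom = (g' ≫ blowUpToBase I).appLE U.1 W.1 hW' := by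
      apply Spec.map_injective
      rw [← cancel_mono (isAffineOpen_coe U).fromSpec, Spec.map_comp, hl', Category.assoc,
        ← blowUpAwayι_toBase, reassoc_of% hl,
        IsAffineOpen.SpecMap_appLE_fromSpec _ (isAffineOpen_coe U) (isAffineOpen_coe W)]
    exact congr(($h1).hom x)

/-- The universal property of the blow-up, on affine charts. -/
lemma exists_lift_blowUpAwayι (U : X.affineOpens) {c : Γ(X, U)} (hc : c ∈ I.ideal U)
    (f : Y ⟶ X) (W : Y.affineOpens) (hW : W.1 ≤ f ⁻¹ᵁ U.1)
    (hdvd : ∀ x ∈ I.ideal U, (f.appLE U.1 W.1 hW).hom c ∣ (f.appLE U.1 W.1 hW).hom x)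
    (hreg : (f.appLE U.1 W.1 hW).hom c ∈ nonZeroDivisors Γ(Y, W)) :
    ∃ ψ : Away (reesGrading (I.ideal U)) (reesElem hc) →+* Γ(Y, W),
      (Spec.map (CommRingCat.ofHom ψ) ≫ blowUpAwayι I U hc) ≫ blowUpToBase I =
        (isAffineOpen_coe W).fromSpec ≫ f ∧
      ∀ x, ψ (awayStr _ _ x) = (f.appLE U.1 W.1 hW).hom x := by
  obtain ⟨ψ, hψ⟩ := exists_awayLift (f.appLE U.1 W.1 hW).hom hc hdvd hreg
  refine ⟨ψ, ?_, fun x ↦ congr($hψ x)⟩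
  rw [Category.assoc, blowUpAwayι_toBase, ← Spec.map_comp_assoc, ← CommRingCat.ofHom_comp, hψ]
  exact IsAffineOpen.SpecMap_appLE_fromSpec _ (isAffineOpen_coe U) (isAffineOpen_coe W) hW

end BlowUpAffineCharts

/-! ### Lifting congruent morphisms to a blow-up -/

section Comparison

/-- Let `g` be the restriction to `A` of a homomorphism `ψ : A[I/c] → B`, and let `f : A → B` be
congruent to `g` modulo `e ^ (m + 1)`, where `e = g(α)` for some `α ∈ I`. Then `e = g(c) d` for
some `d`, and therefore `f(c) = g(c) (1 + eᵐ d b)` for some `b`. -/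
lemma exists_factorization {A B : Type u} [CommRing A] [CommRing B] {I : Ideal A} {c α : A}
    (hc : c ∈ I) (hα : α ∈ I) (ψ : Away (reesGrading I) (reesElem hc) →+* B) (f : A →+* B) {e : B}
    (heα : ψ (awayStr _ _ α) = e) (he : e ∈ nonZeroDivisors B) (m : ℕ)
    (h : ∀ x, e ^ (m + 1) ∣ f x - ψ (awayStr _ _ x)) :
    ∃ γ d b : B, γ = ψ (awayStr _ _ c) ∧ γ ∈ nonZeroDivisors B ∧ e = γ * d ∧
      f c = γ * (1 + e ^ m * d * b) ∧
      ∀ x, ∃ x', f x = ψ (awayStr _ _ x) + γ * (d * e ^ m * x') := by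
  obtain ⟨γ, hγ⟩ : ∃ γ, γ = ψ (awayStr _ _ c) := ⟨_, rfl⟩
  obtain ⟨d, hd⟩ : ∃ d, e = γ * d := by
    refine ⟨ψ (reesFrac hc 1 α (by rwa [pow_one])), ?_⟩
    rw [← heα, ← reesFrac_one_mul hc hα, map_mul, mul_comm, hγ]
  have key (x) : ∃ x', f x = ψ (awayStr _ _ x) + γ * (d * e ^ m * x') := by
    obtain ⟨x', hx'⟩ := h x
    exact ⟨x', by linear_combination hx' + e ^ m * x' * hd⟩
  obtain ⟨b, hb⟩ := key c
  refine ⟨γ, d, b, hγ, ?_, hd, by rw [hb, ← hγ]; ring, key⟩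
  rw [hd] at he
  exact (mul_mem_nonZeroDivisors.mp he).1

lemma dvd_of_factorization {A B : Type u} [CommRing A] [CommRing B] {I : Ideal A} {c : A}
    (hc : c ∈ I) (ψ : Away (reesGrading I) (reesElem hc) →+* B) {γ r z : B}
    (hγ : γ = ψ (awayStr _ _ c)) {x : A} (hx : x ∈ I) (h : z = ψ (awayStr _ _ x) + γ * r) :
    γ ∣ z := by
  rw [h, ← reesFrac_one_mul hc hx, map_mul, ← hγ]
  exact dvd_add (Dvd.intro_left _ rfl) (Dvd.intro _ rfl)

/-- The homomorphism `ψ'` with restriction `f` in `exists_factorization` agrees with `ψ` after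
base change to rings in which `eᵐ` vanishes: on fractions the comparison of `f` and `g`
is divided by `g(c)`, which costs one factor `e`. -/
lemma comp_eq_of_factorization {A B B' D : Type u} [CommRing A] [CommRing B] [CommRing B']
    [CommRing D] {I : Ideal A} {c : A} (hc : c ∈ I)
    (ψ : Away (reesGrading I) (reesElem hc) →+* B) (f : A →+* B) (ρ : B →+* B')
    (ψ' : Away (reesGrading I) (reesElem hc) →+* B') (χ : B' →+* D) {γ d b e : B}
    (hψ' : ∀ x, ψ' (awayStr _ _ x) = ρ (f x)) (hγ : γ = ψ (awayStr _ _ c))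
    (hγ' : ρ γ ∈ nonZeroDivisors B') (he : χ (ρ e) = 0) (hc' : f c = γ * (1 + e * d * b))
    (key : ∀ x, ∃ x', f x = ψ (awayStr _ _ x) + γ * (d * e * x')) :
    χ.comp ψ' = χ.comp (ρ.comp ψ) := by
  refine away_ringHom_ext hc (fun r ↦ ?_) fun r hr ↦ ?_
  · obtain ⟨x', hx'⟩ := key r
    simp only [RingHom.comp_apply, hψ', hx', map_add, map_mul, he]
    ring
  · obtain ⟨x', hx'⟩ := key r
    have h3 := hψ' r
    rw [hx', ← reesFrac_one_mul hc hr, map_mul, map_mul, hψ', hc', ← hγ, map_add, map_mul, map_mul,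
      map_mul, map_mul, map_mul, map_add, map_mul, map_mul, RingHom.map_one] at h3
    have h1 : ψ' (reesFrac hc 1 r (by rwa [pow_one])) * (1 + ρ e * ρ d * ρ b) =
        ρ (ψ (reesFrac hc 1 r (by rwa [pow_one]))) + ρ d * ρ e * ρ x' := by
      refine (mul_cancel_left_mem_nonZeroDivisors hγ').mp ?_
      linear_combination h3
    have h2 := congrArg χ h1
    simp only [map_add, map_mul, he, RingHom.map_one] at h2
    simp only [RingHom.comp_apply]
    linear_combination h2

end Comparison

section Shrinking
variable {X Y : Scheme.{u}}

lemma exists_affineOpens_isUnit_map (W : Y.affineOpens) (v : Γ(Y, W)) {y : Y}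
    (hy : y ∈ Y.basicOpen v) : ∃ (W' : Y.affineOpens) (hW : W'.1 ≤ W.1), y ∈ W'.1 ∧
      IsUnit ((Y.presheaf.map (homOfLE hW).op).hom v) :=
  ⟨Y.affineBasicOpen v, Y.basicOpen_le v, hy, Y.toRingedSpace.isUnit_res_basicOpen _⟩

lemma map_appLE_hom (f : Y ⟶ X) (U : X.affineOpens) (W W' : Y.affineOpens) (hWf : W.1 ≤ f ⁻¹ᵁ U.1)
    (hW : W'.1 ≤ W.1) (x : Γ(X, U)) :
    (Y.presheaf.map (homOfLE hW).op).hom ((f.appLE U.1 W.1 hWf).hom x) =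
      (f.appLE U.1 W'.1 (hW.trans hWf)).hom x := by
  rw [← Scheme.Hom.appLE_map f hWf (homOfLE hW).op]
  rfl

end Shrinking

section LiftToBlowUp
variable {X Y : Scheme.{u}} {O : Type u} [CommRing O] {a : O} (I : X.IdealSheafData)
  {s : X ⟶ Spec (.of O)} {t : Y ⟶ Spec (.of O)} {m : ℕ} {f : Y ⟶ X} {g' : Y ⟶ blowUp I}

lemma CongrMod.exists_chart (h : CongrMod (a ^ (m + 1)) t f (g' ≫ blowUpToBase I)) {y : Y}
    (W₀ : Y.affineOpens) (hy : y ∈ W₀.1) (hya : y ∉ Y.basicOpen (structHom t W₀ a)) :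
    ∃ (U : X.affineOpens) (c : Γ(X, U)) (hc : c ∈ I.ideal U) (W : Y.affineOpens), y ∈ W.1 ∧
      W.1 ≤ W₀.1 ∧ W.1 ≤ f ⁻¹ᵁ U.1 ∧ W.1 ≤ g' ⁻¹ᵁ (blowUpAwayι I U hc).opensRange := by
  have h1 : f y = (g' ≫ blowUpToBase I) y := h.apply_eq W₀ hy fun h2 ↦ hya (by
    rw [map_pow, Scheme.basicOpen_pow _ _ m.succ_pos] at h2
    exact h2)
  obtain ⟨U, hU, -⟩ := exists_affineOpens_mem_le (f y) (V := ⊤) trivial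
  have hU' := hU
  rw [h1, Scheme.Hom.comp_apply] at hU'
  obtain ⟨c, hc, hz⟩ := exists_mem_opensRange_blowUpAwayι I U (g' y) hU'
  obtain ⟨W, hW, hW'⟩ := exists_affineOpens_mem_le y
    (V := W₀.1 ⊓ (f ⁻¹ᵁ U.1) ⊓ (g' ⁻¹ᵁ (blowUpAwayι I U hc).opensRange)) ⟨⟨hy, hU⟩, hz⟩
  exact ⟨U, c, hc, W, hW, fun x hx ↦ (hW' hx).1.1, fun x hx ↦ (hW' hx).1.2,
    fun x hx ↦ (hW' hx).2⟩

/-- The comparison `exists_factorization` on an affine open `W` which is mapped by `g'` to the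
chart `Spec A[I/c]` of the blow-up. -/
lemma CongrMod.exists_factorization (h : CongrMod (a ^ (m + 1)) t f (g' ≫ blowUpToBase I))
    (hI : ∀ U, structHom s U a ∈ I.ideal U) (ha : a ∈ nonZeroDivisors O) [Flat t]
    (hg : (g' ≫ blowUpToBase I) ≫ s = t) (U : X.affineOpens) {c : Γ(X, U)} (hc : c ∈ I.ideal U)
    (W : Y.affineOpens) (hWf : W.1 ≤ f ⁻¹ᵁ U.1)
    (hW : W.1 ≤ g' ⁻¹ᵁ (blowUpAwayι I U hc).opensRange) :
    ∃ (ψ : Away (reesGrading (I.ideal U)) (reesElem hc) →+* Γ(Y, W)) (γ d b : Γ(Y, W)),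
      (isAffineOpen_coe W).fromSpec ≫ g' = Spec.map (CommRingCat.ofHom ψ) ≫ blowUpAwayι I U hc ∧
      γ = ψ (awayStr _ _ c) ∧ γ ∈ nonZeroDivisors Γ(Y, W) ∧
      structHom t W a = γ * d ∧
      (f.appLE U.1 W.1 hWf).hom c = γ * (1 + structHom t W a ^ m * d * b) ∧
      ∀ x, ∃ x', (f.appLE U.1 W.1 hWf).hom x =
        ψ (awayStr _ _ x) + γ * (d * structHom t W a ^ m * x') := by
  have hWg := le_preimage_of_le_preimage_opensRange I U hc g' hW
  obtain ⟨ψ, hψ, hψ'⟩ := exists_eq_SpecMap_blowUpAwayι I U hc g' W hW hWg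
  obtain ⟨γ, d, b, h1⟩ := BlowupModel.exists_factorization hc (hI U) ψ (f.appLE U.1 W.1 hWf).hom
    (e := structHom t W a) (by rw [hψ', appLE_structHom, hg])
    (structHom_mem_nonZeroDivisors t W ha) m (fun x ↦ by
      rw [hψ', ← map_pow]
      exact h.dvd_sub U W hWf hWg x)
  exact ⟨ψ, γ, d, b, hψ, h1⟩

/-- Locally, `f` lifts to the blow-up. Where `a` is not invertible, the image of the ideal of the
centre under `f` is generated by `f(c)` or by `a`, in the notation of
`CongrMod.exists_factorization`. -/
lemma CongrMod.exists_local_lift (h : CongrMod (a ^ (m + 1)) t f (g' ≫ blowUpToBase I))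
    (hI : ∀ U, structHom s U a ∈ I.ideal U) (ha : a ∈ nonZeroDivisors O) [Flat t]
    (hf : f ≫ s = t) (hg : (g' ≫ blowUpToBase I) ≫ s = t) (y : Y) :
    ∃ W : Y.affineOpens, y ∈ W.1 ∧ ∃ l : Spec Γ(Y, W) ⟶ blowUp I,
      l ≫ blowUpToBase I = (isAffineOpen_coe W).fromSpec ≫ f := by
  have hstr (U : X.affineOpens) (W : Y.affineOpens) (hW : W.1 ≤ f ⁻¹ᵁ U.1) :
      (f.appLE U.1 W.1 hW).hom (structHom s U a) = structHom t W a := by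
    rw [appLE_structHom, hf]
  -- it suffices to find `c ∈ I` with `f(c) = γ v` where `v(y) ≠ 0` and `γ` divides `f(I)`
  have reduce (U : X.affineOpens) (W : Y.affineOpens) (hW : W.1 ≤ f ⁻¹ᵁ U.1) (γ v : Γ(Y, W))
      (hdvd : ∀ x ∈ I.ideal U, γ ∣ (f.appLE U.1 W.1 hW).hom x) (c : Γ(X, U))
      (hc : c ∈ I.ideal U) (hv : (f.appLE U.1 W.1 hW).hom c = γ * v) (hy : y ∈ Y.basicOpen v) :
      ∃ W : Y.affineOpens, y ∈ W.1 ∧ ∃ l : Spec Γ(Y, W) ⟶ blowUp I,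
        l ≫ blowUpToBase I = (isAffineOpen_coe W).fromSpec ≫ f := by
    obtain ⟨W', hle, hy', hu⟩ := exists_affineOpens_isUnit_map W v hy
    set ρ := (Y.presheaf.map (homOfLE hle).op).hom with hρ
    have h1 (x) (hx : x ∈ I.ideal U) : ρ γ ∣ (f.appLE U.1 W'.1 (hle.trans hW)).hom x := by
      rw [← map_appLE_hom f U W W' hW hle]
      exact map_dvd ρ (hdvd x hx)
    have h2 : (f.appLE U.1 W'.1 (hle.trans hW)).hom c = ρ γ * ρ v := by
      rw [← map_appLE_hom f U W W' hW hle, hv, map_mul]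
    have h3 : ρ γ ∈ nonZeroDivisors Γ(Y, W') := by
      obtain ⟨r, hr⟩ := h1 _ (hI U)
      have h4 := structHom_mem_nonZeroDivisors t W' ha
      rw [← hstr U W' (hle.trans hW), hr] at h4
      exact (mul_mem_nonZeroDivisors.mp h4).1
    obtain ⟨ψ, hψ, -⟩ := exists_lift_blowUpAwayι I U hc f W' (hle.trans hW)
      (fun x hx ↦ by
        rw [h2]
        exact (hu.mul_right_dvd).mpr (h1 x hx))
      (by
        rw [h2]
        exact mul_mem h3 hu.mem_nonZeroDivisors)
    exact ⟨W', hy', _, hψ⟩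
  obtain ⟨U₀, hU₀, -⟩ := exists_affineOpens_mem_le (f y) (V := ⊤) trivial
  obtain ⟨W₀, hy₀, hW₀⟩ := exists_affineOpens_mem_le y (V := f ⁻¹ᵁ U₀.1) hU₀
  by_cases hya : y ∈ Y.basicOpen (structHom t W₀ a)
  · exact reduce U₀ W₀ hW₀ 1 _ (fun x _ ↦ one_dvd _) _ (hI U₀)
      ((hstr U₀ W₀ hW₀).trans (one_mul _).symm) hya
  obtain ⟨U, c, hc, W, hyW, -, hWf, hW⟩ := h.exists_chart I W₀ hy₀ hya
  obtain ⟨ψ, γ, d, b, -, hγ, -, hd, hfc, key⟩ := h.exists_factorization I hI ha hg U hc W hWf hW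
  have hdvd (x) (hx : x ∈ I.ideal U) : γ ∣ (f.appLE U.1 W.1 hWf).hom x :=
    (key x).elim fun _ h ↦ dvd_of_factorization hc ψ hγ hx h
  by_cases hyd : y ∈ Y.basicOpen d
  · exact reduce U W hWf γ d hdvd _ (hI U) ((hstr U W hWf).trans hd) hyd
  · refine reduce U W hWf γ _ hdvd c hc hfc ?_
    obtain ⟨q, rfl⟩ := exists_fromSpec_eq W hyW
    rw [fromSpec_mem_basicOpen, not_not] at hyd
    rw [fromSpec_mem_basicOpen]
    intro h1
    refine q.isPrime.ne_top ((Ideal.eq_top_iff_one _).mpr ?_)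
    have h2 := sub_mem h1 (Ideal.mul_mem_right b _
      (Ideal.mul_mem_left _ (structHom t W a ^ m) hyd))
    rwa [add_sub_cancel_right] at h2

variable {L : Type u} [CommRing L] {j : O →+* L} (hj : Function.Injective j) (haj : IsUnit (j a))

include hj haj in
/-- Let `f, g : Y → X` be congruent modulo `aᵐ⁺¹`, where `a` lies in the ideal of the centre. If
`g` lifts to the blow-up, then so does `f`, and the lifts are congruent modulo `aᵐ`. -/
lemma CongrMod.exists_lift (h : CongrMod (a ^ (m + 1)) t f (g' ≫ blowUpToBase I))
    (hI : ∀ U, structHom s U a ∈ I.ideal U) [Flat t]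
    (hf : f ≫ s = t) (hg : (g' ≫ blowUpToBase I) ≫ s = t) :
    ∃ f' : Y ⟶ blowUp I, f' ≫ blowUpToBase I = f ∧ CongrMod (a ^ m) t f' g' := by
  have ha : a ∈ nonZeroDivisors O := mem_nonZeroDivisors_iff_right.mpr fun x hx ↦ hj (by
    rw [map_zero]
    have := congrArg j hx
    rwa [map_mul, map_zero, haj.mul_left_eq_zero] at this)
  have hmono := genericallyMono_blowUp I s hI haj
  have hflat : Flat (f ≫ s) := by rwa [hf]
  obtain ⟨f', hf'⟩ := hmono.exists_lift hj f (h.exists_local_lift I hI ha hf hg)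
  refine ⟨f', hf', fun C _ ψC hψC k hk ↦ hom_ext_of_affineOpens _ _ fun x ↦ ?_⟩
  obtain ⟨W₀, hy₀, -⟩ := exists_affineOpens_mem_le (k x) (V := ⊤) trivial
  -- `aᵐ` vanishes at the points of the image of `Spec C`
  have hzero (W : Y.affineOpens) (N : (Spec (.of C)).affineOpens) (hN : N.1 ≤ k ⁻¹ᵁ W.1) :
      (k.appLE W.1 N.1 hN).hom (structHom t W a ^ m) = 0 := by
    have h1 := structHom_comp_SpecMap ψC (𝟙 _) N
    rw [Category.id_comp, ← hk] at h1
    rw [← map_pow, appLE_structHom, h1, RingHom.comp_apply, hψC, map_zero]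
  have hmem (W : Y.affineOpens) (hxW : k x ∈ W.1) : k x ∉ Y.basicOpen (structHom t W a ^ m) := by
    intro hx
    obtain ⟨N, hxN, hN⟩ := exists_affineOpens_mem_le x (V := k ⁻¹ᵁ W.1) hxW
    have h1 := Scheme.basicOpen_appLE k N.1 W.1 hN (structHom t W a ^ m)
    rw [hzero W N hN, Scheme.basicOpen_zero] at h1
    exact h1.ge ⟨hxN, hx⟩
  have hmem' (W : Y.affineOpens) (hxW : k x ∈ W.1) (v : Γ(Y, W)) :
      k x ∈ Y.basicOpen (1 + structHom t W a ^ m * v) := by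
    have h1 := hmem W hxW
    obtain ⟨q, hq⟩ := exists_fromSpec_eq W hxW
    rw [← hq, fromSpec_mem_basicOpen, not_not] at h1
    rw [← hq, fromSpec_mem_basicOpen]
    intro h2
    refine q.isPrime.ne_top ((Ideal.eq_top_iff_one _).mpr ?_)
    have h3 := sub_mem h2 (Ideal.mul_mem_right v _ h1)
    rwa [add_sub_cancel_right] at h3
  obtain ⟨U, c, hc, W, hyW, -, hWf, hW⟩ := h.exists_chart I W₀ hy₀ fun hx ↦
    hmem W₀ hy₀ (by
      rcases m.eq_zero_or_pos with rfl | hm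
      · rw [pow_zero, Scheme.basicOpen_of_isUnit _ isUnit_one]
        exact hy₀
      · rwa [Scheme.basicOpen_pow _ _ hm])
  obtain ⟨ψ, γ, d, b, hψ, hγ, -, hd, hfc, key⟩ :=
    h.exists_factorization I hI ha hg U hc W hWf hW
  have hdvd (x) (hx : x ∈ I.ideal U) : γ ∣ (f.appLE U.1 W.1 hWf).hom x :=
    (key x).elim fun _ h ↦ dvd_of_factorization hc ψ hγ hx h
  have hv := hmem' W hyW (d * b)
  rw [← mul_assoc] at hv
  obtain ⟨W', hle, hyW', hu⟩ := exists_affineOpens_isUnit_map W _ hv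
  obtain ⟨ρ, hρ⟩ : ∃ ρ, ρ = (Y.presheaf.map (homOfLE hle).op).hom := ⟨_, rfl⟩
  have hρf (x) : (f.appLE U.1 W'.1 (hle.trans hWf)).hom x =
      ρ ((f.appLE U.1 W.1 hWf).hom x) := by
    rw [hρ, map_appLE_hom f U W W' hWf hle]
  have hρe : ρ (structHom t W a) = structHom t W' a := by
    rw [hρ, map_structHom]
  rw [← hρ] at hu
  have hργ : ρ γ ∈ nonZeroDivisors Γ(Y, W') := by
    have h4 := structHom_mem_nonZeroDivisors t W' ha
    rw [← hρe, hd, map_mul] at h4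
    exact (mul_mem_nonZeroDivisors.mp h4).1
  obtain ⟨ψ', hψ', hψ''⟩ := exists_lift_blowUpAwayι I U hc f W' (hle.trans hWf)
    (fun x hx ↦ by
      rw [hρf, hρf, hfc, map_mul]
      exact hu.mul_right_dvd.mpr (map_dvd ρ (hdvd x hx)))
    (by
      rw [hρf, hfc, map_mul]
      exact mul_mem hργ hu.mem_nonZeroDivisors)
  have hψρ : (isAffineOpen_coe W').fromSpec ≫ g' =
      Spec.map (CommRingCat.ofHom (ρ.comp ψ)) ≫ blowUpAwayι I U hc := by
    rw [CommRingCat.ofHom_comp, Spec.map_comp, Category.assoc, ← hψ,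
      ← (isAffineOpen_coe W).map_fromSpec (isAffineOpen_coe W') (homOfLE hle).op, hρ]
    rfl
  have hψf : (isAffineOpen_coe W').fromSpec ≫ f' =
      Spec.map (CommRingCat.ofHom ψ') ≫ blowUpAwayι I U hc := by
    have hflat' : Flat (((isAffineOpen_coe W').fromSpec ≫ f') ≫ blowUpToBase I ≫ s) := by
      have h1 : ((isAffineOpen_coe W').fromSpec ≫ f') ≫ blowUpToBase I ≫ s =
          (isAffineOpen_coe W').fromSpec ≫ t := by
        rw [Category.assoc, reassoc_of% hf', hf]
      rw [h1]
      infer_instance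
    refine hmono.hom_ext hj ?_
    rw [hψ', Category.assoc, hf']
  obtain ⟨N, hxN, hN⟩ := exists_affineOpens_mem_le x (V := k ⁻¹ᵁ W'.1) hyW'
  refine ⟨N, hxN, ?_⟩
  rw [← Category.assoc, ← Category.assoc,
    ← IsAffineOpen.SpecMap_appLE_fromSpec k (isAffineOpen_coe W') (isAffineOpen_coe N) hN,
    Category.assoc, Category.assoc, hψρ, hψf, ← Spec.map_comp_assoc, ← Spec.map_comp_assoc]
  have hχ := comp_eq_of_factorization hc ψ _ ρ ψ' (k.appLE W'.1 N.1 hN).hom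
    (fun x ↦ (hψ'' x).trans (hρf x)) hγ hργ
    (by rw [map_pow, hρe]; exact hzero W' N hN) hfc key
  have hχ' : CommRingCat.ofHom ψ' ≫ k.appLE W'.1 N.1 hN =
      CommRingCat.ofHom (ρ.comp ψ) ≫ k.appLE W'.1 N.1 hN := CommRingCat.hom_ext hχ
  rw [hχ']

end LiftToBlowUp

/-! ### Linear substitutions and points of the projective line -/

section LinearSubstitutions
open MvPolynomial
attribute [local instance] MvPolynomial.gradedAlgebra

variable {R S T : Type u} [CommRing R] [CommRing S] [CommRing T]

/-- Composition of linear substitutions. The matrices act on row vectors, `x ↦ x M`, which accounts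
for the order of the product. -/
lemma linearSubst_comp (f : R →+* S) (M : Matrix (Fin 2) (Fin 2) S) (g : S →+* T)
    (N : Matrix (Fin 2) (Fin 2) T) :
    (linearSubst g N).comp (linearSubst f M) = linearSubst (g.comp f) (N * g.mapMatrix M) := by
  have h : (linearSubst g N).toRingHom.comp (linearSubst f M).toRingHom =
      (linearSubst (g.comp f) (N * g.mapMatrix M)).toRingHom := by
    refine MvPolynomial.ringHom_ext (fun r ↦ ?_) fun j ↦ ?_
    · change linearSubst g N (linearSubst f M (C r)) = linearSubst _ _ (C r)
      rw [linearSubst_C, linearSubst_C, linearSubst_C]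
      rfl
    · change linearSubst g N (linearSubst f M (X j)) = linearSubst _ _ (X j)
      rw [linearSubst_X, linearSubst_X, map_sum]
      simp only [map_mul, linearSubst_C, linearSubst_X, Matrix.mul_apply, map_sum, Finset.sum_mul,
        Finset.mul_sum]
      rw [Finset.sum_comm]
      refine Finset.sum_congr rfl fun k _ ↦ Finset.sum_congr rfl fun i _ ↦ ?_
      rw [RingHom.mapMatrix_apply, Matrix.map_apply]
      ring
  exact DFunLike.ext _ _ fun x ↦ congr($h x)

lemma linearSubst_id_one : linearSubst (RingHom.id R) 1 = .id (coordGrading R) := by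
  have h : (linearSubst (RingHom.id R) 1).toRingHom = RingHom.id _ := by
    refine MvPolynomial.ringHom_ext (fun r ↦ linearSubst_C _ _ _) fun j ↦ ?_
    refine (linearSubst_X _ _ j).trans ?_
    simp [Matrix.one_apply]
  exact DFunLike.ext _ _ fun x ↦ congr($h x)

lemma P1.map_congr {f g : R →+* S} {M N : Matrix (Fin 2) (Fin 2) S} (hfg : f = g) (hMN : M = N)
    (hM : IsUnit M.det) (hN : IsUnit N.det) : P1.map f M hM = P1.map g N hN := by
  subst hfg hMN; rfl

lemma isUnit_det_mul_mapMatrix (g : S →+* T) {M : Matrix (Fin 2) (Fin 2) S} (hM : IsUnit M.det)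
    {N : Matrix (Fin 2) (Fin 2) T} (hN : IsUnit N.det) : IsUnit (N * g.mapMatrix M).det := by
  rw [Matrix.det_mul, ← RingHom.map_det]
  exact hN.mul (hM.map g)

lemma P1.map_comp (f : R →+* S) (M : Matrix (Fin 2) (Fin 2) S) (hM : IsUnit M.det) (g : S →+* T)
    (N : Matrix (Fin 2) (Fin 2) T) (hN : IsUnit N.det) :
    P1.map g N hN ≫ P1.map f M hM =
      P1.map (g.comp f) (N * g.mapMatrix M) (isUnit_det_mul_mapMatrix g hM hN) := by
  refine (Proj.map_comp _ _ _ _).symm.trans ?_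
  exact projMap_congr (linearSubst_comp f M g N) _ _

lemma P1.map_id_one (h : IsUnit (1 : Matrix (Fin 2) (Fin 2) R).det) :
    P1.map (RingHom.id R) 1 h = 𝟙 _ :=
  (projMap_congr linearSubst_id_one _ (by simp)).trans Proj.map_id

/-- On points: `[x₀ : x₁] ↦ [x₀ : x₁] M`, followed by the base change. -/
lemma P1.map_id_comp_map (f : R →+* S) {M N : Matrix (Fin 2) (Fin 2) S} (hM : IsUnit M.det)
    (hN : IsUnit N.det) (hNM : IsUnit (N * M).det) :
    P1.map (RingHom.id S) N hN ≫ P1.map f M hM = P1.map f (N * M) hNM := by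
  rw [P1.map_comp]
  exact P1.map_congr (RingHom.id_comp f) (by ext; simp) _ _

/-- The base change by `g` of the morphism defined by `M`. -/
lemma P1.baseMap_comp_map (f : R →+* S) {M : Matrix (Fin 2) (Fin 2) S} (hM : IsUnit M.det)
    (g : S →+* T) {N : Matrix (Fin 2) (Fin 2) T} (hN : IsUnit N.det) (h : g.mapMatrix M = N) :
    P1.baseMap g ≫ P1.map f M hM = P1.map (g.comp f) N hN := by
  rw [P1.baseMap, P1.map_comp]
  exact P1.map_congr rfl (by rw [one_mul, h]) _ _

instance : IsSeparated (P1 R).hom := isSeparated_projStr (coordGrading R)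

instance [IsDedekindDomain R] : Flat (P1 R).hom := by
  have h := flat_projStr (coordGrading R) (RingHom.id R) fun o ho a ha ↦ by
    refine (mul_eq_zero.mp ha).resolve_left fun h ↦ ho ?_
    exact (map_eq_zero_iff _ (C_injective (Fin 2) R)).mp h
  have h1 : CommRingCat.ofHom (RingHom.id R) = 𝟙 _ := rfl
  rw [h1, Spec.map_id, Category.comp_id] at h
  exact h

lemma GL2Ring.hom_ext {A : Type u} [CommRing A] {f g : GL2Ring R →+* A}
    (h0 : f.comp (algebraMap R _) = g.comp (algebraMap R _))
    (h : f.mapMatrix (GL2Ring.univ R) = g.mapMatrix (GL2Ring.univ R)) : f = g := by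
  refine IsLocalization.ringHom_ext
    (Submonoid.powers (Matrix.mvPolynomialX (Fin 2) (Fin 2) R).det) ?_
  exact MvPolynomial.ringHom_ext (fun r ↦ congr($h0 r)) fun ij ↦ congr($h ij.1 ij.2)

/-- On points, the natural action is `([x₀ : x₁], M) ↦ [x₀ : x₁] M`. -/
lemma lift_natActionLeft (f : R →+* S) {M N : Matrix (Fin 2) (Fin 2) S} (hM : IsUnit M.det)
    (hN : IsUnit N.det) (hNM : IsUnit (N * M).det) {p : (P1 S).left ⟶ pullback (P1 R).hom
      (Spec.map (CommRingCat.ofHom (algebraMap R (GL2Ring R))))}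
    (h1 : p ≫ pullback.fst _ _ = P1.map f N hN)
    (h2 : p ≫ pullback.snd _ _ =
      (P1 S).hom ≫ Spec.map (CommRingCat.ofHom (GL2Ring.lift f M hM))) :
    p ≫ natActionLeft R = P1.map f (N * M) hNM := by
  have hcomp : (GL2Ring.lift f M hM).comp (algebraMap R (GL2Ring R)) = f :=
    RingHom.ext fun r ↦ GL2Ring.lift_algebraMap f M hM r
  have hp : p = P1.map (RingHom.id S) N hN ≫ P1.baseMap (GL2Ring.lift f M hM) ≫
      (P1.baseMap_isPullback (GL2Ring.flat (R := R))).isoPullback.hom := by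
    refine pullback.hom_ext ?_ ?_
    · simp only [Category.assoc, IsPullback.isoPullback_hom_fst]
      have h3 : P1.baseMap (GL2Ring.lift f M hM) ≫ P1.baseMap (algebraMap R (GL2Ring R)) =
          P1.map _ 1 (by simp) := P1.baseMap_comp_map _ (by simp) _ (by simp) (map_one _)
      rw [h1, h3, P1.map_id_comp_map (hNM := by simpa)]
      exact P1.map_congr hcomp.symm (mul_one N).symm _ _
    · simp only [Category.assoc, IsPullback.isoPullback_hom_snd]
      rw [h2, P1.baseMap, P1.map_hom, ← Category.assoc, P1.map_hom, Category.assoc]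
      exact congr(_ ≫ $(Spec.map_id _ ▸ (Category.id_comp _).symm))
  rw [hp, natActionLeft, Category.assoc, Category.assoc, Iso.hom_inv_id_assoc,
    P1.baseMap_comp_map (hN := hM) (h := by
      ext i j; exact GL2Ring.lift_univ f M hM i j), P1.map_id_comp_map (hNM := hNM)]
  exact P1.map_congr hcomp rfl _ _

end LinearSubstitutions

section PointsOfCharts
open MvPolynomial
attribute [local instance] MvPolynomial.gradedAlgebra

variable {S D : Type u} [CommRing S] [CommRing D]

lemma isHomogeneous_coord (j : Fin 2) : (X j : MvPolynomial (Fin 2) S) ∈ coordGrading S 1 :=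
  isHomogeneous_X S j

/-- Dehomogenization `S[x₀, x₁] → S[x₀, x₁]_(x_j)`, `x_i ↦ x_i / x_j`. -/
noncomputable def dehom (j : Fin 2) :
    MvPolynomial (Fin 2) S →+* Away (coordGrading S) (X j) :=
  eval₂Hom (awayStr (coordGrading S) (X j)) fun i ↦
    Away.mk _ (isHomogeneous_coord j) 1 (X i) (by simpa using isHomogeneous_coord i)

lemma IsHomogeneous.eval₂_mul {p : MvPolynomial (Fin 2) S} {n : ℕ} (hp : p.IsHomogeneous n)
    (f : S →+* D) (c : D) (v : Fin 2 → D) :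
    p.eval₂ f (fun i ↦ c * v i) = c ^ n * p.eval₂ f v := by
  rw [eval₂_eq', eval₂_eq', Finset.mul_sum]
  refine Finset.sum_congr rfl fun d hd ↦ ?_
  have hn : ∑ i, d i = n := by
    have := hp (mem_support_iff.mp hd)
    rwa [Finsupp.weight_apply, Finsupp.sum_fintype _ _ (by simp),
      Finset.sum_congr rfl fun i _ ↦ by rw [Pi.one_apply, smul_eq_mul, mul_one]] at this
  simp only [mul_pow, Finset.prod_mul_distrib, Finset.prod_pow_eq_pow_sum, hn]
  ring

lemma dehom_surjective (j : Fin 2) : Function.Surjective (dehom (S := S) j) := by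
  intro x
  obtain ⟨n, p, hp, rfl⟩ := Away.mk_surjective _ (isHomogeneous_coord j) x
  refine ⟨p, val_injective _ ?_⟩
  have hp' : p.IsHomogeneous n := by simpa using hp
  let E := Localization.Away (X j : MvPolynomial (Fin 2) S)
  let α : MvPolynomial (Fin 2) S →+* E := algebraMap _ E
  let ι : S →+* E := α.comp C
  let v (i : Fin 2) : E := Localization.mk (X i) ⟨X j ^ 1, 1, rfl⟩
  have h1 : (dehom j p).val = p.eval₂ ι v := by
    have h2 : (algebraMap (Away (coordGrading S) (X j)) E).comp (dehom j) = eval₂Hom ι v := by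
      refine MvPolynomial.ringHom_ext (fun r ↦ ?_) fun i ↦ ?_
      · rw [RingHom.comp_apply, dehom, eval₂Hom_C, eval₂Hom_C]
        exact val_awayStr _ _ _
      · rw [RingHom.comp_apply, dehom, eval₂Hom_X', eval₂Hom_X']
        exact Away.val_mk _ _ (isHomogeneous_coord j) _ _
    exact congr($h2 p)
  have h4 (i : Fin 2) : α (X j) * v i = α (X i) := by
    have := IsLocalization.mk'_spec' E (X i : MvPolynomial (Fin 2) S)
      (⟨X j ^ 1, 1, rfl⟩ : Submonoid.powers (X j))
    rw [← Localization.mk_eq_mk'] at this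
    simpa only [v, pow_one] using this
  have h5 : eval₂Hom ι (fun i ↦ α (X i)) = α :=
    MvPolynomial.ringHom_ext (fun r ↦ eval₂Hom_C _ _ _) fun i ↦ eval₂Hom_X' _ _ _
  have h3 : p.eval₂ ι (fun i ↦ α (X j) * v i) = α p := by
    simp only [h4]
    exact congr($h5 p)
  rw [IsHomogeneous.eval₂_mul hp', ← h1] at h3
  rw [Away.val_mk, Localization.mk_eq_mk', IsLocalization.eq_mk'_iff_mul_eq, mul_comm, map_pow]
  exact h3

/-- A point of a chart of the projective line over `S` with values in an `S`-algebra `D` comes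
from a point of the projective line over `D`. -/
lemma exists_comp_awayMap (χ : S →+* D) (j : Fin 2)
    (ψ : Away (coordGrading S) (X j) →+* D) (hψ : ψ.comp (awayStr _ _) = χ) :
    ∃ ψ' : Away (coordGrading D) (linearSubst χ 1 (X j)) →+* D,
      ψ'.comp (Away.map (linearSubst χ 1) (X j)) = ψ := by
  obtain ⟨g, hg⟩ : ∃ g : MvPolynomial (Fin 2) D →+* D,
    g = eval₂Hom (RingHom.id D) fun i ↦ ψ (dehom j (X i)) := ⟨_, rfl⟩
  have hgC (r : D) : g (C r) = r := by rw [hg]; exact eval₂Hom_C _ _ _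
  have hgX (i : Fin 2) : g (linearSubst χ 1 (X i)) = ψ (dehom j (X i)) := by
    rw [linearSubst_X, hg]
    simp [Matrix.one_apply]
  have hgj : g (linearSubst χ 1 (X j)) = 1 := by
    have h1 : dehom j (X j) = (1 : Away (coordGrading S) (X j)) := by
      refine val_injective _ ?_
      rw [dehom, eval₂Hom_X', Away.val_mk, val_one]
      simp only [pow_one]
      exact Localization.mk_self ⟨X j, Submonoid.mem_powers _⟩
    rw [hgX, h1]
    exact RingHom.map_one ψ
  let E := Localization.Away (linearSubst χ 1 (X j))
  let l : E →+* D := IsLocalization.Away.lift (linearSubst χ 1 (X j)) (g := g)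
    (by rw [hgj]; exact isUnit_one)
  have hl (a) : l (algebraMap _ E a) = g a := IsLocalization.Away.lift_eq _ _ _
  have hl' (a) : l (Localization.mk a ⟨linearSubst χ 1 (X j) ^ 1, 1, rfl⟩) = g a := by
    have := congrArg l (IsLocalization.mk'_spec E a
      (⟨linearSubst χ 1 (X j) ^ 1, 1, rfl⟩ : Submonoid.powers (linearSubst χ 1 (X j))))
    rw [map_mul, hl, hl, map_pow, hgj, one_pow, mul_one] at this
    rwa [Localization.mk_eq_mk']
  refine ⟨l.comp (algebraMap _ E), ?_⟩
  refine (RingHom.cancel_right (dehom_surjective j)).mp ?_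
  refine MvPolynomial.ringHom_ext (fun r ↦ ?_) fun i ↦ ?_
  · have h2 : dehom j (C r) = awayStr (coordGrading S) (X j) r := eval₂Hom_C _ _ _
    have h3 : (Away.map (linearSubst χ 1) (X j) (awayStr (coordGrading S) (X j) r)).val =
        algebraMap (MvPolynomial (Fin 2) D) E (C (χ r)) := by
      rw [val_awayMap_eq, val_awayStr, IsLocalization.map_eq]
      exact congrArg _ (linearSubst_C χ 1 r)
    simp only [RingHom.comp_apply, h2]
    refine (congrArg l h3).trans ?_
    rw [hl, hgC, ← hψ]
    rfl
  · have h2 : dehom j (X i) = Away.mk (coordGrading S) (isHomogeneous_coord j) 1 (X i)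
      (by simpa using isHomogeneous_coord i) := eval₂Hom_X' _ _ _
    have h3 : (Away.map (linearSubst χ 1) (X j) (dehom j (X i))).val =
        (Localization.mk (linearSubst χ 1 (X i))
          (⟨linearSubst χ 1 (X j) ^ 1, 1, rfl⟩ :
            Submonoid.powers (linearSubst χ 1 (X j))) : E) := by
      rw [h2, Away.map_mk]
      exact Away.val_mk ..
    simp only [RingHom.comp_apply]
    refine (congrArg l h3).trans ?_
    rw [hl', hgX]

end PointsOfCharts

/-! ### The action of the congruence group on the projective line -/

section ActionOnP1
open MonoidalCategory CartesianMonoidalCategory MonObj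

variable {R : Type u} [CommRing R] {A : Type u} [CommRing A] [Algebra R A]

variable (R A) in
/-- The projective line over an `R`-algebra `A`, as a scheme over `R`. -/
noncomputable def P1.over : Over (Spec (.of R)) :=
  Over.mk ((P1 A).hom ≫ Spec.map (CommRingCat.ofHom (algebraMap R A)))

variable (R A) in
/-- The projection from the projective line over `A` to `Spec A`. -/
noncomputable def P1.overStr : P1.over R A ⟶ (Spec (.of A)).asOver (Spec (.of R)) :=
  Over.homMk (P1 A).hom rfl

variable (R) in
/-- The morphism `P1.map` over `R`. -/
noncomputable def P1.overMap (M : Matrix (Fin 2) (Fin 2) A) (hM : IsUnit M.det) :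
    P1.over R A ⟶ P1 R :=
  Over.homMk (P1.map (algebraMap R A) M hM) (P1.map_hom _ _ _)

lemma P1.overMap_congr {M N : Matrix (Fin 2) (Fin 2) A} (h : M = N) (hM : IsUnit M.det)
    (hN : IsUnit N.det) : P1.overMap R M hM = P1.overMap R N hN := by
  subst h; rfl

/-- For flat `A`, the projective line over `A` is the product of `Spec A` and the projective line
over `R`. -/
lemma P1.isIso_lift_overStr (hA : (algebraMap R A).Flat) (h1 : IsUnit (1 : Matrix _ _ A).det) :
    IsIso (lift (P1.overMap R (1 : Matrix (Fin 2) (Fin 2) A) h1) (P1.overStr R A)) := by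
  have h : IsIso (lift (P1.overMap R (1 : Matrix (Fin 2) (Fin 2) A) h1) (P1.overStr R A)).left := by
    have h2 : (lift (P1.overMap R (1 : Matrix (Fin 2) (Fin 2) A) h1) (P1.overStr R A)).left =
        (P1.baseMap_isPullback hA).isoPullback.hom :=
      pullback.hom_ext
        ((congrArg Over.Hom.left (lift_fst _ _)).trans (IsPullback.isoPullback_hom_fst _).symm)
        ((congrArg Over.Hom.left (lift_snd _ _)).trans (IsPullback.isoPullback_hom_snd _).symm)
    rw [h2]
    exact Iso.isIso_hom _
  have h3 : IsIso ((Over.forget (Spec (.of R))).map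
      (lift (P1.overMap R (1 : Matrix (Fin 2) (Fin 2) A) h1) (P1.overStr R A))) := h
  exact isIso_of_reflects_iso _ (Over.forget _)

variable {t : R}

/-- The `A`-valued point of the congruence group with coordinates `M`. -/
noncomputable def congPt (M : Matrix (Fin 2) (Fin 2) A) (hM : IsUnit (1 + t • M).det) :
    (Spec (.of A)).asOver (Spec (.of R)) ⟶ congGroup t :=
  (Spec.map (CommRingCat.ofHom (CongRing.lift M hM).toRingHom)).asOver _

lemma congPt_left (M : Matrix (Fin 2) (Fin 2) A) (hM : IsUnit (1 + t • M).det) :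
    (congPt M hM).left = Spec.map (CommRingCat.ofHom (CongRing.lift M hM).toRingHom) := rfl

lemma lift_toConv_mul (M N : Matrix (Fin 2) (Fin 2) A) (hM : IsUnit (1 + t • M).det)
    (hN : IsUnit (1 + t • N).det) :
    WithConv.toConv (CongRing.lift M hM) * WithConv.toConv (CongRing.lift N hN) =
      WithConv.toConv (CongRing.lift (CongRing.mulMat t M N)
        (CongRing.isUnit_det_mulMat hM hN)) := by
  apply WithConv.ofConv_injective
  have h := CongRing.lift_comp_comulHom t (CongRing.lift M hM) (CongRing.lift N hN)
  rw [CongRing.lift_univ, CongRing.lift_univ] at h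
  refine CongRing.hom_ext ((Eq.trans ?_ h).trans (CongRing.lift_univ _
    (CongRing.isUnit_det_mulMat hM hN)).symm)
  congr 1
  congr 1
  exact AlgHom.ext fun c ↦ AlgHom.convMul_apply _ _ c

/-- The group law on points is `(M, N) ↦ M + N + t M N`. -/
lemma lift_congPt_mul (M N : Matrix (Fin 2) (Fin 2) A) (hM : IsUnit (1 + t • M).det)
    (hN : IsUnit (1 + t • N).det) : lift (congPt M hM) (congPt N hN) ≫ μ =
      congPt (CongRing.mulMat t M N) (CongRing.isUnit_det_mulMat hM hN) := by
  have h := map_mul (Spec.mapMulEquiv (R := R) (S := CongRing t) (T := A))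
    (.toConv (CongRing.lift M hM)) (.toConv (CongRing.lift N hN))
  rw [lift_toConv_mul] at h
  exact h.symm

lemma toUnit_one_eq_congPt :
    toUnit _ ≫ η[congGroup t] = congPt (0 : Matrix (Fin 2) (Fin 2) A) (by simp) := by
  refine Over.OverMorphism.ext ?_
  change Spec.map (CommRingCat.ofHom (algebraMap R A)) ≫
    Spec.map (CommRingCat.ofHom (CongRing.counitHom t).toRingHom) = _
  rw [congPt_left, ← Spec.map_comp, ← CommRingCat.ofHom_comp]
  have h : (Algebra.ofId R A).comp (CongRing.counitHom t) = CongRing.lift 0 (by simp) :=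
    CongRing.hom_ext (by rw [CongRing.map_counitHom, CongRing.lift_univ])
  rw [← h]
  rfl

variable (t) in
/-- The action of the congruence group on the projective line. -/
noncomputable def congAct : P1 R ⊗ congGroup t ⟶ P1 R :=
  P1 R ◁ congGroupToGL2 t ≫ natAction R

lemma lift_comp_GL2Ring_lift (M : Matrix (Fin 2) (Fin 2) A) (hM : IsUnit (1 + t • M).det) :
    (CongRing.lift M hM).toRingHom.comp (GL2Ring.lift (algebraMap R (CongRing t))
      (1 + t • CongRing.univ t) CongRing.isUnit_det_univ) =
      GL2Ring.lift (algebraMap R A) (1 + t • M) hM := by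
  refine GL2Ring.hom_ext (RingHom.ext fun r ↦ ?_) ?_
  · simp [GL2Ring.lift_algebraMap]
  · ext i j
    have h2 := congr($(CongRing.mapMatrix_one_add_smul (t := t) (CongRing.lift M hM)
      (CongRing.univ t)) i j)
    rw [CongRing.lift_univ] at h2
    simp only [RingHom.mapMatrix_apply, Matrix.map_apply, RingHom.comp_apply]
    rw [GL2Ring.lift_univ, GL2Ring.lift_univ]
    exact h2

lemma congPt_toGL2_left (M : Matrix (Fin 2) (Fin 2) A) (hM : IsUnit (1 + t • M).det) :
    (congPt M hM ≫ congGroupToGL2 t).left =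
      Spec.map (CommRingCat.ofHom (GL2Ring.lift (algebraMap R A) (1 + t • M) hM)) := by
  rw [← lift_comp_GL2Ring_lift, CommRingCat.ofHom_comp, Spec.map_comp]
  rfl

/-- On points, `X` acts by `[x₀ : x₁] ↦ [x₀ : x₁] (1 + t X)`. -/
lemma lift_congAct {M N : Matrix (Fin 2) (Fin 2) A} (hM : IsUnit (1 + t • M).det)
    (hN : IsUnit N.det) (hNM : IsUnit (N * (1 + t • M)).det) :
    lift (P1.overMap R N hN) (P1.overStr R A ≫ congPt M hM) ≫ congAct t =
      P1.overMap R (N * (1 + t • M)) hNM := by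
  rw [congAct, lift_whiskerLeft_assoc, Category.assoc]
  refine Over.OverMorphism.ext ?_
  refine lift_natActionLeft (algebraMap R A) hM hN hNM
    (p := (lift (P1.overMap R N hN) (P1.overStr R A ≫ congPt M hM ≫ congGroupToGL2 t)).left)
    (congrArg Over.Hom.left (lift_fst _ _)) ?_
  refine (congrArg Over.Hom.left (lift_snd _ _)).trans ?_
  rw [Over.comp_left, congPt_toGL2_left]
  rfl

lemma CongRing.flat : (algebraMap R (CongRing t)).Flat := by
  have h1 : Module.Flat (MvPolynomial (Fin 2 × Fin 2) R) (CongRing t) :=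
    IsLocalization.flat _ (Submonoid.powers (congDet t))
  have : Module.Flat R (CongRing t) := Module.Flat.trans R (MvPolynomial (Fin 2 × Fin 2) R) _
  exact (RingHom.flat_algebraMap_iff).mpr this

lemma CongRing.flat_tensorProduct : (algebraMap R (CongRing t ⊗[R] CongRing t)).Flat := by
  have h1 : Module.Flat R (CongRing t) := (RingHom.flat_algebraMap_iff).mp CongRing.flat
  exact (RingHom.flat_algebraMap_iff).mpr inferInstance

lemma isIso_overHomMk {X Y S : Scheme.{u}} {f : X ⟶ S} {g : Y ⟶ S} (l : X ⟶ Y) (w : l ≫ g = f)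
    [hl : IsIso l] : IsIso (Over.homMk l w : Over.mk f ⟶ Over.mk g) := by
  have h3 : IsIso ((Over.forget S).map (Over.homMk l w : Over.mk f ⟶ Over.mk g)) := hl
  exact isIso_of_reflects_iso _ (Over.forget _)

lemma P1.isIso_map_algebraMap (h : IsUnit (1 : Matrix (Fin 2) (Fin 2) R).det) :
    IsIso (P1.map (algebraMap R R) 1 h) := by
  have h1 := P1.map_id_one h
  rw [← Algebra.algebraMap_self] at h1
  rw [h1]
  exact IsIso.id _

lemma P1.isIso_overMap (h : IsUnit (1 : Matrix (Fin 2) (Fin 2) R).det) :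
    IsIso (P1.overMap R (1 : Matrix (Fin 2) (Fin 2) R) h) :=
  isIso_overHomMk (P1.map (algebraMap R R) 1 h) (P1.map_hom _ _ _) (hl := P1.isIso_map_algebraMap h)

lemma P1.overMap_whiskerLeft_one (h : IsUnit (1 : Matrix (Fin 2) (Fin 2) R).det)
    (h0 : IsUnit (1 + t • (0 : Matrix (Fin 2) (Fin 2) R)).det) :
    P1.overMap R (1 : Matrix (Fin 2) (Fin 2) R) h ≫ (ρ_ (P1 R)).inv ≫ P1 R ◁ η[congGroup t] =
      lift (P1.overMap R (1 : Matrix (Fin 2) (Fin 2) R) h)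
        (P1.overStr R R ≫ congPt (0 : Matrix (Fin 2) (Fin 2) R) h0) := by
  have h2 : P1.overStr R R ≫ congPt (0 : Matrix (Fin 2) (Fin 2) R) h0 =
      toUnit _ ≫ η[congGroup t] := by
    rw [← toUnit_one_eq_congPt, comp_toUnit_assoc]
  rw [h2]
  ext1
  · simp
  · rw [lift_snd, Category.assoc, Category.assoc, whiskerLeft_snd, rightUnitor_inv_snd_assoc,
      comp_toUnit_assoc]

lemma congAct_one : P1 R ◁ η[congGroup t] ≫ congAct t = (ρ_ (P1 R)).hom := by
  have h : IsUnit (1 : Matrix (Fin 2) (Fin 2) R).det := by simp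
  have h0 : IsUnit (1 + t • (0 : Matrix (Fin 2) (Fin 2) R)).det := by simp
  have h0' : IsUnit (1 * (1 + t • (0 : Matrix (Fin 2) (Fin 2) R))).det := by simp
  have := P1.isIso_overMap h
  rw [← cancel_epi (ρ_ (P1 R)).inv, Iso.inv_hom_id, ← cancel_epi (P1.overMap R 1 h),
    Category.comp_id, reassoc_of% P1.overMap_whiskerLeft_one h h0, lift_congAct h0 h h0']
  exact P1.overMap_congr (by simp) _ _

lemma isIso_lift_congPt {X₁ X₂ : Matrix (Fin 2) (Fin 2) (CongRing t ⊗[R] CongRing t)}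
    (h₁ : IsUnit (1 + t • X₁).det) (h₂ : IsUnit (1 + t • X₂).det)
    (e₁ : CongRing.lift X₁ h₁ = Algebra.TensorProduct.includeLeft)
    (e₂ : CongRing.lift X₂ h₂ = Algebra.TensorProduct.includeRight) :
    IsIso (lift (congPt X₁ h₁) (congPt X₂ h₂)) := by
  have h : (lift (congPt X₁ h₁) (congPt X₂ h₂)).left =
      (pullbackSpecIso R (CongRing t) (CongRing t)).inv := by
    refine pullback.hom_ext ((congrArg Over.Hom.left (lift_fst _ _)).trans ?_)
      ((congrArg Over.Hom.left (lift_snd _ _)).trans ?_)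
    · rw [congPt_left, e₁]
      exact (pullbackSpecIso_inv_fst R (CongRing t) (CongRing t)).symm
    · rw [congPt_left, e₂]
      exact (pullbackSpecIso_inv_snd R (CongRing t) (CongRing t)).symm
  have h3 : IsIso ((Over.forget (Spec (.of R))).map
      (lift (congPt X₁ h₁) (congPt X₂ h₂))) := by
    change IsIso (lift (congPt X₁ h₁) (congPt X₂ h₂)).left
    rw [h]
    exact Iso.isIso_inv _
  exact isIso_of_reflects_iso _ (Over.forget _)

/-- Since `P¹ × G × G` is the projective line over the coordinate ring of `G × G`, it suffices to
compare the two actions of the pair of universal matrices. -/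
lemma congAct_mul : P1 R ◁ μ[congGroup t] ≫ congAct t =
    (α_ (P1 R) (congGroup t) (congGroup t)).inv ≫ congAct t ▷ congGroup t ≫ congAct t := by
  let S := CongRing t ⊗[R] CongRing t
  let X₁ : Matrix (Fin 2) (Fin 2) S :=
    (Algebra.TensorProduct.includeLeft (R := R) (S := R)).mapMatrix (CongRing.univ t)
  let X₂ : Matrix (Fin 2) (Fin 2) S :=
    (Algebra.TensorProduct.includeRight (R := R)).mapMatrix (CongRing.univ t)
  have hX₁ : IsUnit (1 + t • X₁).det := CongRing.isUnit_det_map _ CongRing.isUnit_det_univ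
  have hX₂ : IsUnit (1 + t • X₂).det := CongRing.isUnit_det_map _ CongRing.isUnit_det_univ
  have i1 : IsIso (lift (congPt X₁ hX₁) (congPt X₂ hX₂)) := isIso_lift_congPt hX₁ hX₂
    (CongRing.hom_ext (CongRing.lift_univ _ _)) (CongRing.hom_ext (CongRing.lift_univ _ _))
  have hone : IsUnit (1 : Matrix (Fin 2) (Fin 2) S).det := by simp
  have i2 := P1.isIso_lift_overStr (CongRing.flat_tensorProduct (t := t)) hone
  have i3 : IsIso (lift (P1.overMap R 1 hone) (P1.overStr R S) ≫
    P1 R ◁ lift (congPt X₁ hX₁) (congPt X₂ hX₂)) := inferInstance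
  rw [← cancel_epi (lift (P1.overMap R 1 hone) (P1.overStr R S) ≫
    P1 R ◁ lift (congPt X₁ hX₁) (congPt X₂ hX₂))]
  have h1 : (lift (P1.overMap R 1 hone) (P1.overStr R S) ≫
      P1 R ◁ lift (congPt X₁ hX₁) (congPt X₂ hX₂)) ≫ (α_ _ _ _).inv =
      lift (lift (P1.overMap R 1 hone) (P1.overStr R S ≫ congPt X₁ hX₁))
        (P1.overStr R S ≫ congPt X₂ hX₂) := by
    ext1
    · ext1 <;> simp
    · simp
  rw [← Category.assoc _ (α_ _ _ _).inv, h1, lift_whiskerRight_assoc,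
    lift_congAct hX₁ hone (by simpa), lift_congAct hX₂ _ (by
      rw [_root_.one_mul, Matrix.det_mul]; exact hX₁.mul hX₂),
    lift_whiskerLeft, lift_whiskerLeft_assoc, Category.assoc, lift_congPt_mul,
    lift_congAct _ _ (by rw [_root_.one_mul]; exact CongRing.isUnit_det_mulMat hX₁ hX₂)]
  exact P1.overMap_congr (by rw [_root_.one_mul, _root_.one_mul, CongRing.one_add_mulMat]) _ _

/-- The congruence group acts on the projective line. -/
lemma isRightAction_congAct : IsRightAction (congAct t) := ⟨congAct_one, congAct_mul⟩

end ActionOnP1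

/-! ### Triviality of the action modulo `t` -/

section CongruenceOnP1
open MvPolynomial
attribute [local instance] MvPolynomial.gradedAlgebra

variable {R A : Type u} [CommRing R] [CommRing A]

lemma iSup_basicOpen_coord :
    ⨆ j : Fin 2, Proj.basicOpen (coordGrading A) (X j) = ⊤ := by
  refine Proj.iSup_basicOpen_eq_top _ _ ?_
  have h := irrelevant_le_of_X_mem (R := A) ⟨Ideal.span (Set.range X),
    Ideal.homogeneous_span _ _ (by rintro _ ⟨i, rfl⟩; exact ⟨1, isHomogeneous_coord i⟩)⟩
    fun i ↦ Ideal.subset_span ⟨i, rfl⟩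
  exact h

/-- Locally, a morphism to the projective line over `A` factors through the projective line over
the source. -/
lemma exists_projMap_factorization {Y : Scheme.{u}} (h : Y ⟶ Proj (coordGrading A)) (y : Y) :
    ∃ W : Y.affineOpens, y ∈ W.1 ∧ ∃ l : Spec Γ(Y, W) ⟶ Proj (coordGrading Γ(Y, W)),
      (isAffineOpen_coe W).fromSpec ≫ h =
        l ≫ Proj.map (linearSubst (structHom (h ≫ projStr (coordGrading A)) W) 1)
          (irrelevant_le_linearSubst _ (by simp)) := by
  obtain ⟨j, hj⟩ := TopologicalSpace.Opens.mem_iSup.mp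
    (iSup_basicOpen_coord.ge (Set.mem_univ (h y)))
  rw [← Proj.opensRange_awayι _ _ (isHomogeneous_coord j) one_pos] at hj
  obtain ⟨W, hyW, hW⟩ := exists_affineOpens_mem_le y (V := h ⁻¹ᵁ
    (Proj.awayι (coordGrading A) (X j) (isHomogeneous_coord j) one_pos).opensRange) hj
  refine ⟨W, hyW, ?_⟩
  let l := IsOpenImmersion.lift (Proj.awayι (coordGrading A) (X j) (isHomogeneous_coord j) one_pos)
    ((isAffineOpen_coe W).fromSpec ≫ h) (by
    rintro _ ⟨q, rfl⟩
    rw [Scheme.Hom.comp_apply]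
    refine hW ?_
    have := (isAffineOpen_coe W).range_fromSpec
    exact this.le ⟨_, rfl⟩)
  have hl : l ≫ Proj.awayι (coordGrading A) (X j) (isHomogeneous_coord j) one_pos =
    (isAffineOpen_coe W).fromSpec ≫ h := IsOpenImmersion.lift_fac _ _ _
  obtain ⟨ψ, hψ⟩ : ∃ ψ : Away (coordGrading A) (X j) →+* Γ(Y, W),
    Spec.map (CommRingCat.ofHom ψ) = l := ⟨(Spec.preimage l).hom, Spec.map_preimage l⟩
  have hψA : ψ.comp (awayStr _ _) = structHom (h ≫ projStr (coordGrading A)) W := by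
    have h1 : CommRingCat.ofHom (ψ.comp (awayStr (coordGrading A) (X j))) =
        CommRingCat.ofHom (structHom (h ≫ projStr (coordGrading A)) W) := by
      apply Spec.map_injective
      rw [← fromSpec_comp, ← reassoc_of% hl, CommRingCat.ofHom_comp, Spec.map_comp, hψ,
        ← awayι_projStr one_pos (isHomogeneous_coord j)]
    exact congr(($h1).hom)
  obtain ⟨ψ', hψ'⟩ := exists_comp_awayMap _ j ψ hψA
  refine ⟨Spec.map (CommRingCat.ofHom ψ') ≫ Proj.awayι (coordGrading Γ(Y, W))
    (linearSubst (structHom (h ≫ projStr (coordGrading A)) W) 1 (X j))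
    ((linearSubst (structHom (h ≫ projStr (coordGrading A)) W) 1).2 (isHomogeneous_coord j))
    one_pos, ?_⟩
  rw [← hl, ← hψ, ← hψ', CommRingCat.ofHom_comp, Spec.map_comp, Category.assoc, Category.assoc]
  congr 1
  exact (Proj.awayι_comp_map _ _ one_pos _ (isHomogeneous_coord j)).symm

lemma P1.exists_factorization {Y : Scheme.{u}} (h : Y ⟶ (P1 A).left) (y : Y) :
    ∃ W : Y.affineOpens, y ∈ W.1 ∧ ∃ l : Spec Γ(Y, W) ⟶ (P1 Γ(Y, W)).left,
      (isAffineOpen_coe W).fromSpec ≫ h = l ≫ P1.baseMap (structHom (h ≫ (P1 A).hom) W) :=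
  exists_projMap_factorization h y

/-- The restriction of `P1.map f M` to a scheme `Y` over the projective line over `A` depends only
on the image of `M` in the rings of functions of `Y`. -/
lemma P1.comp_map_congr {Y : Scheme.{u}} (h : Y ⟶ (P1 A).left) (f : R →+* A)
    {M N : Matrix (Fin 2) (Fin 2) A} (hM : IsUnit M.det) (hN : IsUnit N.det)
    (H : ∀ W : Y.affineOpens, (structHom (h ≫ (P1 A).hom) W).mapMatrix M =
      (structHom (h ≫ (P1 A).hom) W).mapMatrix N) :
    h ≫ P1.map f M hM = h ≫ P1.map f N hN := by
  refine hom_ext_of_affineOpens _ _ fun y ↦ ?_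
  obtain ⟨W, hy, l, hl⟩ := P1.exists_factorization h y
  refine ⟨W, hy, ?_⟩
  have hN' : IsUnit ((structHom (h ≫ (P1 A).hom) W).mapMatrix N).det := by
    rw [← RingHom.map_det]
    exact hN.map _
  rw [reassoc_of% hl, reassoc_of% hl, P1.baseMap_comp_map f hM _ hN' (H W),
    P1.baseMap_comp_map f hN _ hN' rfl]

open MonoidalCategory CartesianMonoidalCategory

variable (t : R)

lemma mapMatrix_one_add_smul_of_eq_zero {D : Type u} [CommRing D] [Algebra R A] (χ : A →+* D)
    {t : R} (ht : χ (algebraMap R A t) = 0) (M : Matrix (Fin 2) (Fin 2) A) :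
    χ.mapMatrix (1 * (1 + t • M)) = χ.mapMatrix 1 := by
  ext i j
  rw [one_mul, RingHom.mapMatrix_apply, Matrix.map_apply, Matrix.add_apply, Matrix.smul_apply,
    Algebra.smul_def, map_add, map_mul, ht, zero_mul, add_zero]
  rfl

lemma congPt_univ : congPt (CongRing.univ t) CongRing.isUnit_det_univ = 𝟙 (congGroup t) := by
  have h : CongRing.lift (CongRing.univ t) CongRing.isUnit_det_univ =
      AlgHom.id R (CongRing t) := CongRing.hom_ext (CongRing.lift_univ _ _)
  refine Over.OverMorphism.ext ?_
  rw [congPt_left, h]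
  exact Spec.map_id _

/-- The congruence group `1 + t X` acts trivially on the projective line modulo `t`. -/
lemma congrMod_congAct : CongrMod t (P1 R ⊗ congGroup t).hom (congAct t).left
    (fst (P1 R) (congGroup t)).left := by
  intro C _ ψ hψ h hh
  have hone : IsUnit (1 : Matrix (Fin 2) (Fin 2) (CongRing t)).det := by simp
  have hone' : IsUnit (1 * (1 + t • CongRing.univ t)).det := by
    rw [one_mul]; exact CongRing.isUnit_det_univ
  obtain ⟨p, hp⟩ : ∃ p : P1.over R (CongRing t) ⟶ P1 R ⊗ congGroup t,
    p = lift (P1.overMap R 1 hone) (P1.overStr R (CongRing t)) := ⟨_, rfl⟩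
  have hp' : IsIso p := hp ▸ P1.isIso_lift_overStr CongRing.flat hone
  have h1 : p ≫ congAct t = P1.overMap R (1 * (1 + t • CongRing.univ t)) hone' := by
    rw [← lift_congAct CongRing.isUnit_det_univ hone hone', congPt_univ, hp]
    exact congrArg (CartesianMonoidalCategory.lift _ · ≫ _) (Category.comp_id _).symm
  have h2 : p ≫ fst _ _ = P1.overMap R 1 hone := by rw [hp]; exact lift_fst _ _
  obtain ⟨h', rfl⟩ : ∃ h', h = h' ≫ p.left := ⟨h ≫ (inv p).left, by
    rw [Category.assoc, ← Over.comp_left, IsIso.inv_hom_id, Over.id_left, Category.comp_id]⟩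
  rw [Category.assoc, Category.assoc, ← Over.comp_left, ← Over.comp_left, h1, h2]
  refine P1.comp_map_congr h' (algebraMap R (CongRing t)) hone' hone fun W ↦ ?_
  have h4 : (h' ≫ (P1 (CongRing t)).hom) ≫
      Spec.map (CommRingCat.ofHom (algebraMap R (CongRing t))) =
      Spec.map (CommRingCat.ofHom ψ) := by
    refine Eq.trans ?_ hh
    rw [Category.assoc h' p.left]
    exact (Category.assoc _ _ _).trans (congrArg (h' ≫ ·) (Over.w p).symm)
  have h5 : structHom (h' ≫ (P1 (CongRing t)).hom) W (algebraMap R (CongRing t) t) = 0 := by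
    have h6 := structHom_comp_SpecMap ψ (𝟙 _) W
    rw [Category.id_comp, ← h4, structHom_comp_SpecMap] at h6
    exact (congr($h6 t)).trans (by rw [RingHom.comp_apply, hψ, map_zero])
  exact mapMatrix_one_add_smul_of_eq_zero _ h5 _

end CongruenceOnP1

/-! ### The action on the models -/

section Models
open MonoidalCategory CartesianMonoidalCategory MonObj

variable {O : Type u} [CommRing O] (ϖ : O)

lemma mem_zeroLocus_of_mem_smoothRationalPoints (X : Over (Spec (.of O))) {x : X.left}
    (hx : x ∈ smoothRationalPoints ϖ X) :
    X.hom x ∈ (PrimeSpectrum.zeroLocus {ϖ} : Set (PrimeSpectrum O)) := by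
  obtain ⟨y, -, -, rfl, -⟩ := hx
  let z : Spec (.of (Res ϖ)) := pullback.snd X.hom (specRes ϖ) y
  have h1 : X.hom (specialFibreι ϖ X y) = specRes ϖ z :=
    congr($(pullback.condition (f := X.hom) (g := specRes ϖ)) y)
  rw [h1]
  refine (PrimeSpectrum.mem_zeroLocus _ _).mpr (Set.singleton_subset_iff.mpr ?_)
  change Ideal.Quotient.mk (Ideal.span {ϖ}) ϖ ∈ PrimeSpectrum.asIdeal z
  rw [Ideal.Quotient.eq_zero_iff_mem.mpr (Ideal.mem_span_singleton_self ϖ)]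
  exact Ideal.zero_mem _

/-- The centre of the blow-up lies in the special fibre. -/
lemma structHom_mem_centre (X : Over (Spec (.of O))) (U : X.left.affineOpens) :
    structHom X.hom U ϖ ∈ (centre ϖ X).ideal U := by
  rw [centre, Scheme.IdealSheafData.vanishingIdeal_ideal, PrimeSpectrum.mem_vanishingIdeal]
  intro (q : Spec Γ(X.left, U)) hq
  have hcl : closure (smoothRationalPoints ϖ X) ⊆
      X.hom ⁻¹' (PrimeSpectrum.zeroLocus {ϖ} : Set (PrimeSpectrum O)) :=
    closure_minimal (fun x hx ↦ mem_zeroLocus_of_mem_smoothRationalPoints ϖ X hx)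
      ((PrimeSpectrum.isClosed_zeroLocus {ϖ}).preimage X.hom.continuous)
  have h1 : X.hom ((isAffineOpen_coe U).fromSpec q) ∈
    (PrimeSpectrum.zeroLocus {ϖ} : Set (PrimeSpectrum O)) := hcl hq
  rw [← Scheme.Hom.comp_apply, fromSpec_comp] at h1
  let z : Spec (.of O) := Spec.map (CommRingCat.ofHom (structHom X.hom U)) q
  have h2 : ϖ ∈ PrimeSpectrum.asIdeal z :=
    Set.singleton_subset_iff.mp ((PrimeSpectrum.mem_zeroLocus z _).mp h1)
  exact h2

instance isSeparated_pr (n : ℕ) : IsSeparated (pr ϖ n).left := by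
  induction n with
  | zero => exact inferInstanceAs (IsSeparated (𝟙 _))
  | succ n ih =>
    have := ih
    exact inferInstanceAs (IsSeparated (blowUpToBase (centre ϖ (model ϖ n)) ≫ (pr ϖ n).left))

instance flat_model [IsDedekindDomain O] (n : ℕ) : Flat (model ϖ n).hom := by
  induction n with
  | zero => exact inferInstanceAs (Flat (P1 O).hom)
  | succ n ih => exact flat_blowUp (centre ϖ (model ϖ n)) (model ϖ n).hom

variable {L : Type u} [CommRing L] {j : O →+* L} (hj : Function.Injective j) (hϖ : IsUnit (j ϖ))

include hϖ in
lemma genericallyMono_pr (n : ℕ) : GenericallyMono j (pr ϖ n).left (P1 O).hom := by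
  induction n with
  | zero => exact fun T a b r _ h ↦ (Category.comp_id _).symm.trans (h.trans (Category.comp_id _))
  | succ n ih =>
    have h1 := genericallyMono_blowUp (centre ϖ (model ϖ n)) (model ϖ n).hom
      (structHom_mem_centre ϖ (model ϖ n)) hϖ
    rw [← Over.w (pr ϖ n)] at h1
    exact h1.comp ih

variable {ϖ}

include hj hϖ in
/-- Morphisms from a flat scheme to a model are determined by their composites with `pr`. -/
lemma hom_ext_of_comp_pr {n : ℕ} {Z : Over (Spec (.of O))} [hZ : Flat Z.hom]
    {f g : Z ⟶ model ϖ n} (h : f ≫ pr ϖ n = g ≫ pr ϖ n) : f = g := by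
  refine Over.OverMorphism.ext ?_
  have hflat : Flat (f.left ≫ (pr ϖ n).left ≫ (P1 O).hom) := by
    rw [Over.w, Over.w]; exact hZ
  exact (genericallyMono_pr ϖ hϖ n).hom_ext hj (congrArg Over.Hom.left h)

instance flat_tensorObj (X Y : Over (Spec (.of O))) [Flat X.hom] [Flat Y.hom] :
    Flat (X ⊗ Y).hom :=
  inferInstanceAs (Flat (pullback.fst X.hom Y.hom ≫ X.hom))

instance flat_tensorUnit : Flat (𝟙_ (Over (Spec (.of O)))).hom :=
  inferInstanceAs (Flat (𝟙 (Spec (.of O))))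

instance flat_congGroup (t : O) : Flat (congGroup t).hom := by
  have h : Flat (Spec.map (CommRingCat.ofHom (algebraMap O (CongRing t)))) :=
    Flat.SpecMap_iff.mpr CongRing.flat
  exact h

lemma CongrMod.comp {X Y Z : Over (Spec (.of O))} {a : O} {f g : Y ⟶ X}
    (h : CongrMod a Y.hom f.left g.left) (k : Z ⟶ Y) :
    CongrMod a Z.hom (k ≫ f).left (k ≫ g).left := fun C _ ψ hψ l hl ↦ by
  rw [Over.comp_left, Over.comp_left, ← Category.assoc, ← Category.assoc]
  refine h ψ hψ (l ≫ k.left) ?_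
  rw [Category.assoc, Over.w, hl]

include hj hϖ in
/-- The lift of the action to the `n`-th model. Each blow-up costs one factor `ϖ` in the
congruence between the action and the projection. -/
lemma exists_model_action [IsDedekindDomain O] {n k : ℕ} (hnk : n ≤ k) :
    ∃ σ : model ϖ n ⊗ congGroup (ϖ ^ k) ⟶ model ϖ n,
      σ ≫ pr ϖ n = pr ϖ n ▷ congGroup (ϖ ^ k) ≫ congAct (ϖ ^ k) ∧
      CongrMod (ϖ ^ (k - n)) (model ϖ n ⊗ congGroup (ϖ ^ k)).hom σ.left
        (fst (model ϖ n) (congGroup (ϖ ^ k))).left := by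
  induction n with
  | zero =>
    refine ⟨congAct (ϖ ^ k), ?_, congrMod_congAct _⟩
    change congAct (ϖ ^ k) ≫ 𝟙 _ = 𝟙 _ ▷ _ ≫ _
    rw [id_whiskerRight, Category.comp_id, Category.id_comp]
  | succ n ih =>
    obtain ⟨σ, hσ, hc⟩ := ih (by omega)
    obtain ⟨m, hm⟩ : ∃ m, m = k - (n + 1) := ⟨_, rfl⟩
    rw [← hm]
    rw [show k - n = m + 1 by omega] at hc
    let G := congGroup (ϖ ^ k)
    let Y := model ϖ (n + 1) ⊗ G
    let π : model ϖ (n + 1) ⟶ model ϖ n := blowUpPointsProj ϖ (model ϖ n)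
    have h1 := hc.comp (π ▷ G)
    rw [whiskerRight_fst] at h1
    obtain ⟨f', hf', hcf⟩ := CongrMod.exists_lift (centre ϖ (model ϖ n)) (s := (model ϖ n).hom)
      (t := Y.hom) (f := (π ▷ G ≫ σ).left) (g' := (fst (model ϖ (n + 1)) G).left) (m := m) hj hϖ
      h1 (structHom_mem_centre ϖ (model ϖ n)) (Over.w (π ▷ G ≫ σ))
      (Over.w (fst (model ϖ (n + 1)) G ≫ π))
    have hw : f' ≫ (model ϖ (n + 1)).hom = Y.hom := by
      have h2 : f' ≫ (model ϖ (n + 1)).hom = (f' ≫ π.left) ≫ (model ϖ n).hom :=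
        (Category.assoc _ _ _).symm
      rw [h2]
      exact congr($hf' ≫ _).trans (Over.w (π ▷ G ≫ σ))
    refine ⟨Over.homMk f' hw, ?_, hcf⟩
    have h3 : (Over.homMk f' hw : Y ⟶ model ϖ (n + 1)) ≫ π = π ▷ G ≫ σ :=
      Over.OverMorphism.ext hf'
    change (Over.homMk f' hw : Y ⟶ model ϖ (n + 1)) ≫ π ≫ pr ϖ n = (π ≫ pr ϖ n) ▷ G ≫ _
    rw [reassoc_of% h3, hσ, comp_whiskerRight, Category.assoc]

include hj hϖ in
/-- A lift of the action of the congruence group on the projective line to a model is an action. -/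
lemma isRightAction_of_comp_pr [IsDedekindDomain O] {n : ℕ} {t : O}
    {σ : model ϖ n ⊗ congGroup t ⟶ model ϖ n}
    (hσ : σ ≫ pr ϖ n = pr ϖ n ▷ congGroup t ≫ congAct t) : IsRightAction σ where
  one := by
    refine hom_ext_of_comp_pr hj hϖ ?_
    rw [Category.assoc, hσ, whisker_exchange_assoc, isRightAction_congAct.one,
      rightUnitor_naturality]
  mul := by
    refine hom_ext_of_comp_pr hj hϖ ?_
    rw [Category.assoc, hσ, whisker_exchange_assoc, isRightAction_congAct.mul]
    simp only [Category.assoc]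
    rw [hσ, ← comp_whiskerRight_assoc, hσ]
    simp

end Models

/-! ### Formal completions, special fibres and generic fibres -/

section MonoidalFunctors
open MonoidalCategory MonObj Functor
universe v v' w w'

open scoped Obj in
/-- A lax monoidal functor maps right actions to right actions. -/
lemma IsRightAction.map {C : Type w} [Category.{v} C] [CartesianMonoidalCategory C]
    {D : Type w'} [Category.{v'} D] [CartesianMonoidalCategory D] (F : C ⥤ D) [F.LaxMonoidal]
    {G X : C} [MonObj G] {σ : X ⊗ G ⟶ X} (h : IsRightAction σ) :
    IsRightAction (C := D) (G := F.obj G) (X := F.obj X) (LaxMonoidal.μ F X G ≫ F.map σ) where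
  one := by
    rw [obj.η_def, MonoidalCategory.whiskerLeft_comp, Category.assoc,
      LaxMonoidal.μ_natural_right_assoc, ← F.map_comp, h.one, ← LaxMonoidal.right_unitality]
  mul := by
    rw [obj.μ_def, MonoidalCategory.whiskerLeft_comp, Category.assoc,
      LaxMonoidal.μ_natural_right_assoc, ← F.map_comp, h.mul, comp_whiskerRight, Category.assoc,
      LaxMonoidal.μ_natural_left_assoc, F.map_comp, F.map_comp]
    simp

end MonoidalFunctors

section Completion
open MonoidalCategory CartesianMonoidalCategory

variable {O : Type u} [CommRing O] (ϖ : O)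

lemma isRightAction_completedAction {X G : Over (Spec (.of O))} [GrpObj G] {σ : X ⊗ G ⟶ X}
    (h : IsRightAction σ) : IsRightAction (completedAction ϖ σ) :=
  h.map (completion ϖ)

variable {ϖ}

lemma CongrMod.comp_eq {X Y : Over (Spec (.of O))} {f g : Y ⟶ X}
    (h : CongrMod ϖ Y.hom f.left g.left) (T : Over (Spec (.of (Res ϖ))))
    (k : (Over.map (specRes ϖ)).obj T ⟶ Y) : k ≫ f = k ≫ g := by
  refine Over.OverMorphism.ext (hom_ext_of_affineOpens (X := X.left) (Y := T.left) _ _ fun y ↦ ?_)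
  obtain ⟨W, hy, -⟩ := exists_affineOpens_mem_le y (V := ⊤) trivial
  refine ⟨W, hy, ?_⟩
  have h1 := h ((structHom T.hom W).comp (Ideal.Quotient.mk (Ideal.span {ϖ})))
    (by rw [RingHom.comp_apply,
      Ideal.Quotient.eq_zero_iff_mem.mpr (Ideal.mem_span_singleton_self ϖ), map_zero])
    ((isAffineOpen_coe W).fromSpec ≫ k.left) (by
      rw [Category.assoc, Over.w, CommRingCat.ofHom_comp, Spec.map_comp, ← fromSpec_comp]
      exact (Category.assoc _ _ _).symm)
  exact (Category.assoc _ _ _).symm.trans (h1.trans (Category.assoc _ _ _))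

/-- An action which is congruent modulo `ϖ` to the projection is trivial on special fibres. -/
lemma trivialOnSpecialFibre_of_congrMod {X G : Over (Spec (.of O))} {σ : X ⊗ G ⟶ X}
    (h : CongrMod ϖ (X ⊗ G).hom σ.left (fst X G).left) :
    TrivialOnSpecialFibre ϖ (completedAction ϖ σ) := by
  have h1 : fst ((completion ϖ).obj X) ((completion ϖ).obj G) =
      completedAction ϖ (fst X G) := (Functor.Monoidal.μ_fst (completion ϖ) X G).symm
  rw [TrivialOnSpecialFibre, h1, completedAction, completedAction, Functor.map_comp,
    Functor.map_comp]
  congr 1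
  ext T k
  exact h.comp_eq T.unop k

end Completion

section GenericFibre
open MonoidalCategory CartesianMonoidalCategory
attribute [local instance] MvPolynomial.gradedAlgebra

variable {O : Type u} [CommRing O] {ϖ : O} {L : Type u} [CommRing L]

/-- Over `L`, where `ϖ` is invertible, the model becomes the projective line. -/
lemma exists_isPullback_model {j : O →+* L} (hj : j.Flat) (hϖ : IsUnit (j ϖ)) (n : ℕ) :
    ∃ i : (P1 L).left ⟶ (model ϖ n).left, i ≫ (pr ϖ n).left = P1.baseMap j ∧
      IsPullback i (P1 L).hom (model ϖ n).hom (Spec.map (CommRingCat.ofHom j)) := by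
  induction n with
  | zero => exact ⟨P1.baseMap j, Category.comp_id _, P1.baseMap_isPullback hj⟩
  | succ n ih =>
    obtain ⟨i, hi, hp⟩ := ih
    have h1 := isIso_pullback_snd_blowUpToBase (centre ϖ (model ϖ n)) (model ϖ n).hom
      (structHom_mem_centre ϖ (model ϖ n)) j hϖ i (P1 L).hom hp.w
    obtain ⟨i', h2⟩ : ∃ i' : (P1 L).left ⟶ blowUp (centre ϖ (model ϖ n)),
        IsPullback i' (𝟙 _) (blowUpToBase (centre ϖ (model ϖ n))) i :=
      ⟨inv (pullback.snd (blowUpToBase (centre ϖ (model ϖ n))) i) ≫ pullback.fst _ _,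
        (IsPullback.of_hasPullback (blowUpToBase (centre ϖ (model ϖ n))) i).of_iso
        (asIso (pullback.snd _ _)) (Iso.refl _) (Iso.refl _) (Iso.refl _)
        (by simp) (by simp) (by simp) (by simp)⟩
    have h3 := h2.w
    have h4 := h2.paste_vert hp
    rw [Category.id_comp] at h3 h4
    refine ⟨i', ?_, h4⟩
    rw [← hi, ← h3]
    exact (Category.assoc _ _ _).symm

lemma mapMatrix_one_add_smul_apply {A D : Type u} [CommRing A] [Algebra O A] [CommRing D]
    (f : A →+* D) (t : O) (M : Matrix (Fin 2) (Fin 2) A) (a b : Fin 2) :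
    f.mapMatrix (1 + t • M) a b = (1 : Matrix (Fin 2) (Fin 2) D) a b +
      f (algebraMap O A t) * f (M a b) := by
  rw [RingHom.map_add, RingHom.map_one, Matrix.add_apply, RingHom.mapMatrix_apply,
    Matrix.map_apply, Matrix.smul_apply, Algebra.smul_def, map_mul]

/-- Where `t` is invertible, `X` is determined by `1 + t X`. -/
lemma CongRing.ringHom_ext {D : Type u} [CommRing D] {t : O} {f g : CongRing t →+* D}
    (h0 : f.comp (algebraMap O _) = g.comp (algebraMap O _)) (ht : IsUnit (f (algebraMap O _ t)))
    (h : f.mapMatrix (1 + t • CongRing.univ t) = g.mapMatrix (1 + t • CongRing.univ t)) :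
    f = g := by
  refine IsLocalization.ringHom_ext (Submonoid.powers (congDet t))
    (MvPolynomial.ringHom_ext (fun r ↦ congr($h0 r)) fun ij ↦ ?_)
  have h1 := congr($h ij.1 ij.2)
  have h2 : f (algebraMap O _ t) = g (algebraMap O _ t) := congr($h0 t)
  rw [mapMatrix_one_add_smul_apply, mapMatrix_one_add_smul_apply, ← h2] at h1
  exact ht.mul_left_cancel (add_left_cancel h1)

/-- Where `t` is invertible, every invertible matrix `U` has the form `1 + t X`. -/
lemma CongRing.exists_hom {B : Type u} [CommRing B] (s : O →+* B) {t : O}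
    (ht : IsUnit (s t)) {U : Matrix (Fin 2) (Fin 2) B} (hU : IsUnit U.det) :
    ∃ α : CongRing t →+* B, α.comp (algebraMap O (CongRing t)) = s ∧
      α.mapMatrix (1 + t • CongRing.univ t) = U ∧
      α.comp (GL2Ring.lift (algebraMap O (CongRing t)) (1 + t • CongRing.univ t)
        CongRing.isUnit_det_univ) = GL2Ring.lift s U hU := by
  let _ : Algebra O B := s.toAlgebra
  obtain ⟨r, hr⟩ := ht.exists_right_inv
  have hN : 1 + t • (r • (U - 1)) = U := by
    have h1 : t • (r • (U - 1)) = (s t * r) • (U - 1) := by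
      rw [mul_smul]; exact (algebraMap_smul B t (r • (U - 1))).symm
    rw [h1, hr, one_smul, add_sub_cancel]
  have hN' : IsUnit (1 + t • (r • (U - 1))).det := by rwa [hN]
  refine ⟨(CongRing.lift _ hN').toRingHom, RingHom.ext (CongRing.lift _ hN').commutes, ?_, ?_⟩
  · refine (CongRing.mapMatrix_one_add_smul (CongRing.lift _ hN') (CongRing.univ t)).trans ?_
    rw [CongRing.lift_univ, hN]
  · rw [lift_comp_GL2Ring_lift]
    congr 1

/-- After inverting `t`, the coordinate ring of the congruence group is that of `GL₂`. -/
lemma isPushout_congRing {j : O →+* L} {t : O} (ht : IsUnit (j t))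
    {α : CongRing t →+* GL2Ring L}
    (hα' : α.comp (algebraMap O _) = (algebraMap L (GL2Ring L)).comp j)
    (hα : α.mapMatrix (1 + t • CongRing.univ t) = GL2Ring.univ L) :
    IsPushout (CommRingCat.ofHom (algebraMap O (CongRing t)))
      (CommRingCat.ofHom j) (CommRingCat.ofHom α)
      (CommRingCat.ofHom (algebraMap L (GL2Ring L))) := by
  have hdet {D : Type u} [CommRing D] (f : CongRing t →+* D) :
      IsUnit (f.mapMatrix (1 + t • CongRing.univ t)).det := by
    rw [← RingHom.map_det]
    exact CongRing.isUnit_det_univ.map f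
  have hcomp {D : Type u} [CommRing D] (f : CongRing t →+* D) (g : L →+* D) :
      (GL2Ring.lift g _ (hdet f)).comp (algebraMap L (GL2Ring L)) = g :=
    RingHom.ext fun r ↦ GL2Ring.lift_algebraMap g _ (hdet f) r
  have huniv {D : Type u} [CommRing D] (f : GL2Ring L →+* D) :
      f.mapMatrix (GL2Ring.univ L) = (f.comp α).mapMatrix (1 + t • CongRing.univ t) := by
    rw [← hα]; rfl
  have hdesc {D : Type u} [CommRing D] (f : CongRing t →+* D) (g : L →+* D)
      (h : f.comp (algebraMap O (CongRing t)) = g.comp j) :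
      (GL2Ring.lift g _ (hdet f)).comp α = f := by
    have h0 : ((GL2Ring.lift g _ (hdet f)).comp α).comp (algebraMap O (CongRing t)) =
        f.comp (algebraMap O (CongRing t)) := by
      rw [RingHom.comp_assoc, hα', ← RingHom.comp_assoc, hcomp, h]
    refine CongRing.ringHom_ext h0 ?_ ?_
    · have h1 := congr($(h0.trans h) t)
      exact h1 ▸ ht.map g
    · rw [← huniv]
      exact Matrix.ext (GL2Ring.lift_univ _ _ (hdet f))
  refine ⟨⟨by rw [← CommRingCat.ofHom_comp, ← CommRingCat.ofHom_comp, hα']⟩,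
    ⟨PushoutCocone.IsColimit.mk _ (fun c ↦ CommRingCat.ofHom
      (GL2Ring.lift c.inr.hom _ (hdet c.inl.hom))) (fun c ↦ ?_) (fun c ↦ ?_) fun c m h₁ h₂ ↦ ?_⟩⟩
  · exact CommRingCat.hom_ext (hdesc _ _ congr(($(c.condition)).hom))
  · exact CommRingCat.hom_ext (hcomp _ _)
  · refine CommRingCat.hom_ext (GL2Ring.hom_ext ?_ ?_)
    · exact congr(($h₂).hom).trans (hcomp _ _).symm
    · refine (huniv m.hom).trans (Eq.trans ?_
        (Matrix.ext (GL2Ring.lift_univ _ _ (hdet c.inl.hom))).symm)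
      exact congr(($h₁).hom.mapMatrix _)

/-- Over `L`, where `t` is invertible, the congruence group becomes `GL₂`. -/
lemma exists_isPullback_congGroup {j : O →+* L} {t : O} (ht : IsUnit (j t)) :
    ∃ i : (GL2 L).left ⟶ (congGroup t).left,
      i ≫ (congGroupToGL2 t).left = GL2.baseMap j ∧
      IsPullback i (GL2 L).hom (congGroup t).hom (Spec.map (CommRingCat.ofHom j)) := by
  obtain ⟨α, hα', hα, h⟩ := CongRing.exists_hom ((algebraMap L (GL2Ring L)).comp j)
    (t := t) (ht.map (algebraMap L (GL2Ring L))) (GL2Ring.isUnit_det_univ (R := L))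
  refine ⟨Spec.map (CommRingCat.ofHom α), ?_, ?_⟩
  · refine (Spec.map_comp _ _).symm.trans ?_
    rw [← CommRingCat.ofHom_comp, h]
    rfl
  · exact isPullback_SpecMap_of_isPushout _ _ _ _ (isPushout_congRing ht hα' hα)

/-- The natural actions over `O` and over `L` are compatible. -/
lemma natActionLeft_baseMap (j : O →+* L) {q : pullback (P1 L).hom (GL2 L).hom ⟶
    pullback (P1 O).hom (Spec.map (CommRingCat.ofHom (algebraMap O (GL2Ring O))))}
    (h₁ : q ≫ pullback.fst _ _ = pullback.fst _ _ ≫ P1.baseMap j)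
    (h₂ : q ≫ pullback.snd _ _ = pullback.snd _ _ ≫ GL2.baseMap j) :
    natActionLeft L ≫ P1.baseMap j = q ≫ natActionLeft O := by
  let e := (P1.baseMap_isPullback (GL2Ring.flat (R := L))).isoPullback
  refine (cancel_epi e.hom).mp ?_
  have h3 : e.hom ≫ natActionLeft L = P1.map (algebraMap L (GL2Ring L)) (GL2Ring.univ L)
      GL2Ring.isUnit_det_univ := Iso.hom_inv_id_assoc _ _
  have h4 : e.hom ≫ pullback.fst _ _ = P1.baseMap (algebraMap L (GL2Ring L)) :=
    IsPullback.isoPullback_hom_fst _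
  have h5 : e.hom ≫ pullback.snd _ _ = (P1 (GL2Ring L)).hom := IsPullback.isoPullback_hom_snd _
  have h6 : IsUnit (1 * GL2Ring.univ L).det := by
    rw [one_mul]; exact GL2Ring.isUnit_det_univ
  have h7 := lift_natActionLeft ((algebraMap L (GL2Ring L)).comp j) GL2Ring.isUnit_det_univ
    (N := 1) (by simp) h6 (p := e.hom ≫ q)
    ((Category.assoc _ _ _).trans (congr(e.hom ≫ $h₁).trans
      ((Category.assoc _ _ _).symm.trans (congr($h4 ≫ _).trans
        (P1.baseMap_comp_map _ _ _ (by simp) (map_one _))))))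
    ((Category.assoc _ _ _).trans (congr(e.hom ≫ $h₂).trans
      ((Category.assoc _ _ _).symm.trans congr($h5 ≫ _))))
  refine (Category.assoc _ _ _).symm.trans (congr($h3 ≫ _).trans (Eq.trans ?_
    (h7.symm.trans (Category.assoc _ _ _))))
  rw [P1.baseMap, P1.map_comp]
  exact P1.map_congr rfl (by rw [map_one, one_mul, mul_one]) _ _

lemma GL2.baseMap_hom (j : O →+* L) :
    GL2.baseMap j ≫ (GL2 O).hom = (GL2 L).hom ≫ Spec.map (CommRingCat.ofHom j) := by
  refine (Spec.map_comp _ _).symm.trans (Eq.trans ?_ (Spec.map_comp _ _))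
  rw [← CommRingCat.ofHom_comp, ← CommRingCat.ofHom_comp]
  congr 2
  exact RingHom.ext fun r ↦ GL2Ring.lift_algebraMap _ _ GL2Ring.isUnit_det_univ r

lemma overPullback_map_left_fst {S T : Scheme.{u}} (j : T ⟶ S) {X Y : Over S} (f : X ⟶ Y) :
    ((Over.pullback j).map f).left ≫ pullback.fst Y.hom j =
      pullback.fst X.hom j ≫ f.left :=
  pullback.lift_fst _ _ _

lemma overPullback_μ_left_fst {S T : Scheme.{u}} (j : T ⟶ S) (X Y : Over S) :
    (Functor.LaxMonoidal.μ (Over.pullback j) X Y).left ≫ pullback.fst (X ⊗ Y).hom j ≫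
      (fst X Y).left = (fst ((Over.pullback j).obj X) ((Over.pullback j).obj Y)).left ≫
        pullback.fst X.hom j := by
  rw [← overPullback_map_left_fst, ← Category.assoc, ← Over.comp_left, Functor.Monoidal.μ_fst]

lemma overPullback_μ_left_snd {S T : Scheme.{u}} (j : T ⟶ S) (X Y : Over S) :
    (Functor.LaxMonoidal.μ (Over.pullback j) X Y).left ≫ pullback.fst (X ⊗ Y).hom j ≫
      (snd X Y).left = (snd ((Over.pullback j).obj X) ((Over.pullback j).obj Y)).left ≫
        pullback.fst Y.hom j := by
  rw [← overPullback_map_left_fst, ← Category.assoc, ← Over.comp_left, Functor.Monoidal.μ_snd]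

/-- A morphism `σ` over `O` that lies over the natural action of `GL₂` on the projective line
induces the natural action over `L`, in terms of isomorphisms over `L` that lie
over `π` and `γ`. -/
lemma comp_natAction_of_comp {j : O →+* L} (hL : j.Flat) {X G : Over (Spec (.of O))}
    {π : X ⟶ P1 O} {γ : G ⟶ GL2 O} {σ : X ⊗ G ⟶ X} (hσ : σ ≫ π = (π ⊗ₘ γ) ≫ natAction O)
    {e : (Over.pullback (Spec.map (CommRingCat.ofHom j))).obj X ⟶ P1 L}
    {e' : (Over.pullback (Spec.map (CommRingCat.ofHom j))).obj G ⟶ GL2 L}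
    (he : e.left ≫ P1.baseMap j = pullback.fst X.hom (Spec.map (CommRingCat.ofHom j)) ≫ π.left)
    (he' : e'.left ≫ GL2.baseMap j =
      pullback.fst G.hom (Spec.map (CommRingCat.ofHom j)) ≫ γ.left) :
    Functor.LaxMonoidal.μ (Over.pullback (Spec.map (CommRingCat.ofHom j))) X G ≫
      (Over.pullback (Spec.map (CommRingCat.ofHom j))).map σ ≫ e = (e ⊗ₘ e') ≫ natAction L := by
  refine Over.OverMorphism.ext ((P1.baseMap_isPullback hL).hom_ext ?_
    ((Over.w _).trans (Over.w _).symm))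
  let q : (P1 L ⊗ GL2 L).left ⟶ (P1 O ⊗ GL2 O).left :=
    pullback.map (P1 L).hom (GL2 L).hom (P1 O).hom (GL2 O).hom (P1.baseMap j) (GL2.baseMap j)
      (Spec.map (CommRingCat.ofHom j)) (P1.baseMap_isPullback hL).w.symm
      (GL2.baseMap_hom _).symm
  have hq₁ : q ≫ (fst (P1 O) (GL2 O)).left = (fst (P1 L) (GL2 L)).left ≫ P1.baseMap j :=
    pullback.lift_fst _ _ _
  have hq₂ : q ≫ (snd (P1 O) (GL2 O)).left = (snd (P1 L) (GL2 L)).left ≫ GL2.baseMap j :=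
    pullback.lift_snd _ _ _
  have h1 : (natAction L).left ≫ P1.baseMap j = q ≫ (natAction O).left :=
    natActionLeft_baseMap j hq₁ hq₂
  have h2 : (Functor.LaxMonoidal.μ (Over.pullback (Spec.map (CommRingCat.ofHom j))) X G).left ≫
      pullback.fst _ _ ≫ (π ⊗ₘ γ).left = (e ⊗ₘ e').left ≫ q := by
    refine pullback.hom_ext (f := (P1 O).hom) (g := (GL2 O).hom) ?_ ?_
    · change _ ≫ (fst (P1 O) (GL2 O)).left = _ ≫ (fst (P1 O) (GL2 O)).left
      rw [Category.assoc, Category.assoc, Category.assoc, hq₁, ← Over.comp_left,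
        ← Over.comp_left_assoc, tensorHom_fst, tensorHom_fst, Over.comp_left, Over.comp_left,
        Category.assoc, he, reassoc_of% overPullback_μ_left_fst]
    · change _ ≫ (snd (P1 O) (GL2 O)).left = _ ≫ (snd (P1 O) (GL2 O)).left
      rw [Category.assoc, Category.assoc, Category.assoc, hq₂, ← Over.comp_left,
        ← Over.comp_left_assoc, tensorHom_snd, tensorHom_snd, Over.comp_left, Over.comp_left,
        Category.assoc, he', reassoc_of% overPullback_μ_left_snd]
  have h3 : σ.left ≫ π.left = (π ⊗ₘ γ).left ≫ (natAction O).left := congrArg Over.Hom.left hσ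
  rw [Over.comp_left, Over.comp_left, Over.comp_left, Category.assoc, Category.assoc,
    Category.assoc, he, reassoc_of% overPullback_map_left_fst, h3, h1, ← reassoc_of% h2]

variable [Algebra O L]

lemma extendsNatAction_of_comp_pr (hL : (algebraMap O L).Flat) (hϖ : IsUnit (algebraMap O L ϖ))
    {n k : ℕ} {σ : model ϖ n ⊗ congGroup (ϖ ^ k) ⟶ model ϖ n}
    (hσ : σ ≫ pr ϖ n = pr ϖ n ▷ congGroup (ϖ ^ k) ≫ congAct (ϖ ^ k)) :
    ExtendsNatAction L (pr ϖ n) (congGroupToGL2 (ϖ ^ k)) σ := by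
  obtain ⟨i, hi, hp⟩ := exists_isPullback_model hL hϖ n
  obtain ⟨i', hi', hp'⟩ := exists_isPullback_congGroup (t := ϖ ^ k) (j := algebraMap O L)
    (by rw [map_pow]; exact hϖ.pow k)
  let e : (Over.pullback (Spec.map (CommRingCat.ofHom (algebraMap O L)))).obj (model ϖ n) ≅ P1 L :=
    Over.isoMk hp.isoPullback.symm (by exact hp.isoPullback_inv_snd)
  let e' : (Over.pullback (Spec.map (CommRingCat.ofHom (algebraMap O L)))).obj
      (congGroup (ϖ ^ k)) ≅ GL2 L :=
    Over.isoMk hp'.isoPullback.symm (by exact hp'.isoPullback_inv_snd)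
  have he : e.hom.left ≫ P1.baseMap (algebraMap O L) =
      pullback.fst (model ϖ n).hom (Spec.map (CommRingCat.ofHom (algebraMap O L))) ≫
        (pr ϖ n).left := by
    rw [← hi]
    exact (Category.assoc _ _ _).symm.trans congr($(hp.isoPullback_inv_fst) ≫ _)
  have he' : e'.hom.left ≫ GL2.baseMap (algebraMap O L) =
      pullback.fst (congGroup (ϖ ^ k)).hom (Spec.map (CommRingCat.ofHom (algebraMap O L))) ≫
        (congGroupToGL2 (ϖ ^ k)).left := by
    rw [← hi']
    exact (Category.assoc _ _ _).symm.trans congr($(hp'.isoPullback_inv_fst) ≫ _)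
  refine ⟨e, e', he, he', comp_natAction_of_comp hL ?_ he he'⟩
  rw [hσ, congAct, MonoidalCategory.tensorHom_def, Category.assoc]

end GenericFibre

end BlowupModel

open BlowupModel CategoryTheory MonoidalCategory

theorem proposition2p1 (p : ℕ) [Fact p.Prime] (L : Type u) [Field L] [Algebra ℚ_[p] L]
    [FiniteDimensional ℚ_[p] L] [Algebra ℤ_[p] L] [IsScalarTower ℤ_[p] ℚ_[p] L]
    (ϖ : integralClosure ℤ_[p] L) (hϖ : Irreducible ϖ) (n k : ℕ) (hnk : n ≤ k) :
    ∃ σ : model ϖ n ⊗ congGroup (ϖ ^ k) ⟶ model ϖ n,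
      IsRightAction σ ∧
      ExtendsNatAction L (pr ϖ n) (congGroupToGL2 (ϖ ^ k)) σ ∧
      IsRightAction (completedAction ϖ σ) ∧
      (n < k → TrivialOnSpecialFibre ϖ (completedAction ϖ σ)) := by
  have : IsDedekindDomain (integralClosure ℤ_[p] L) :=
    integralClosure.isDedekindDomain ℤ_[p] ℚ_[p] L
  have hj : Function.Injective (algebraMap (integralClosure ℤ_[p] L) L) :=
    FaithfulSMul.algebraMap_injective _ _
  have hu : IsUnit (algebraMap (integralClosure ℤ_[p] L) L ϖ) :=
    ((map_ne_zero_iff _ hj).mpr hϖ.ne_zero).isUnit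
  have hflat : (algebraMap (integralClosure ℤ_[p] L) L).Flat :=
    RingHom.flat_algebraMap_iff.mpr inferInstance
  obtain ⟨σ, hσ, hc⟩ := exists_model_action hj hu hnk
  have hact := isRightAction_of_comp_pr hj hu hσ
  refine ⟨σ, hact, extendsNatAction_of_comp_pr hflat hu hσ, isRightAction_completedAction ϖ hact,
    fun h ↦ trivialOnSpecialFibre_of_congrMod fun C _ ψ hψ ↦ hc ψ ?_⟩
  rw [map_pow, hψ, zero_pow (Nat.sub_pos_of_lt h).ne']
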